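/- **Setting.** Let $\rho$ be a probability measure on a measurable space $\mathcal X$ (for instance a compact subset of $\mathbb R^d$), and let $\mathcal H_K$ be a separable reproducing kernel Hilbert space of real functions on $\mathcal X$ with norm $\|\cdot\|_K$ and measurable kernel $K$ satisfying $\sup_x\sqrt{K(x,x)}\le\kappa$ (separability and measurability hold, for example, when $K$ is continuous and $\mathcal X$ is compact). Let $L_Kf=\int K(\cdot,x)f(x)\,d\rho(x)$ be its integral operator on $L_2(\rho)$, and let $\mathcal N(\lambda)=\operatorname{Tr}\big((L_K+\lambda I)^{-1}L_K\big)$ be the effective dimension. For $k=0,1,\dots,m$ let $\rho^{(k)}$ be a distribution on $\mathcal X\times\mathbb R$ with marginal $\rho$ on $\mathcal X$ and conditional distribution $\rho^{(k)}_{y|x}$; $k=0$ is the target and $k\ge1$ are the sources. Assume that the regression function $f^{(k)}(x)=\int y\,d\rho^{(k)}_{y|x}$ lies in $\mathcal H_K$. For each $k$ we observe $n_k$ points $(x_i^{(k)},y_i^{(k)})$ i.i.d. from $\rho^{(k)}$, all samples being independent, with $n_0\ge2$. For $h>0$ put $\mathcal A_h=\{1\le k\le m:\|f^{(0)}-f^{(k)}\|_K\le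 h\}$, $n_{\mathcal A_h}=\sum_{k\in\mathcal A_h}n_k$, $N=n_{\mathcal A_h}+n_0$ and $m_h=|\mathcal A_h|+1$. The two-step estimator is $\hat f=\hat f^p+\hat f^{de}$, where $$\hat f^p=\operatorname*{argmin}_{f\in\mathcal H_K}\Big\{\frac1N\sum_{k\in\{0\}\cup\mathcal A_h}\sum_{i=1}^{n_k}\big(f(x_i^{(k)})-y_i^{(k)}\big)^2+\lambda_1\|f\|_K^2\Big\},$$ $$\hat f^{de}=\operatorname*{argmin}_{f\in\mathcal H_K}\Big\{\frac1{n_0}\sum_{i=1}^{n_0}\big(f(x_i^{(0)})-(y_i^{(0)}-\hat f^p(x_i^{(0)}))\big)^2+\lambda_2\|f\|_K^2\Big\}.$$ **Assumptions.** With constants $B,\gamma,\kappa>0$, $Q\ge1$, $G\ge0$, $\alpha\in(0,1]$ and $r\in[\frac12,1]$: 1. for every $k$, $\mathbb E[(y^{(k)})^2]<\infty$ and, for $\rho$-almost every $x$, $\int\big(e^{|y-f^{(k)}(x)|/B}-|y-f^{(k)}(x)|/B-1\big)\,d\rho^{(k)}_{y|x}\le\frac{\gamma^2}{2B^2}$;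 2. $\mathcal N(\lambda)\le Q\lambda^{-\alpha}$ for all $\lambda>0$; 3. for every $k$, $f^{(k)}=L_K^{r}g^{(k)}$ ($\rho$-almost everywhere) for some $g^{(k)}\in L_2(\rho)$ with $\|g^{(k)}\|_{L_2(\rho)}\le G$. **Theorem.** Let $0<c\le c'$. There are constants $C_0,C_1,C_2>0$, depending only on $\kappa,B,\gamma,Q,G,\alpha,r,c,c'$, such that the following holds in every such setting, for all $m$, $n_0,\dots,n_m$ and $h>0$. If $\lambda_1\in[c,c']\cdot N^{-\frac1{2r+\alpha}}$ and $\lambda_2\in[c,c']\cdot h^{-\frac2{1+\alpha}}n_0^{-\frac1{1+\alpha}}$, then for every $\delta\in(0,1)$ with $$C_0\exp\Big\{-\min\Big\{N^{\frac{2r+\alpha-1}{2(2r+\alpha)}}(\log N)^{-\frac12},\ h^{-\frac2{1+\alpha}}n_0^{\frac{\alpha}{2+2\alpha}}(\log n_0)^{-\frac12}\Big\}\Big\}\le\delta,$$ with probability at least $1-\delta$, $$\|\hat f-f^{(0)}\|_{L_2(\rho)}\le C_1N^{-\frac r{2r+\alpha}}\log\frac{12m_h}\delta+C_2h^{\frac\alpha{1+\alpha}}n_0^{-\frac1{2\alpha+2}}\log\frac{12}\delta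 .$$ -/

import Mathlib

open MeasureTheory ProbabilityTheory
open scoped ENNReal

noncomputable section

namespace TKRR

/-! ### The reproducing kernel and its integral operator -/

/-- The real valued reproducing kernel `K(x, y)` of a reproducing kernel Hilbert space `H` of
real functions on `X` (Mathlib's kernel takes values in the operators on `ℝ`). -/
def ker {X : Type*} (H : Type*) [NormedAddCommGroup H] [InnerProductSpace ℝ H] [CompleteSpace H]
    [RKHS ℝ H X ℝ] (x y : X) : ℝ :=
  RKHS.kernel H x y (1 : ℝ)

/-- If `√K(x, x) ≤ κ` for all `x`, then `|K(x, y)| ≤ κ²` for all `x, y`. -/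
theorem abs_ker_le {X : Type*} (H : Type*) [NormedAddCommGroup H] [InnerProductSpace ℝ H]
    [CompleteSpace H] [RKHS ℝ H X ℝ] {κ : ℝ} (hκ : ∀ x : X, Real.sqrt (ker H x x) ≤ κ) (x y : X) :
    |ker H x y| ≤ κ ^ 2 := by
  have key : ∀ x y : X, ker H x y = inner ℝ (RKHS.kerFun H y (1 : ℝ)) (RKHS.kerFun H x (1 : ℝ)) := by
    intro x y
    have := RKHS.kernel_inner (𝕜 := ℝ) H x y (1 : ℝ) (1 : ℝ)
    simpa [ker] using this
  have hn : ∀ x : X, ‖RKHS.kerFun H x (1 : ℝ)‖ ≤ κ := by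
    intro x
    have h := hκ x
    rw [key, real_inner_self_eq_norm_sq, Real.sqrt_sq (norm_nonneg _)] at h
    exact h
  rw [key]
  calc _ ≤ ‖RKHS.kerFun H y (1 : ℝ)‖ * ‖RKHS.kerFun H x (1 : ℝ)‖ := abs_real_inner_le_norm _ _
    _ ≤ κ * κ := mul_le_mul (hn y) (hn x) (norm_nonneg _) ((norm_nonneg _).trans (hn y))
    _ = κ ^ 2 := by ring

theorem norm_integral_ker_le {X : Type*} [MeasurableSpace X] {K : X → X → ℝ} {C : ℝ}
    (hC : ∀ x y, |K x y| ≤ C) (ρ : Measure X) [IsProbabilityMeasure ρ] (f : Lp ℝ 2 ρ) (x : X) :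
    ‖∫ y, K x y * f y ∂ρ‖ ≤ C * ‖f‖ := by
  have hC0 : 0 ≤ C := (abs_nonneg _).trans (hC x x)
  have hf : MemLp f 2 ρ := Lp.memLp f
  have hf1 : Integrable f ρ := hf.integrable (by norm_num)
  have h1 : ∫ y, ‖f y‖ ∂ρ ≤ ‖f‖ := by
    rw [integral_norm_eq_lintegral_enorm hf1.1, ← eLpNorm_one_eq_lintegral_enorm, Lp.norm_def]
    refine ENNReal.toReal_mono (Lp.eLpNorm_ne_top f) ?_
    exact eLpNorm_le_eLpNorm_of_exponent_le (by norm_num) hf.1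
  calc ‖∫ y, K x y * f y ∂ρ‖ ≤ ∫ y, C * ‖f y‖ ∂ρ := by
        refine norm_integral_le_of_norm_le (hf1.norm.const_mul C) (Filter.Eventually.of_forall ?_)
        intro y
        rw [norm_mul]
        exact mul_le_mul_of_nonneg_right (hC x y) (norm_nonneg _)
    _ = C * ∫ y, ‖f y‖ ∂ρ := integral_const_mul _ _
    _ ≤ C * ‖f‖ := mul_le_mul_of_nonneg_left h1 hC0

theorem memLp_integral_ker {X : Type*} [MeasurableSpace X] {K : X → X → ℝ}
    (hK : Measurable (Function.uncurry K)) {C : ℝ} (hC : ∀ x y, |K x y| ≤ C)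
    (ρ : Measure X) [IsProbabilityMeasure ρ] (f : Lp ℝ 2 ρ) :
    MemLp (fun x => ∫ y, K x y * f y ∂ρ) 2 ρ := by
  refine MemLp.of_bound ?_ (C * ‖f‖)
    (Filter.Eventually.of_forall (norm_integral_ker_le hC ρ f))
  have : StronglyMeasurable (Function.uncurry fun x y => K x y * f y) :=
    hK.stronglyMeasurable.mul ((Lp.stronglyMeasurable f).comp_measurable measurable_snd)
  exact this.integral_prod_right.aestronglyMeasurable

theorem integrable_ker_mul {X : Type*} [MeasurableSpace X] {K : X → X → ℝ}
    (hK : Measurable (Function.uncurry K)) {C : ℝ} (hC : ∀ x y, |K x y| ≤ C)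
    (ρ : Measure X) [IsProbabilityMeasure ρ] (f : Lp ℝ 2 ρ) (x : X) :
    Integrable (fun y => K x y * f y) ρ :=
  ((Lp.memLp f).integrable (by norm_num)).bdd_mul
    (hK.of_uncurry_left (x := x)).aestronglyMeasurable
    (Filter.Eventually.of_forall (hC x))

/-- The integral operator `(L_K f)(x) = ∫ K(x, y) f(y) dρ(y)` on `L²(ρ)`, for a bounded measurable
kernel `K`. -/
def integralOp {X : Type*} [MeasurableSpace X] (K : X → X → ℝ)
    (hK : Measurable (Function.uncurry K)) {C : ℝ} (hC : ∀ x y, |K x y| ≤ C)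
    (ρ : Measure X) [IsProbabilityMeasure ρ] : Lp ℝ 2 ρ →L[ℝ] Lp ℝ 2 ρ :=
  LinearMap.mkContinuous
    { toFun := fun f => (memLp_integral_ker hK hC ρ f).toLp (fun x => ∫ y, K x y * f y ∂ρ)
      map_add' := by
        intro f g
        rw [← MemLp.toLp_add]
        refine MemLp.toLp_congr _ _ (Filter.Eventually.of_forall fun x => ?_)
        simp only [Pi.add_apply]
        rw [← integral_add (integrable_ker_mul hK hC ρ f x) (integrable_ker_mul hK hC ρ g x)]
        refine integral_congr_ae ?_
        filter_upwards [Lp.coeFn_add f g] with y hy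
        rw [hy, Pi.add_apply, mul_add]
      map_smul' := by
        intro c f
        rw [RingHom.id_apply, ← MemLp.toLp_const_smul]
        refine MemLp.toLp_congr _ _ (Filter.Eventually.of_forall fun x => ?_)
        simp only [Pi.smul_apply, smul_eq_mul]
        rw [← integral_const_mul]
        refine integral_congr_ae ?_
        filter_upwards [Lp.coeFn_smul c f] with y hy
        rw [hy, Pi.smul_apply, smul_eq_mul]
        ring }
    C
    (by
      intro f
      have hX : Nonempty X := ρ.nonempty_of_neZero
      have hC0 : 0 ≤ C := (abs_nonneg _).trans (hC hX.some hX.some)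
      refine (Lp.norm_le_of_ae_bound (mul_nonneg hC0 (norm_nonneg f)) (C := C * ‖f‖) ?_).trans ?_
      · filter_upwards [MemLp.coeFn_toLp (memLp_integral_ker hK hC ρ f)] with x hx
        exact hx ▸ norm_integral_ker_le hC ρ f x
      · simp [measureUnivNNReal])

/-- The integral operator `L_K` on `L²(ρ)` of the reproducing kernel of `H`, where
`sup_x √K(x, x) ≤ κ`. -/
def LK {X : Type*} [MeasurableSpace X] (H : Type*) [NormedAddCommGroup H] [InnerProductSpace ℝ H]
    [CompleteSpace H] [RKHS ℝ H X ℝ] (hK : Measurable (Function.uncurry (ker H : X → X → ℝ)))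
    {κ : ℝ} (hκ : ∀ x : X, Real.sqrt (ker H x x) ≤ κ)
    (ρ : Measure X) [IsProbabilityMeasure ρ] : Lp ℝ 2 ρ →L[ℝ] Lp ℝ 2 ρ :=
  integralOp (ker H) hK (abs_ker_le H hκ) ρ

/-! ### Powers, traces and the effective dimension -/

section Operators

variable {E : Type*} [NormedAddCommGroup E] [InnerProductSpace ℝ E] [CompleteSpace E]

/-- The power `T ^ r` (with `r > 0`) of a compact, positive, self-adjoint operator `T`, through its
spectral decomposition `T ^ r g = ∑ μ, μ ^ r P_μ g`. Here `P_μ` is the orthogonal projection onto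
`{v | T v = μ v}`, so that only the eigenvalues of `T` contribute to the sum; expanding each `P_μ`
in an orthonormal basis of eigenvectors gives `∑ k, μ_k ^ r ⟨ψ_k, g⟩ ψ_k`. -/
def opPow (T : E →L[ℝ] E) (r : ℝ) (g : E) : E :=
  ∑' μ : ℝ, (μ ^ r) • (T - μ • (1 : E →L[ℝ] E)).ker.starProjection g

/-- The trace `∑ i, ⟨e_i, T e_i⟩` of a positive operator, as an element of `[0, ∞]`; for a positive
operator it does not depend on the orthonormal basis `e`. -/
def opTrace (T : E →L[ℝ] E) : ℝ≥0∞ :=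
  ∑' i : (exists_hilbertBasis ℝ E).choose,
    ENNReal.ofReal (inner ℝ ((exists_hilbertBasis ℝ E).choose_spec.choose i)
      (T ((exists_hilbertBasis ℝ E).choose_spec.choose i)))

/-- The effective dimension `Tr((T + λ I)⁻¹ T)` of a positive operator `T`, for `λ > 0`. -/
def effDim (T : E →L[ℝ] E) (lam : ℝ) : ℝ≥0∞ :=
  opTrace (Ring.inverse (T + lam • (1 : E →L[ℝ] E)) * T)

end Operators

/-! ### The assumptions on the models -/

/-- `f` is the regression function of a model with marginal distribution `ρ` and conditional
distributions `η x` of the response given `x`: `f x = ∫ y dη(y | x)`. -/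
def IsRegression {X : Type*} [MeasurableSpace X] (ρ : Measure X) (η : Kernel X ℝ) (f : X → ℝ) :
    Prop :=
  ∀ᵐ x ∂ρ, f x = ∫ y, y ∂(η x)

/-- The response has a finite second moment, and the noise `y - f x` satisfies
`∫ (exp (|y - f x| / B) - |y - f x| / B - 1) dη(y | x) ≤ γ² / (2 B²)`; the integrand is nonnegative,
and the integral is the one with values in `[0, ∞]`. -/
def SubExpNoise {X : Type*} [MeasurableSpace X] (ρ : Measure X) (η : Kernel X ℝ) (f : X → ℝ)
    (B γ : ℝ) : Prop :=
  MemLp (fun z : X × ℝ => z.2) 2 (ρ.compProd η) ∧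
  ∀ᵐ x ∂ρ, ∫⁻ y, ENNReal.ofReal (Real.exp (|y - f x| / B) - |y - f x| / B - 1) ∂(η x)
    ≤ ENNReal.ofReal (γ ^ 2 / (2 * B ^ 2))

/-! ### The two-step estimator -/

section Estimator

variable {X : Type*} {H : Type*} [NormedAddCommGroup H] [InnerProductSpace ℝ H]
  [RKHS ℝ H X ℝ] {m : ℕ}

open Classical in
/-- The set `A_h` of the indices `k ≥ 1` with `‖f⁽⁰⁾ - f⁽ᵏ⁾‖_K ≤ h`. -/
def transferable (f : Fin (m + 1) → H) (h : ℝ) : Finset (Fin (m + 1)) :=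
  Finset.univ.filter fun k => k ≠ 0 ∧ ‖f 0 - f k‖ ≤ h

/-- The pooled sample size `n_A + n_0`. -/
def poolSize (n : Fin (m + 1) → ℕ) (A : Finset (Fin (m + 1))) : ℕ :=
  ∑ k ∈ insert 0 A, n k

/-- The objective of the transferring step: kernel ridge regression on the samples with index in
`{0} ∪ A`, pooled. -/
def transferObjective (n : Fin (m + 1) → ℕ) (A : Finset (Fin (m + 1)))
    (z : (k : Fin (m + 1)) → Fin (n k) → X × ℝ) (lam : ℝ) (f : H) : ℝ :=
  (1 / (poolSize n A : ℝ)) * ∑ k ∈ insert 0 A, ∑ i, (f (z k i).1 - (z k i).2) ^ 2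
    + lam * ‖f‖ ^ 2

/-- The objective of the debiasing step: kernel ridge regression on the target sample, with the
residuals `y - fp x` of the first step as responses. -/
def debiasObjective (n : Fin (m + 1) → ℕ)
    (z : (k : Fin (m + 1)) → Fin (n k) → X × ℝ) (lam : ℝ) (fp f : H) : ℝ :=
  (1 / (n 0 : ℝ)) * ∑ i, (f (z 0 i).1 - ((z 0 i).2 - fp (z 0 i).1)) ^ 2
    + lam * ‖f‖ ^ 2

/-- `fhat = fp + fde`, where `fp` minimizes the objective of the transferring step over `H`, and
`fde` that of the debiasing step. -/
def IsTKRR (n : Fin (m + 1) → ℕ) (A : Finset (Fin (m + 1)))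
    (z : (k : Fin (m + 1)) → Fin (n k) → X × ℝ) (lam1 lam2 : ℝ) (fhat : H) : Prop :=
  ∃ fp fde : H, IsMinOn (transferObjective n A z lam1) Set.univ fp ∧
    IsMinOn (debiasObjective n z lam2 fp) Set.univ fde ∧ fhat = fp + fde

end Estimator

end TKRR

end

/-!
Let `S : H → L²(ρ)` be the inclusion (`incl`), so that `L_K = S S†` (`LK_eq`). All operators are
handled through the norm `regNorm S λ v = √(‖S v‖² + λ ‖v‖²)` and its dual quadratic form `resForm`,
that of `(S† S + λ)⁻¹`; no functional calculus is needed. The effective dimension enters only as the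
mean of `⟪K_x, (S† S + λ)⁻¹ K_x⟫` (`lintegral_resForm_point_le`), and the source condition only as
`|⟪f, v⟫| ≤ G λ^(r - 1) regNorm S λ v` (`abs_inner_le_of_source`), for the representative of the
regression function orthogonal to `ker S`.

**Deterministic part.** Let `c` be the mean of the regression functions over the pooled sample, so
that `‖c - f₀‖ ≤ h`. By the normal equations, the error `u = f̂ᵖ - c` solves a ridge problem whose
right side is the centered noise of the pool minus `λ₁ c`, and the total error `e = f̂ - f₀` solves
`(T₀ + λ₂) (e - u) = λ₂ (c - f₀) + (noise of the target sample) - T₀ u`, with `T₀` the empirical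
version of `S† S` on the target sample. Energy estimates bound `e` by the noise, by `√λ₂ h`, and by
`min(1, κ/√λ₂)` times the empirical norm of `u` on the target sample (`norm_map_sub_le`). That last
factor is the delicate one, as `u` depends on the target sample. If this sample makes up half of the
pool, the energy of `u` controls it. Otherwise `u` is compared with the solution `u'` of the ridge
problem on the source samples alone: `u'` is independent of the target sample, so that Bernstein's
inequality compares its empirical and its population norm (`empNorm_le_of_sources`,
`measure_sum_sq_gt_le_of_indep`).

**Probabilistic part.** Two facts are needed, and both follow from a supermartingale argument
(`lintegral_potential_le`).

* A Bernstein inequality for the noise in the norm given by `resForm`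
  (`measure_le_sqrt_resForm_sum_le`), with Pinelis' potential `cosh ‖·‖` (`cosh_sqrt_add_le`).
* The lower isometry `S† S + λ ≤ 8 (T̂ + λ)` (`measure_exists_regNorm_lt_le`). In an eigenbasis of
  the compression of `S† S` to a finite dimensional subspace it is a lower bound for a sum of random
  matrices of rank one, obtained from the potential `Tr M^(-p)`
  (`trace_inv_pow_add_vecMulVec_le`, `measure_exists_quadForm_lt_le`). This potential makes the
  failure probability `n e^(-p)` free of the dimension, so that the subspace can be exhausted
  afterwards.

**Rates.** With `L = log (12 / δ)`, the lower bound on `δ` says that `L² log N ≲ N λ₁` and that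
`L n₀^(α/(2+2α)) √(log n₀) ≲ n₀ λ₂` (`transfer_rates`, `debias_rates`), which is what the lower
isometry needs with `p ≈ L + log N` and `p ≈ L + log n₀`, and all error terms are then of the
claimed order (`exists_measure_rate_lt_le`). Where the source-sample error meets the debiasing
step, it carries a factor `min(1, κ/√λ₂) / √n₀`, which is at most of the order of the debiasing rate
(`min_div_sqrt_le`).

As the estimator is not assumed to be measurable, the bad event is enlarged to one that is phrased
in terms of the samples only, and moved to the product space of their laws
(`measure_preimage_le_pi`).
-/

namespace TKRR

/-! ### Regularized operators in the language of quadratic forms -/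

section Operators

variable {H E : Type*} [NormedAddCommGroup H] [InnerProductSpace ℝ H]
  [NormedAddCommGroup E] [InnerProductSpace ℝ E]

/-- The regularized norm `v ↦ √(‖S v‖² + lam ‖v‖²)`, which is `‖(S† S + lam)^(1/2) v‖`. -/
noncomputable def regNorm (S : H →L[ℝ] E) (lam : ℝ) (v : H) : ℝ :=
  √(‖S v‖ ^ 2 + lam * ‖v‖ ^ 2)

theorem regNorm_nonneg (S : H →L[ℝ] E) (lam : ℝ) (v : H) : 0 ≤ regNorm S lam v :=
  Real.sqrt_nonneg _

theorem regNorm_sq (S : H →L[ℝ] E) {lam : ℝ} (hlam : 0 ≤ lam) (v : H) :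
    regNorm S lam v ^ 2 = ‖S v‖ ^ 2 + lam * ‖v‖ ^ 2 :=
  Real.sq_sqrt (by positivity)

theorem norm_map_le_regNorm (S : H →L[ℝ] E) {lam : ℝ} (hlam : 0 ≤ lam) (v : H) :
    ‖S v‖ ≤ regNorm S lam v :=
  Real.le_sqrt_of_sq_le (le_add_of_nonneg_right (by positivity))

theorem sqrt_mul_norm_le_regNorm (S : H →L[ℝ] E) {lam : ℝ} (hlam : 0 ≤ lam) (v : H) :
    √lam * ‖v‖ ≤ regNorm S lam v := by
  refine Real.le_sqrt_of_sq_le ?_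
  rw [mul_pow, Real.sq_sqrt hlam]
  exact le_add_of_nonneg_left (by positivity)

/-- The Cauchy-Schwarz inequality for the inner product that defines `regNorm`. -/
theorem abs_inner_add_le (S : H →L[ℝ] E) {lam : ℝ} (hlam : 0 ≤ lam) (a v : H) :
    |inner ℝ (S a) (S v) + lam * inner ℝ a v| ≤ regNorm S lam a * regNorm S lam v := by
  have h1 : |inner ℝ (S a) (S v) + lam * inner ℝ a v| ≤ ‖S a‖ * ‖S v‖ + lam * (‖a‖ * ‖v‖) := by
    refine (abs_add_le _ _).trans (add_le_add (abs_real_inner_le_norm _ _) ?_)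
    rw [abs_mul, abs_of_nonneg hlam]
    exact mul_le_mul_of_nonneg_left (abs_real_inner_le_norm _ _) hlam
  refine h1.trans (abs_le_of_sq_le_sq' ?_
    (mul_nonneg (regNorm_nonneg _ _ _) (regNorm_nonneg _ _ _))).2
  rw [mul_pow, regNorm_sq S hlam, regNorm_sq S hlam]
  nlinarith [mul_nonneg hlam (sq_nonneg (‖S a‖ * ‖v‖ - ‖S v‖ * ‖a‖))]

theorem norm_le_of_source (S : H →L[ℝ] E) {κ G r : ℝ} (hκ : 0 < κ) (hG : 0 ≤ G)
    (hS : ∀ v, ‖S v‖ ≤ κ * ‖v‖) {f : H}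
    (hf : ∀ lam : ℝ, 0 < lam → ∀ v, |inner ℝ f v| ≤ G * lam ^ (r - 1) * regNorm S lam v) :
    ‖f‖ ≤ G * (κ ^ 2) ^ (r - 1) * (2 * κ) := by
  have h1 := hf (κ ^ 2) (by positivity) f
  have h2 : regNorm S (κ ^ 2) f ≤ 2 * κ * ‖f‖ := by
    refine Real.sqrt_le_left (by positivity) |>.2 ?_
    have := pow_le_pow_left₀ (norm_nonneg _) (hS f) 2
    nlinarith [sq_nonneg (κ * ‖f‖)]
  rw [real_inner_self_eq_norm_sq, abs_of_nonneg (sq_nonneg _)] at h1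
  have h0 : 0 ≤ G * (κ ^ 2) ^ (r - 1) := by positivity
  have h3 : ‖f‖ ^ 2 ≤ G * (κ ^ 2) ^ (r - 1) * (2 * κ) * ‖f‖ := by
    calc _ ≤ _ := h1
      _ ≤ G * (κ ^ 2) ^ (r - 1) * (2 * κ * ‖f‖) := mul_le_mul_of_nonneg_left h2 h0
      _ = _ := by ring
  rcases (norm_nonneg f).eq_or_lt with h | h
  · rw [← h]; positivity
  · nlinarith

variable [CompleteSpace H] [CompleteSpace E]

/-- The resolvent `(S† S + lam)⁻¹`. -/
noncomputable def resolvent (S : H →L[ℝ] E) (lam : ℝ) : H →L[ℝ] H :=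
  Ring.inverse (ContinuousLinearMap.adjoint S ∘L S + lam • (1 : H →L[ℝ] H))

theorem isUnit_adjoint_comp_self_add (S : H →L[ℝ] E) {lam : ℝ} (hlam : 0 < lam) :
    IsUnit (ContinuousLinearMap.adjoint S ∘L S + lam • (1 : H →L[ℝ] H)) := by
  refine ContinuousLinearMap.isUnit_of_forall_le_norm_inner_map _ (c := lam.toNNReal)
    (Real.toNNReal_pos.2 hlam) ?_
  intro x
  refine le_trans ?_ (le_abs_self _)
  rw [Real.coe_toNNReal _ hlam.le]
  simp only [add_apply, ContinuousLinearMap.comp_apply,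
    smul_apply, one_apply_eq_self, inner_add_left,
    ContinuousLinearMap.adjoint_inner_left, real_inner_smul_left, real_inner_self_eq_norm_sq]
  nlinarith [sq_nonneg ‖S x‖]

theorem apply_resolvent (S : H →L[ℝ] E) {lam : ℝ} (hlam : 0 < lam) (v : H) :
    ContinuousLinearMap.adjoint S (S (resolvent S lam v)) + lam • resolvent S lam v = v := by
  have h := Ring.mul_inverse_cancel _ (isUnit_adjoint_comp_self_add S hlam)
  simpa [resolvent] using congrArg (fun A : H →L[ℝ] H => A v) h

theorem inner_map_resolvent (S : H →L[ℝ] E) {lam : ℝ} (hlam : 0 < lam) (a v : H) :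
    inner ℝ (S (resolvent S lam a)) (S v) + lam * inner ℝ (resolvent S lam a) v
      = inner ℝ a v := by
  conv_rhs => rw [← apply_resolvent S hlam a]
  rw [inner_add_left, ContinuousLinearMap.adjoint_inner_left, real_inner_smul_left]

/-- The resolvent form `⟪a, (S† S + lam)⁻¹ b⟫`. -/
noncomputable def resForm (S : H →L[ℝ] E) (lam : ℝ) (a b : H) : ℝ :=
  inner ℝ a (resolvent S lam b)

theorem resForm_eq (S : H →L[ℝ] E) {lam : ℝ} (hlam : 0 < lam) (a b : H) :
    resForm S lam a b = inner ℝ (S (resolvent S lam a)) (S (resolvent S lam b))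
      + lam * inner ℝ (resolvent S lam a) (resolvent S lam b) :=
  (inner_map_resolvent S hlam a _).symm

theorem resForm_comm (S : H →L[ℝ] E) {lam : ℝ} (hlam : 0 < lam) (a b : H) :
    resForm S lam a b = resForm S lam b a := by
  rw [resForm_eq S hlam, resForm_eq S hlam, real_inner_comm, real_inner_comm (resolvent S lam b)]

theorem resForm_self (S : H →L[ℝ] E) {lam : ℝ} (hlam : 0 < lam) (a : H) :
    resForm S lam a a = regNorm S lam (resolvent S lam a) ^ 2 := by
  rw [resForm_eq S hlam, regNorm_sq S hlam.le, real_inner_self_eq_norm_sq,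
    real_inner_self_eq_norm_sq]

theorem resForm_self_nonneg (S : H →L[ℝ] E) {lam : ℝ} (hlam : 0 < lam) (a : H) :
    0 ≤ resForm S lam a a := by
  rw [resForm_self S hlam]; positivity

/-- The norm dual to `regNorm` is `b ↦ √⟪b, (S† S + lam)⁻¹ b⟫`. -/
theorem abs_inner_le_resForm (S : H →L[ℝ] E) {lam : ℝ} (hlam : 0 < lam) (b v : H) :
    |inner ℝ b v| ≤ √(resForm S lam b b) * regNorm S lam v := by
  rw [resForm_self S hlam, Real.sqrt_sq (regNorm_nonneg _ _ _), ← inner_map_resolvent S hlam]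
  exact abs_inner_add_le S hlam.le _ _

theorem resForm_self_le (S : H →L[ℝ] E) {lam : ℝ} (hlam : 0 < lam) {b : H} {C : ℝ}
    (h : ∀ v, |inner ℝ b v| ≤ C * regNorm S lam v) : resForm S lam b b ≤ C ^ 2 := by
  have h1 := h (resolvent S lam b)
  have h2 : inner ℝ b (resolvent S lam b) = regNorm S lam (resolvent S lam b) ^ 2 :=
    resForm_self S hlam b
  rw [h2, abs_of_nonneg (sq_nonneg _)] at h1
  rw [resForm_self S hlam]
  rcases (regNorm_nonneg S lam (resolvent S lam b)).eq_or_lt with h0 | h0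
  · rw [← h0]; nlinarith [sq_nonneg C]
  · have : regNorm S lam (resolvent S lam b) ≤ C := by nlinarith
    gcongr

theorem abs_resForm_le (S : H →L[ℝ] E) {lam : ℝ} (hlam : 0 < lam) (a b : H) :
    |resForm S lam a b| ≤ √(resForm S lam a a) * √(resForm S lam b b) := by
  rw [resForm_self S hlam b, Real.sqrt_sq (regNorm_nonneg _ _ _)]
  exact abs_inner_le_resForm S hlam a _

theorem resForm_self_le_norm_sq (S : H →L[ℝ] E) {lam : ℝ} (hlam : 0 < lam) (b : H) :
    resForm S lam b b ≤ (‖b‖ / √lam) ^ 2 := by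
  refine resForm_self_le S hlam fun v => ?_
  refine (abs_real_inner_le_norm _ _).trans ?_
  rw [div_mul_eq_mul_div, le_div_iff₀ (Real.sqrt_pos.2 hlam), mul_assoc]
  refine mul_le_mul_of_nonneg_left ?_ (norm_nonneg _)
  rw [mul_comm]
  exact sqrt_mul_norm_le_regNorm S hlam.le v

theorem resForm_add_left (S : H →L[ℝ] E) (lam : ℝ) (a b c : H) :
    resForm S lam (a + b) c = resForm S lam a c + resForm S lam b c := inner_add_left _ _ _

theorem resForm_add_right (S : H →L[ℝ] E) (lam : ℝ) (a b c : H) :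
    resForm S lam a (b + c) = resForm S lam a b + resForm S lam a c := by
  simp [resForm, inner_add_right]

theorem resForm_smul_left (S : H →L[ℝ] E) (lam t : ℝ) (a b : H) :
    resForm S lam (t • a) b = t * resForm S lam a b := real_inner_smul_left _ _ _

theorem resForm_smul_right (S : H →L[ℝ] E) (lam t : ℝ) (a b : H) :
    resForm S lam a (t • b) = t * resForm S lam a b := by
  simp [resForm, real_inner_smul_right]

theorem sqrt_resForm_add_le (S : H →L[ℝ] E) {lam : ℝ} (hlam : 0 < lam) (a b : H) :
    √(resForm S lam (a + b) (a + b)) ≤ √(resForm S lam a a) + √(resForm S lam b b) := by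
  rw [Real.sqrt_le_left (by positivity)]
  have h1 := (abs_le.1 (abs_resForm_le S hlam a b)).2
  rw [resForm_add_left, resForm_add_right, resForm_add_right, resForm_comm S hlam b a, add_sq,
    Real.sq_sqrt (resForm_self_nonneg S hlam a), Real.sq_sqrt (resForm_self_nonneg S hlam b)]
  linarith

theorem sqrt_resForm_smul (S : H →L[ℝ] E) (lam t : ℝ) (a : H) :
    √(resForm S lam (t • a) (t • a)) = |t| * √(resForm S lam a a) := by
  rw [resForm_smul_left, resForm_smul_right, ← mul_assoc, ← sq, Real.sqrt_mul (sq_nonneg t),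
    Real.sqrt_sq_eq_abs]

theorem effDim_eq_tsum (S : H →L[ℝ] E) {lam : ℝ} (hlam : 0 < lam) :
    effDim (S ∘L ContinuousLinearMap.adjoint S) lam
      = ∑' i : (exists_hilbertBasis ℝ E).choose, ENNReal.ofReal
          (resForm S lam
            (ContinuousLinearMap.adjoint S ((exists_hilbertBasis ℝ E).choose_spec.choose i))
            (ContinuousLinearMap.adjoint S ((exists_hilbertBasis ℝ E).choose_spec.choose i))) := by
  have hu : IsUnit (S ∘L ContinuousLinearMap.adjoint S + lam • (1 : E →L[ℝ] E)) := by
    have := isUnit_adjoint_comp_self_add (ContinuousLinearMap.adjoint S) hlam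
    rwa [ContinuousLinearMap.adjoint_adjoint] at this
  have key : Ring.inverse (S ∘L ContinuousLinearMap.adjoint S + lam • (1 : E →L[ℝ] E))
      * (S ∘L ContinuousLinearMap.adjoint S)
      = S ∘L resolvent S lam ∘L ContinuousLinearMap.adjoint S := by
    rw [← Ring.inverse_mul_cancel_left _ (S ∘L resolvent S lam ∘L ContinuousLinearMap.adjoint S) hu]
    congr 1
    ext1 e
    have h := congrArg S (apply_resolvent S hlam (ContinuousLinearMap.adjoint S e))
    rw [map_add, map_smul] at h
    simpa using h.symm
  rw [effDim, key, opTrace]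
  refine tsum_congr fun i => ?_
  congr 1
  simp [resForm, ContinuousLinearMap.adjoint_inner_left]

/-- Bessel's inequality for a finite family that is orthonormal for the inner product of
`regNorm`, in the dual norm. -/
theorem sum_inner_sq_le_resForm (S : H →L[ℝ] E) {lam : ℝ} (hlam : 0 < lam) {ι : Type*}
    [Fintype ι] [DecidableEq ι] (w : ι → H)
    (hw : ∀ i j, inner ℝ (S (w i)) (S (w j)) + lam * inner ℝ (w i) (w j) = if i = j then 1 else 0)
    (a : H) : ∑ i, inner ℝ a (w i) ^ 2 ≤ resForm S lam a a := by
  set s := ∑ i, inner ℝ a (w i) ^ 2 with hs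
  have hs0 : 0 ≤ s := Finset.sum_nonneg fun i _ => sq_nonneg _
  set v := ∑ i, inner ℝ a (w i) • w i with hv
  have h1 : inner ℝ a v = s := by
    simp [hv, hs, inner_sum, real_inner_smul_right, sq]
  have h2 : regNorm S lam v ^ 2 = s := by
    have h3 : ∀ i j, inner ℝ a (w i) * (inner ℝ a (w j) * inner ℝ (S (w i)) (S (w j)))
        + lam * (inner ℝ a (w i) * (inner ℝ a (w j) * inner ℝ (w i) (w j)))
        = inner ℝ a (w i) * inner ℝ a (w j) * if i = j then 1 else 0 := by
      intro i j; rw [← hw i j]; ring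
    rw [regNorm_sq S hlam.le, ← real_inner_self_eq_norm_sq, ← real_inner_self_eq_norm_sq, hv]
    simp only [map_sum, map_smul, sum_inner, inner_sum, real_inner_smul_left,
      real_inner_smul_right, Finset.mul_sum, ← Finset.sum_add_distrib]
    rw [hs]
    refine Finset.sum_congr rfl fun i _ => ?_
    rw [Finset.sum_eq_single i (fun j _ hj => ?_) (by simp)]
    · rw [h3]; simp [sq]
    · have := h3 j i
      rw [if_neg hj, mul_zero] at this
      rw [← this]; ring
  have h3 := abs_inner_le_resForm S hlam a v
  rw [h1, abs_of_nonneg hs0] at h3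
  have h4 : s ^ 2 ≤ resForm S lam a a * s := by
    calc s ^ 2 ≤ (√(resForm S lam a a) * regNorm S lam v) ^ 2 := by gcongr
      _ = _ := by rw [mul_pow, Real.sq_sqrt (resForm_self_nonneg S hlam a), h2]
  rcases hs0.eq_or_lt with h0 | h0
  · rw [← h0]; exact resForm_self_nonneg S hlam a
  · nlinarith

/-- The effective dimension dominates the trace of `S† S` along every finite family that is
orthonormal for the inner product of `regNorm`. -/
theorem sum_norm_sq_le_effDim (S : H →L[ℝ] E) {lam : ℝ} (hlam : 0 < lam) {ι : Type*}
    [Fintype ι] [DecidableEq ι] (w : ι → H)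
    (hw : ∀ i j, inner ℝ (S (w i)) (S (w j)) + lam * inner ℝ (w i) (w j) = if i = j then 1 else 0) :
    ∑ i, ENNReal.ofReal (‖S (w i)‖ ^ 2)
      ≤ effDim (S ∘L ContinuousLinearMap.adjoint S) lam := by
  set b := (exists_hilbertBasis ℝ E).choose_spec.choose
  have h1 : ∀ i, ENNReal.ofReal (‖S (w i)‖ ^ 2)
      = ∑' j, ENNReal.ofReal (inner ℝ (ContinuousLinearMap.adjoint S (b j)) (w i) ^ 2) := by
    intro i
    have := b.hasSum_inner_mul_inner (S (w i)) (S (w i))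
    rw [real_inner_self_eq_norm_sq] at this
    rw [← this.tsum_eq, ENNReal.ofReal_tsum_of_nonneg _ this.summable]
    · refine tsum_congr fun j => ?_
      rw [ContinuousLinearMap.adjoint_inner_left, sq, real_inner_comm]
    · intro j
      rw [real_inner_comm]; exact mul_self_nonneg _
  simp_rw [h1]
  rw [← Summable.tsum_finsetSum fun i _ => ENNReal.summable, effDim_eq_tsum S hlam]
  refine ENNReal.tsum_le_tsum fun j => ?_
  rw [← ENNReal.ofReal_sum_of_nonneg fun i _ => sq_nonneg _]
  exact ENNReal.ofReal_le_ofReal (sum_inner_sq_le_resForm S hlam w hw _)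

end Operators

/-! ### The source condition as a bound on a functional -/

section Source

variable {H E : Type*} [NormedAddCommGroup H] [InnerProductSpace ℝ H] [CompleteSpace H]
  [NormedAddCommGroup E] [InnerProductSpace ℝ E] [CompleteSpace E]

/-- The orthogonal projection onto the eigenspace `{v | T v = μ v}`. -/
noncomputable abbrev eigenProj (T : E →L[ℝ] E) (μ : ℝ) : E →L[ℝ] E :=
  (T - μ • (1 : E →L[ℝ] E)).ker.starProjection

theorem apply_eigenProj (T : E →L[ℝ] E) (μ : ℝ) (w : E) :
    T (eigenProj T μ w) = μ • eigenProj T μ w := by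
  have h : eigenProj T μ w ∈ (T - μ • (1 : E →L[ℝ] E)).ker :=
    Submodule.starProjection_apply_mem _ _
  rw [LinearMap.mem_ker] at h
  simpa [sub_eq_zero] using h

theorem inner_eigenProj_eigenProj (T : E →L[ℝ] E) (μ : ℝ) (v w : E) :
    inner ℝ (eigenProj T μ v) w = inner ℝ (eigenProj T μ v) (eigenProj T μ w) := by
  have h : eigenProj T μ (eigenProj T μ v) = eigenProj T μ v :=
    Submodule.starProjection_eq_self_iff.2 (Submodule.starProjection_apply_mem _ _)
  conv_lhs => rw [← h]
  exact Submodule.inner_starProjection_left_eq_right _ _ _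

theorem inner_eigenProj_of_ne {T : E →L[ℝ] E} (hT : ∀ v w, inner ℝ (T v) w = inner ℝ v (T w))
    {μ ν : ℝ} (h : μ ≠ ν) (v w : E) : inner ℝ (eigenProj T μ v) (eigenProj T ν w) = 0 := by
  have h1 := hT (eigenProj T μ v) (eigenProj T ν w)
  rw [apply_eigenProj, apply_eigenProj, real_inner_smul_left, real_inner_smul_right] at h1
  have h2 : (μ - ν) * inner ℝ (eigenProj T μ v) (eigenProj T ν w) = 0 := by linarith
  exact (mul_eq_zero.1 h2).resolve_left (sub_ne_zero.2 h)

/-- Bessel's inequality for the eigenprojections of a positive operator, in its quadratic form. -/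
theorem sum_mul_norm_eigenProj_sq_le {T : E →L[ℝ] E}
    (hT : ∀ v w, inner ℝ (T v) w = inner ℝ v (T w)) (hpos : ∀ v, 0 ≤ inner ℝ (T v) v)
    (s : Finset ℝ) (w : E) :
    ∑ μ ∈ s, μ * ‖eigenProj T μ w‖ ^ 2 ≤ inner ℝ (T w) w := by
  set p := ∑ μ ∈ s, eigenProj T μ w with hp
  have hTp : T p = ∑ μ ∈ s, μ • eigenProj T μ w := by
    rw [hp, map_sum]; exact Finset.sum_congr rfl fun μ _ => apply_eigenProj T μ w
  have h1 : inner ℝ (T p) w = ∑ μ ∈ s, μ * ‖eigenProj T μ w‖ ^ 2 := by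
    rw [hTp, sum_inner]
    refine Finset.sum_congr rfl fun μ _ => ?_
    rw [real_inner_smul_left, inner_eigenProj_eigenProj, real_inner_self_eq_norm_sq]
  have h2 : inner ℝ (T p) p = ∑ μ ∈ s, μ * ‖eigenProj T μ w‖ ^ 2 := by
    rw [hTp, hp, sum_inner]
    refine Finset.sum_congr rfl fun μ hμ => ?_
    rw [real_inner_smul_left, inner_sum, Finset.sum_eq_single μ
      (fun ν _ hν => inner_eigenProj_of_ne hT hν.symm _ _) (fun h => absurd hμ h),
      real_inner_self_eq_norm_sq]
  have h3 := hpos (w - p)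
  have h4 : inner ℝ (T w) p = inner ℝ (T p) w := by rw [hT, real_inner_comm]
  rw [map_sub, inner_sub_left, inner_sub_right, inner_sub_right, h4, h1, h2] at h3
  linarith

theorem sum_norm_eigenProj_sq_le {T : E →L[ℝ] E}
    (hT : ∀ v w, inner ℝ (T v) w = inner ℝ v (T w)) (s : Finset ℝ) (w : E) :
    ∑ μ ∈ s, ‖eigenProj T μ w‖ ^ 2 ≤ ‖w‖ ^ 2 := by
  set p := ∑ μ ∈ s, eigenProj T μ w with hp
  have h1 : inner ℝ p w = ∑ μ ∈ s, ‖eigenProj T μ w‖ ^ 2 := by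
    rw [hp, sum_inner]
    refine Finset.sum_congr rfl fun μ _ => ?_
    rw [inner_eigenProj_eigenProj, real_inner_self_eq_norm_sq]
  have h2 : inner ℝ p p = ∑ μ ∈ s, ‖eigenProj T μ w‖ ^ 2 := by
    conv_lhs => rw [hp]
    rw [sum_inner]
    refine Finset.sum_congr rfl fun μ hμ => ?_
    rw [inner_sum, Finset.sum_eq_single μ
      (fun ν _ hν => inner_eigenProj_of_ne hT hν.symm _ _) (fun h => absurd hμ h),
      real_inner_self_eq_norm_sq]
  have h3 := real_inner_self_nonneg (x := w - p)
  rw [inner_sub_left, inner_sub_right, inner_sub_right, real_inner_comm p w, h1, h2,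
    real_inner_self_eq_norm_sq] at h3
  linarith

/-- If `v = S† w`, the functional `w ↦ ⟪T ^ r g, w⟫` for `T = S S†` is bounded by
`‖g‖ lam ^ (r - 1) √(‖S v‖² + lam ‖v‖²)`. Each eigenvalue `μ` contributes
`μ ^ r ‖P_μ g‖ ‖P_μ w‖`, and `μ ^ (2 r) ≤ lam ^ (2 r - 2) (μ² + lam μ)` because
`1 ≤ 2 r ≤ 2`. -/
theorem abs_inner_opPow_le (S : H →L[ℝ] E) {lam r : ℝ} (hlam : 0 < lam)
    (hr : r ∈ Set.Icc (1 / 2 : ℝ) 1) (g w : E) :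
    |inner ℝ (opPow (S ∘L ContinuousLinearMap.adjoint S) r g) w|
      ≤ ‖g‖ * lam ^ (r - 1) * regNorm S lam (ContinuousLinearMap.adjoint S w) := by
  set T := S ∘L ContinuousLinearMap.adjoint S with hTdef
  have hT : ∀ v w, inner ℝ (T v) w = inner ℝ v (T w) := by
    intro v w
    rw [hTdef, ContinuousLinearMap.comp_apply, ContinuousLinearMap.comp_apply,
      ← ContinuousLinearMap.adjoint_inner_right, ContinuousLinearMap.adjoint_inner_left]
  have hTT : ∀ v, inner ℝ (T v) v = ‖ContinuousLinearMap.adjoint S v‖ ^ 2 := by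
    intro v
    rw [← real_inner_self_eq_norm_sq, ContinuousLinearMap.adjoint_inner_right]; rfl
  have hpos : ∀ v, 0 ≤ inner ℝ (T v) v := fun v => by rw [hTT]; positivity
  have hB0 : 0 ≤ ‖g‖ * lam ^ (r - 1) * regNorm S lam (ContinuousLinearMap.adjoint S w) :=
    mul_nonneg (mul_nonneg (norm_nonneg _) (Real.rpow_nonneg hlam.le _)) (regNorm_nonneg _ _ _)
  -- negative numbers are not eigenvalues
  have hneg : ∀ μ : ℝ, μ < 0 → ∀ w, eigenProj T μ w = 0 := by
    intro μ hμ w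
    have h := hpos (eigenProj T μ w)
    rw [apply_eigenProj, real_inner_smul_left, real_inner_self_eq_norm_sq] at h
    have : ‖eigenProj T μ w‖ ^ 2 ≤ 0 := by nlinarith [sq_nonneg ‖eigenProj T μ w‖]
    exact norm_eq_zero.1 (pow_eq_zero_iff two_ne_zero |>.1 (le_antisymm this (sq_nonneg _)))
  have hsq : ∀ μ : ℝ, 0 ≤ μ → (μ ^ r) ^ 2 ≤ (lam ^ (r - 1)) ^ 2 * (μ ^ 2 + lam * μ) := by
    intro μ hμ
    obtain ⟨t, ht, rfl⟩ : ∃ t : ℝ, 0 ≤ t ∧ μ = lam * t :=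
      ⟨μ / lam, by positivity, by field_simp⟩
    have h1 : (t ^ r) ^ 2 ≤ t ^ 2 + t := by
      rw [← Real.rpow_natCast (t ^ r), ← Real.rpow_mul ht]
      rcases le_total t 1 with h | h
      · have : t ^ (r * (2 : ℕ)) ≤ t ^ (1 : ℝ) := by
          rcases ht.eq_or_lt with rfl | h0
          · rw [Real.zero_rpow (by have := hr.1; push_cast; linarith), Real.zero_rpow one_ne_zero]
          · exact Real.rpow_le_rpow_of_exponent_ge h0 h (by have := hr.1; push_cast; linarith)
        rw [Real.rpow_one] at this
        nlinarith [sq_nonneg t]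
      · have : t ^ (r * (2 : ℕ)) ≤ t ^ ((2 : ℕ) : ℝ) :=
          Real.rpow_le_rpow_of_exponent_le h (by have := hr.2; push_cast; linarith)
        rw [Real.rpow_natCast] at this
        linarith
    have h2 : lam ^ r = lam ^ (r - 1) * lam := by
      rw [← Real.rpow_add_one hlam.ne']; congr 1; ring
    rw [Real.mul_rpow hlam.le ht, h2]
    have h3 : 0 ≤ (lam ^ (r - 1)) ^ 2 * lam ^ 2 := by positivity
    nlinarith [mul_le_mul_of_nonneg_left h1 h3]
  have hpart : ∀ s : Finset ℝ,
      |inner ℝ (∑ μ ∈ s, (μ ^ r) • eigenProj T μ g) w|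
        ≤ ‖g‖ * lam ^ (r - 1) * regNorm S lam (ContinuousLinearMap.adjoint S w) := by
    intro s
    have h1 : inner ℝ (∑ μ ∈ s, (μ ^ r) • eigenProj T μ g) w
        = ∑ μ ∈ s, inner ℝ (eigenProj T μ g) ((μ ^ r) • eigenProj T μ w) := by
      rw [sum_inner]
      refine Finset.sum_congr rfl fun μ _ => ?_
      rw [real_inner_smul_left, inner_eigenProj_eigenProj, real_inner_smul_right]
    have h2 : ∑ μ ∈ s, ‖(μ ^ r) • eigenProj T μ w‖ ^ 2
        ≤ (lam ^ (r - 1) * regNorm S lam (ContinuousLinearMap.adjoint S w)) ^ 2 := by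
      have h3 : ∀ μ ∈ s, ‖(μ ^ r) • eigenProj T μ w‖ ^ 2 ≤ (lam ^ (r - 1)) ^ 2
          * (‖eigenProj T μ (T w)‖ ^ 2 + lam * (μ * ‖eigenProj T μ w‖ ^ 2)) := by
        intro μ _
        have h4 : eigenProj T μ (T w) = μ • eigenProj T μ w := by
          refine ext_inner_right ℝ fun v => ?_
          have e1 : inner ℝ (eigenProj T μ (T w)) v = inner ℝ (T w) (eigenProj T μ v) :=
            Submodule.inner_starProjection_left_eq_right _ _ _
          have e2 : inner ℝ (eigenProj T μ w) v = inner ℝ w (eigenProj T μ v) :=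
            Submodule.inner_starProjection_left_eq_right _ _ _
          rw [e1, hT, apply_eigenProj, real_inner_smul_right, real_inner_smul_left, e2]
        rcases lt_or_ge μ 0 with hμ | hμ
        · simp [hneg μ hμ]
        · rw [h4, norm_smul, norm_smul, mul_pow, mul_pow, Real.norm_eq_abs, Real.norm_eq_abs,
            sq_abs, sq_abs]
          calc _ ≤ (lam ^ (r - 1)) ^ 2 * (μ ^ 2 + lam * μ) * ‖eigenProj T μ w‖ ^ 2 := by
                gcongr; exact hsq μ hμ
            _ = _ := by ring
      refine (Finset.sum_le_sum h3).trans ?_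
      rw [← Finset.mul_sum, Finset.sum_add_distrib, ← Finset.mul_sum, mul_pow,
        regNorm_sq S hlam.le]
      have h5 := sum_norm_eigenProj_sq_le hT s (T w)
      have h6 := sum_mul_norm_eigenProj_sq_le hT hpos s w
      rw [hTT] at h6
      have h7 : T w = S (ContinuousLinearMap.adjoint S w) := rfl
      rw [h7] at h5
      gcongr
      · exact h5
    rw [h1]
    have hcs : (∑ μ ∈ s, ‖eigenProj T μ g‖ * ‖(μ ^ r) • eigenProj T μ w‖) ^ 2
        ≤ ‖g‖ ^ 2 * (lam ^ (r - 1) * regNorm S lam (ContinuousLinearMap.adjoint S w)) ^ 2 :=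
      (Finset.sum_mul_sq_le_sq_mul_sq _ _ _).trans
        (mul_le_mul (sum_norm_eigenProj_sq_le hT s g) h2
          (Finset.sum_nonneg fun _ _ => sq_nonneg _) (sq_nonneg _))
    calc _ ≤ ∑ μ ∈ s, ‖eigenProj T μ g‖ * ‖(μ ^ r) • eigenProj T μ w‖ :=
          (Finset.abs_sum_le_sum_abs _ _).trans
            (Finset.sum_le_sum fun μ _ => abs_real_inner_le_norm _ _)
      _ ≤ _ := by
          refine (abs_le_of_sq_le_sq' ?_ hB0).2
          calc _ ≤ _ := hcs
            _ = _ := by ring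
  -- an unconditionally divergent sum would have the value `0`, so that the bound holds anyway
  by_cases hsum : Summable fun μ : ℝ => (μ ^ r) • eigenProj T μ g
  · have hlim := hsum.hasSum
    have h1 : Filter.Tendsto (fun s : Finset ℝ => |inner ℝ (∑ μ ∈ s, (μ ^ r) • eigenProj T μ g) w|)
        Filter.atTop (nhds |inner ℝ (opPow T r g) w|) :=
      (Filter.Tendsto.inner hlim tendsto_const_nhds).abs
    exact le_of_tendsto' h1 hpart
  · rw [opPow, tsum_eq_zero_of_not_summable hsum, inner_zero_left, abs_zero]
    exact hB0

/-- The source condition, for an element `f` orthogonal to the kernel of `S`: the functional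
`⟪f, ·⟫` is bounded by `‖g‖ lam ^ (r - 1)` in the norm dual to `regNorm`. -/
theorem abs_inner_le_of_source (S : H →L[ℝ] E) {lam r : ℝ} (hlam : 0 < lam)
    (hr : r ∈ Set.Icc (1 / 2 : ℝ) 1) {f : H} {g : E} (hf : f ∈ S.kerᗮ)
    (hfg : S f = opPow (S ∘L ContinuousLinearMap.adjoint S) r g) (v : H) :
    |inner ℝ f v| ≤ ‖g‖ * lam ^ (r - 1) * regNorm S lam v := by
  -- projecting `v` onto the orthogonal complement of `ker S` does not increase the right side
  have hcl : IsClosed {v : H | |inner ℝ f v| ≤ ‖g‖ * lam ^ (r - 1) * regNorm S lam v} := by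
    refine isClosed_le (by fun_prop) ?_
    unfold regNorm
    fun_prop
  have hrange : S.kerᗮ
      ≤ ((ContinuousLinearMap.adjoint S).range).topologicalClosure := by
    have h := ContinuousLinearMap.orthogonal_range (ContinuousLinearMap.adjoint S)
    rw [ContinuousLinearMap.adjoint_adjoint] at h
    rw [← h, Submodule.orthogonal_orthogonal_eq_closure]
  have hmem : ∀ v ∈ S.kerᗮ, |inner ℝ f v| ≤ ‖g‖ * lam ^ (r - 1) * regNorm S lam v := by
    intro v hv
    have hv' : v ∈ closure ((ContinuousLinearMap.adjoint S).range : Set H) := hrange hv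
    refine closure_minimal ?_ hcl hv'
    rintro _ ⟨w, rfl⟩
    have h := abs_inner_opPow_le S hlam hr g w
    rw [← hfg, ← ContinuousLinearMap.adjoint_inner_right] at h
    exact h
  set p := S.ker.starProjection v with hp
  have hpk : p ∈ S.ker := Submodule.starProjection_apply_mem _ _
  have hvp : v - p ∈ S.kerᗮ := Submodule.sub_starProjection_mem_orthogonal v
  have h1 := hmem (v - p) hvp
  have h2 : inner ℝ f p = 0 := Submodule.inner_left_of_mem_orthogonal hpk hf
  rw [inner_sub_right, h2, sub_zero] at h1
  refine h1.trans (mul_le_mul_of_nonneg_left ?_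
    (mul_nonneg (norm_nonneg _) (Real.rpow_nonneg hlam.le _)))
  refine Real.sqrt_le_sqrt ?_
  have h3 : S p = 0 := hpk
  rw [map_sub, h3, sub_zero]
  have h4 : inner ℝ p (v - p) = 0 := Submodule.inner_right_of_mem_orthogonal hpk hvp
  have h5 : ‖v‖ ^ 2 = ‖p‖ ^ 2 + ‖v - p‖ ^ 2 := by
    have := norm_add_sq_real p (v - p)
    rw [h4, add_sub_cancel] at this
    linarith
  nlinarith [sq_nonneg ‖p‖]

end Source

/-! ### The inclusion of the reproducing kernel Hilbert space into `L²` -/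

section Inclusion

variable {X : Type*} {H : Type*} [NormedAddCommGroup H] [InnerProductSpace ℝ H] [CompleteSpace H]
  [RKHS ℝ H X ℝ]

/-- The kernel section `K(·, x)`, as an element of `H`. -/
noncomputable def point (H : Type*) {X : Type*} [NormedAddCommGroup H] [InnerProductSpace ℝ H]
    [CompleteSpace H] [RKHS ℝ H X ℝ] (x : X) : H :=
  RKHS.kerFun H x (1 : ℝ)

theorem inner_point (x : X) (f : H) : inner ℝ (point H x) f = f x := by
  simp [point]

theorem ker_eq_inner (x y : X) : ker H x y = inner ℝ (point H y) (point H x) := by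
  have := RKHS.kernel_inner (𝕜 := ℝ) H x y (1 : ℝ) (1 : ℝ)
  simpa [ker, point] using this

theorem norm_point_le {κ : ℝ} (hκ : ∀ x : X, Real.sqrt (ker H x x) ≤ κ) (x : X) :
    ‖point H x‖ ≤ κ := by
  have h := hκ x
  rwa [ker_eq_inner, real_inner_self_eq_norm_sq, Real.sqrt_sq (norm_nonneg _)] at h

theorem abs_apply_le {κ : ℝ} (hκ : ∀ x : X, Real.sqrt (ker H x x) ≤ κ) (f : H) (x : X) :
    |f x| ≤ κ * ‖f‖ := by
  rw [← inner_point]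
  exact (abs_real_inner_le_norm _ _).trans
    (mul_le_mul_of_nonneg_right (norm_point_le hκ x) (norm_nonneg _))

variable [MeasurableSpace X]

theorem measurable_coe (hK : Measurable (Function.uncurry (ker H : X → X → ℝ))) (f : H) :
    Measurable (f : X → ℝ) := by
  let M : Submodule ℝ H :=
    { carrier := {f | Measurable (f : X → ℝ)}
      add_mem' := fun {a b} ha hb => by
        simp only [Set.mem_ofPred_eq, RKHS.coe_add] at *
        exact Measurable.add ha hb
      zero_mem' := by
        simp only [Set.mem_ofPred_eq, RKHS.coe_zero]
        exact measurable_zero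
      smul_mem' := fun c a ha => by
        simp only [Set.mem_ofPred_eq, RKHS.coe_smul] at *
        exact Measurable.const_smul ha c }
  have hcl : IsClosed (M : Set H) := by
    refine IsSeqClosed.isClosed fun u f hu hf => ?_
    refine measurable_of_tendsto_metrizable (f := fun n => (u n : X → ℝ)) (fun n => hu n) ?_
    rw [tendsto_pi_nhds]
    intro x
    exact ((RKHS.continuous_eval (𝕜 := ℝ) (H := H) x).tendsto f).comp hf
  have hspan : Submodule.span ℝ {RKHS.kerFun H x v | (x : X) (v : ℝ)} ≤ M := by
    refine Submodule.span_le.2 ?_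
    rintro _ ⟨x, v, rfl⟩
    have h1 : ∀ y, RKHS.kerFun H x v y = v * ker H y x := by
      intro y
      rw [RKHS.kerFun_apply, ker, ← smul_eq_mul, ← map_smul, smul_eq_mul, mul_one]
    change Measurable fun y => RKHS.kerFun H x v y
    simp_rw [h1]
    exact (hK.of_uncurry_right (y := x)).const_mul v
  have htop := Submodule.topologicalClosure_minimal _ hspan hcl
  rw [RKHS.kerFun_dense] at htop
  exact htop (Submodule.mem_top (x := f))

theorem memLp_coe (hK : Measurable (Function.uncurry (ker H : X → X → ℝ))) {κ : ℝ}
    (hκ : ∀ x : X, Real.sqrt (ker H x x) ≤ κ) (ρ : Measure X) [IsFiniteMeasure ρ] (f : H) :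
    MemLp (f : X → ℝ) 2 ρ :=
  MemLp.of_bound (measurable_coe hK f).aestronglyMeasurable (κ * ‖f‖)
    (Filter.Eventually.of_forall (abs_apply_le hκ f))

/-- The inclusion of `H` into `L²(ρ)`, which sends a function to its class. -/
noncomputable def incl (hK : Measurable (Function.uncurry (ker H : X → X → ℝ))) {κ : ℝ}
    (hκ : ∀ x : X, Real.sqrt (ker H x x) ≤ κ) (ρ : Measure X) [IsProbabilityMeasure ρ] :
    H →L[ℝ] Lp ℝ 2 ρ :=
  LinearMap.mkContinuous
    { toFun := fun f => (memLp_coe hK hκ ρ f).toLp f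
      map_add' := fun f g => by
        rw [← MemLp.toLp_add]
        exact MemLp.toLp_congr _ _ (by rw [RKHS.coe_add])
      map_smul' := fun c f => by
        rw [RingHom.id_apply, ← MemLp.toLp_const_smul]
        exact MemLp.toLp_congr _ _ (by rw [RKHS.coe_smul]) }
    κ
    (by
      intro f
      have hX : Nonempty X := ρ.nonempty_of_neZero
      have h0 : 0 ≤ κ * ‖f‖ := (abs_nonneg _).trans (abs_apply_le hκ f hX.some)
      refine (Lp.norm_le_of_ae_bound h0 (C := κ * ‖f‖) ?_).trans ?_
      · filter_upwards [MemLp.coeFn_toLp (memLp_coe hK hκ ρ f)] with x hx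
        exact hx ▸ abs_apply_le hκ f x
      · simp [measureUnivNNReal])

theorem integrable_mul_coe (hK : Measurable (Function.uncurry (ker H : X → X → ℝ))) {κ : ℝ}
    (hκ : ∀ x : X, Real.sqrt (ker H x x) ≤ κ) (ρ : Measure X) [IsFiniteMeasure ρ] (f g : H) :
    Integrable (fun x => f x * g x) ρ :=
  (memLp_coe hK hκ ρ f).integrable_mul (memLp_coe hK hκ ρ g)

variable (hK : Measurable (Function.uncurry (ker H : X → X → ℝ))) {κ : ℝ}
  (hκ : ∀ x : X, Real.sqrt (ker H x x) ≤ κ) (ρ : Measure X) [IsProbabilityMeasure ρ]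

theorem incl_ae (f : H) : incl hK hκ ρ f =ᵐ[ρ] f :=
  MemLp.coeFn_toLp (memLp_coe hK hκ ρ f)

theorem norm_incl_le (hκ0 : 0 ≤ κ) (f : H) : ‖incl hK hκ ρ f‖ ≤ κ * ‖f‖ :=
  (incl hK hκ ρ).le_of_opNorm_le (LinearMap.mkContinuous_norm_le _ hκ0 _) f

theorem inner_incl (f g : H) :
    inner ℝ (incl hK hκ ρ f) (incl hK hκ ρ g) = ∫ x, f x * g x ∂ρ := by
  rw [L2.inner_def]
  refine integral_congr_ae ?_
  filter_upwards [incl_ae hK hκ ρ f, incl_ae hK hκ ρ g] with x h1 h2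
  rw [h1, h2]
  simp [mul_comm]

theorem norm_incl_sq (f : H) : ‖incl hK hκ ρ f‖ ^ 2 = ∫ x, f x ^ 2 ∂ρ := by
  rw [← real_inner_self_eq_norm_sq, inner_incl]
  simp_rw [sq]

theorem eLpNorm_coe_eq (f : H) :
    eLpNorm (f : X → ℝ) 2 ρ = ENNReal.ofReal ‖incl hK hκ ρ f‖ := by
  rw [Lp.norm_def, ENNReal.ofReal_toReal (Lp.eLpNorm_ne_top _)]
  exact eLpNorm_congr_ae (incl_ae hK hκ ρ f).symm

/-- The integral operator is `S S†` for the inclusion `S : H → L²(ρ)`. -/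
theorem LK_eq : LK H hK hκ ρ = incl hK hκ ρ ∘L ContinuousLinearMap.adjoint (incl hK hκ ρ) := by
  ext1 e
  refine Lp.ext ?_
  have h1 : LK H hK hκ ρ e =ᵐ[ρ] fun x => ∫ y, ker H x y * e y ∂ρ :=
    MemLp.coeFn_toLp (memLp_integral_ker hK (abs_ker_le H hκ) ρ e)
  have h2 := incl_ae hK hκ ρ (ContinuousLinearMap.adjoint (incl hK hκ ρ) e)
  filter_upwards [h1, h2] with x hx1 hx2
  rw [hx1, ContinuousLinearMap.comp_apply, hx2, ← inner_point,
    ContinuousLinearMap.adjoint_inner_right, L2.inner_def]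
  refine integral_congr_ae ?_
  filter_upwards [incl_ae hK hκ ρ (point H x)] with y hy
  rw [hy, ← inner_point, ← ker_eq_inner]
  simp [mul_comm]

end Inclusion

section MeasurablePoint

variable {X : Type*} [MeasurableSpace X] {H : Type*} [NormedAddCommGroup H]
  [InnerProductSpace ℝ H] [CompleteSpace H] [TopologicalSpace.SeparableSpace H] [RKHS ℝ H X ℝ]
  [MeasurableSpace H] [BorelSpace H]

theorem measurable_point (hK : Measurable (Function.uncurry (ker H : X → X → ℝ))) :
    Measurable (point H : X → H) := by
  have hball : ∀ (v : H) (ε : ℝ), MeasurableSet ((point H : X → H) ⁻¹' Metric.ball v ε) := by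
    intro v ε
    have h1 : Measurable fun x : X => dist (point H x) v := by
      have h2 : ∀ x : X, dist (point H x) v = √(ker H x x - 2 * v x + ‖v‖ ^ 2) := by
        intro x
        rw [dist_eq_norm, ker_eq_inner, real_inner_self_eq_norm_sq, ← inner_point,
          ← norm_sub_sq_real, Real.sqrt_sq (norm_nonneg _)]
      simp_rw [h2]
      have h3 : Measurable (Function.uncurry (ker H : X → X → ℝ) ∘ fun x => (x, x)) :=
        hK.comp (measurable_id.prodMk measurable_id)
      exact ((h3.sub ((measurable_coe hK v).const_mul 2)).add_const _).sqrt
    exact measurableSet_lt h1 measurable_const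
  refine measurable_of_isOpen fun U hU => ?_
  have hcov : U = ⋃ p ∈ {p : ℕ × ℕ | Metric.ball (TopologicalSpace.denseSeq H p.1)
      (1 / ((p.2 : ℝ) + 1)) ⊆ U},
      Metric.ball (TopologicalSpace.denseSeq H p.1) (1 / ((p.2 : ℝ) + 1)) := by
    refine Set.Subset.antisymm (fun u hu => ?_) (Set.iUnion₂_subset fun p hp => hp)
    obtain ⟨ε, hε, hεU⟩ := Metric.isOpen_iff.1 hU u hu
    obtain ⟨k, hk⟩ := exists_nat_one_div_lt (half_pos hε)
    obtain ⟨n, hn⟩ := (TopologicalSpace.denseRange_denseSeq H).exists_dist_lt u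
      (Nat.one_div_pos_of_nat (α := ℝ) (n := k))
    refine Set.mem_iUnion₂.2 ⟨(n, k), fun w hw => hεU ?_, hn⟩
    have h1 : dist w (TopologicalSpace.denseSeq H n) < 1 / ((k : ℝ) + 1) := hw
    have h2 := dist_triangle w (TopologicalSpace.denseSeq H n) u
    rw [dist_comm (TopologicalSpace.denseSeq H n) u] at h2
    exact Metric.mem_ball.2 (by linarith)
  rw [hcov, Set.preimage_iUnion₂]
  exact MeasurableSet.biUnion (Set.to_countable _) fun p _ => hball _ _

end MeasurablePoint

/-! ### Exponential moments of sums of independent random vectors -/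

section Chain

variable {Ω : Type*} [MeasurableSpace Ω] {P : Measure Ω} [IsProbabilityMeasure P] {ι : Type*}

/-- The supermartingale argument for a sum of independent random variables: if adding one more
summand to any fixed state `s` does not increase the mean of the potential, then the potential of
the sum has mean at most `φ 0 0`. -/
theorem lintegral_potential_le {V : Type*} [AddCommMonoid V] [MeasurableSpace V]
    [MeasurableAdd₂ V] {Y : ι → Ω → V} (hY : ∀ i, Measurable (Y i)) (hindep : iIndepFun Y P)
    (M : AddSubmonoid V) (hM : ∀ i ω, Y i ω ∈ M) (φ : ℕ → V → ℝ≥0∞) (hφ : ∀ k, Measurable (φ k))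
    (n : ℕ) (J : Finset ι)
    (hstep : ∀ k < n, ∀ i ∈ J, ∀ s ∈ M, ∫⁻ ω, φ (k + 1) (s + Y i ω) ∂P ≤ φ k s)
    (hJ : J.card ≤ n) : ∫⁻ ω, φ J.card (∑ i ∈ J, Y i ω) ∂P ≤ φ 0 0 := by
  classical
  induction J using Finset.induction_on with
  | empty => simp
  | insert i J hi ih =>
    rw [Finset.card_insert_of_notMem hi] at hJ ⊢
    have hind : IndepFun (fun ω => ∑ j ∈ J, Y j ω) (Y i) P := by
      have := hindep.indepFun_finsetSum_of_notMem hY hi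
      convert this using 1
      ext ω; simp
    have hSm : Measurable fun ω => ∑ j ∈ J, Y j ω := Finset.measurable_sum _ fun j _ => hY j
    have hprod :=
      (indepFun_iff_map_prod_eq_prod_map_map hSm.aemeasurable (hY i).aemeasurable).1 hind
    have hF : Measurable fun p : V × V => φ (J.card + 1) (p.1 + p.2) :=
      (hφ _).comp measurable_add
    calc ∫⁻ ω, φ (J.card + 1) (∑ j ∈ insert i J, Y j ω) ∂P
        = ∫⁻ ω, φ (J.card + 1) ((∑ j ∈ J, Y j ω) + Y i ω) ∂P := by
          simp_rw [Finset.sum_insert hi, add_comm (Y i _)]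
      _ = ∫⁻ p, φ (J.card + 1) (p.1 + p.2) ∂(P.map fun ω => (∑ j ∈ J, Y j ω, Y i ω)) :=
          (lintegral_map hF (hSm.prodMk (hY i))).symm
      _ = ∫⁻ s, ∫⁻ y, φ (J.card + 1) (s + y) ∂(P.map (Y i)) ∂(P.map fun ω => ∑ j ∈ J, Y j ω) := by
          rw [hprod, lintegral_prod _ hF.aemeasurable]
      _ = ∫⁻ ω, ∫⁻ y, φ (J.card + 1) ((∑ j ∈ J, Y j ω) + y) ∂(P.map (Y i)) ∂P := by
          rw [lintegral_map (Measurable.lintegral_prod_right' hF) hSm]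
      _ ≤ ∫⁻ ω, φ J.card (∑ j ∈ J, Y j ω) ∂P := by
          refine lintegral_mono fun ω => ?_
          have hF' : Measurable fun y => φ (J.card + 1) ((∑ j ∈ J, Y j ω) + y) :=
            hF.comp (measurable_const.prodMk measurable_id)
          rw [lintegral_map hF' (hY i)]
          exact hstep _ (by omega) i (Finset.mem_insert_self _ _) _
            (M.sum_mem fun j _ => hM j ω)
      _ ≤ _ := ih (fun k hk j hj => hstep k hk j (Finset.mem_insert_of_mem hj)) (by omega)

theorem cosh_sqrt_convex_comb {θ p q : ℝ} (hθ : θ ∈ Set.Icc (0 : ℝ) 1) (hp : 0 ≤ p) (hq : 0 ≤ q) :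
    Real.cosh √(θ * p + (1 - θ) * q) ≤ θ * Real.cosh √p + (1 - θ) * Real.cosh √q := by
  have h1 := Real.hasSum_cosh √(θ * p + (1 - θ) * q)
  have h2 := ((Real.hasSum_cosh √p).mul_left θ).add ((Real.hasSum_cosh √q).mul_left (1 - θ))
  have hθ' : 0 ≤ 1 - θ := sub_nonneg.2 hθ.2
  refine hasSum_le (fun n => ?_) h1 h2
  have h0 : 0 ≤ θ * p + (1 - θ) * q :=
    add_nonneg (mul_nonneg hθ.1 hp) (mul_nonneg hθ' hq)
  rw [pow_mul, pow_mul, pow_mul, Real.sq_sqrt h0, Real.sq_sqrt hp, Real.sq_sqrt hq,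
    mul_div_assoc', mul_div_assoc', ← add_div]
  refine div_le_div_of_nonneg_right ?_ (by positivity)
  have := (convexOn_pow n).2 (Set.mem_Ici.2 hp) (Set.mem_Ici.2 hq) hθ.1 hθ' (by ring)
  simp only [smul_eq_mul] at this
  exact this

/-- The inequality behind the martingale method for Hilbert space valued sums, with `a = ‖x‖`,
`b = ‖y‖` and `c = ⟪x, y⟫`. The left side is convex in `c` and the right side affine, so that only
`c = ± a b` matter, where the left side is `cosh (a ± b)`. -/
theorem cosh_sqrt_add_le {a b c : ℝ} (ha : 0 ≤ a) (hb : 0 ≤ b) (hc : |c| ≤ a * b) :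
    Real.cosh √(a ^ 2 + b ^ 2 + 2 * c)
      ≤ Real.cosh a + Real.sinh a / a * c + Real.cosh a * (Real.exp b - 1 - b) := by
  have hexp : Real.exp b = Real.cosh b + Real.sinh b := (Real.cosh_add_sinh b).symm
  have hsb : b ≤ Real.sinh b := Real.self_le_sinh_iff.2 hb
  have hsa : Real.sinh a ≤ Real.cosh a := by
    have := Real.cosh_sub_sinh a
    have := Real.exp_pos (-a)
    linarith
  have hsa0 : 0 ≤ Real.sinh a := Real.sinh_nonneg_iff.2 ha
  have hend1 : Real.cosh (a + b) ≤ Real.cosh a + b * Real.sinh a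
      + Real.cosh a * (Real.exp b - 1 - b) := by
    rw [Real.cosh_add, hexp]
    nlinarith
  have hend2 : Real.cosh (a - b) ≤ Real.cosh a - b * Real.sinh a
      + Real.cosh a * (Real.exp b - 1 - b) := by
    rw [Real.cosh_sub, hexp]
    nlinarith
  rcases (mul_nonneg ha hb).eq_or_lt with hab | hab
  · have hc0 : c = 0 := by
      rw [← hab] at hc
      exact abs_nonpos_iff.1 hc
    have h1 : √(a ^ 2 + b ^ 2 + 2 * c) = a + b := by
      rw [hc0, mul_zero, add_zero, ← Real.sqrt_sq (add_nonneg ha hb)]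
      congr 1
      rw [add_sq]; linarith
    rw [h1, hc0, mul_zero, add_zero]
    rcases mul_eq_zero.1 hab.symm with h | h
    · subst h; simpa using hend1
    · subst h; simp
  · have ha0 : a ≠ 0 := fun h => by simp [h] at hab
    set θ := (1 + c / (a * b)) / 2 with hθdef
    have hcab : c = (2 * θ - 1) * (a * b) := by
      have hb0 : b ≠ 0 := fun h => by simp [h] at hab
      rw [hθdef]; field_simp; ring
    have hθ : θ ∈ Set.Icc (0 : ℝ) 1 := by
      have h1 := abs_le.1 hc
      have h2 : -1 ≤ c / (a * b) := by rw [le_div_iff₀ hab]; linarith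
      have h3 : c / (a * b) ≤ 1 := by rw [div_le_iff₀ hab]; linarith
      constructor <;> rw [hθdef] <;> linarith
    have h1 : a ^ 2 + b ^ 2 + 2 * c = θ * (a + b) ^ 2 + (1 - θ) * (a - b) ^ 2 := by
      rw [hcab]; ring
    have h2 := cosh_sqrt_convex_comb hθ (sq_nonneg (a + b)) (sq_nonneg (a - b))
    rw [← h1, Real.sqrt_sq (add_nonneg ha hb), Real.sqrt_sq_eq_abs, Real.cosh_abs] at h2
    have h3 : Real.sinh a / a * c = (2 * θ - 1) * (b * Real.sinh a) := by
      rw [hcab]; field_simp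
    rw [h3]
    nlinarith [mul_le_mul_of_nonneg_left hend1 hθ.1,
      mul_le_mul_of_nonneg_left hend2 (sub_nonneg.2 hθ.2)]

theorem lintegral_ofReal_le_of_le_add {F g h : Ω → ℝ} {c w : ℝ} (hF : ∀ ω, 0 ≤ F ω)
    (hle : ∀ ω, F ω ≤ c + g ω + h ω) (hg : Integrable g P) (hg0 : ∫ ω, g ω ∂P = 0)
    (hh : Measurable h) (hh0 : ∀ ω, 0 ≤ h ω)
    (hw : ∫⁻ ω, ENNReal.ofReal (h ω) ∂P ≤ ENNReal.ofReal w) (hw0 : 0 ≤ w) :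
    ∫⁻ ω, ENNReal.ofReal (F ω) ∂P ≤ ENNReal.ofReal (c + w) := by
  have hint : Integrable h P := by
    refine ⟨hh.aestronglyMeasurable, ?_⟩
    rw [hasFiniteIntegral_iff_ofReal (Filter.Eventually.of_forall hh0)]
    exact hw.trans_lt ENNReal.ofReal_lt_top
  have hh1 : ∫ ω, h ω ∂P ≤ w := by
    rw [integral_eq_lintegral_of_nonneg_ae (Filter.Eventually.of_forall hh0)
      hh.aestronglyMeasurable]
    exact ENNReal.toReal_le_of_le_ofReal hw0 hw
  have hsum : Integrable (fun ω => c + g ω + h ω) P := ((integrable_const c).add hg).add hint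
  calc ∫⁻ ω, ENNReal.ofReal (F ω) ∂P ≤ ∫⁻ ω, ENNReal.ofReal (c + g ω + h ω) ∂P :=
        lintegral_mono fun ω => ENNReal.ofReal_le_ofReal (hle ω)
    _ = ENNReal.ofReal (∫ ω, c + g ω + h ω ∂P) :=
        (ofReal_integral_eq_lintegral_ofReal hsum
          (Filter.Eventually.of_forall fun ω => (hF ω).trans (hle ω))).symm
    _ ≤ _ := by
        refine ENNReal.ofReal_le_ofReal ?_
        have e1 : ∫ ω, c + g ω + h ω ∂P = ∫ ω, c + g ω ∂P + ∫ ω, h ω ∂P :=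
          integral_add ((integrable_const c).add hg) hint
        have e2 : ∫ ω, c + g ω ∂P = ∫ ω, c ∂P + ∫ ω, g ω ∂P :=
          integral_add (integrable_const c) hg
        rw [e1, e2, hg0]
        simpa using hh1

end Chain

section Bernstein

variable {Ω : Type*} [MeasurableSpace Ω] {P : Measure Ω} [IsProbabilityMeasure P] {ι : Type*}
  {H E : Type*} [NormedAddCommGroup H] [InnerProductSpace ℝ H] [CompleteSpace H]
  [MeasurableSpace H] [BorelSpace H]
  [NormedAddCommGroup E] [InnerProductSpace ℝ E] [CompleteSpace E]

theorem measurable_resForm_self (S : H →L[ℝ] E) (lam : ℝ) :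
    Measurable fun a : H => √(resForm S lam a a) := by
  have : Continuous fun a : H => √(resForm S lam a a) := by
    unfold resForm
    fun_prop
  exact this.measurable

/-- A Bernstein inequality in the norm `b ↦ √⟪b, (S† S + lam)⁻¹ b⟫`, for independent random vectors
that are centered in the weak sense. -/
theorem measure_le_sqrt_resForm_sum_le [TopologicalSpace.SeparableSpace H] (S : H →L[ℝ] E)
    {lam : ℝ} (hlam : 0 < lam)
    {Y : ι → Ω → H} (hY : ∀ i, Measurable (Y i)) (hindep : iIndepFun Y P) (J : Finset ι)
    (hmean : ∀ i ∈ J, ∀ a : H, Integrable (fun ω => inner ℝ a (Y i ω)) P ∧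
      ∫ ω, inner ℝ a (Y i ω) ∂P = 0)
    {σ v : ℝ} (hσ : 0 < σ) (hv : 0 ≤ v)
    (hexp : ∀ i ∈ J, ∫⁻ ω, ENNReal.ofReal (Real.exp (σ * √(resForm S lam (Y i ω) (Y i ω))) - 1
      - σ * √(resForm S lam (Y i ω) (Y i ω))) ∂P ≤ ENNReal.ofReal v) (t : ℝ) :
    P {ω | t ≤ √(resForm S lam (∑ i ∈ J, Y i ω) (∑ i ∈ J, Y i ω))}
      ≤ ENNReal.ofReal (2 * Real.exp (J.card * v - σ * t)) := by
  set N : H → ℝ := fun a => √(resForm S lam a a) with hN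
  have hNm : Measurable N := measurable_resForm_self S lam
  set φ : ℕ → H → ℝ≥0∞ := fun k s => ENNReal.ofReal (Real.cosh (σ * N s) / (1 + v) ^ k) with hφ
  have hφm : ∀ k, Measurable (φ k) := fun k =>
    ((Real.continuous_cosh.measurable.comp (hNm.const_mul σ)).div_const _).ennreal_ofReal
  have hstep : ∀ k < J.card, ∀ i ∈ J, ∀ s ∈ (⊤ : AddSubmonoid H),
      ∫⁻ ω, φ (k + 1) (s + Y i ω) ∂P ≤ φ k s := by
    intro k _ i hi s _
    have hv1 : 0 < (1 + v) ^ (k + 1) := by positivity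
    have hmain : ∫⁻ ω, ENNReal.ofReal (Real.cosh (σ * N (s + Y i ω))) ∂P
        ≤ ENNReal.ofReal (Real.cosh (σ * N s) + Real.cosh (σ * N s) * v) := by
      set D := Real.sinh (σ * N s) / (σ * N s) * σ ^ 2 with hD
      refine lintegral_ofReal_le_of_le_add (g := fun ω => D * resForm S lam s (Y i ω))
        (h := fun ω => Real.cosh (σ * N s) * (Real.exp (σ * N (Y i ω)) - 1 - σ * N (Y i ω)))
        (fun ω => (Real.cosh_pos _).le) (fun ω => ?_) ?_ ?_ ?_ (fun ω => ?_) ?_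
        (mul_nonneg (Real.cosh_pos _).le hv)
      · have hc : |σ ^ 2 * resForm S lam s (Y i ω)| ≤ (σ * N s) * (σ * N (Y i ω)) := by
          rw [abs_mul, abs_of_nonneg (sq_nonneg σ)]
          calc _ ≤ σ ^ 2 * (N s * N (Y i ω)) :=
                mul_le_mul_of_nonneg_left (abs_resForm_le S hlam _ _) (sq_nonneg σ)
            _ = _ := by ring
        have h1 := cosh_sqrt_add_le (mul_nonneg hσ.le (Real.sqrt_nonneg _))
          (mul_nonneg hσ.le (Real.sqrt_nonneg _)) hc
        have h2 : σ * N (s + Y i ω)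
            = √((σ * N s) ^ 2 + (σ * N (Y i ω)) ^ 2 + 2 * (σ ^ 2 * resForm S lam s (Y i ω))) := by
          rw [mul_pow, mul_pow, hN, Real.sq_sqrt (resForm_self_nonneg S hlam _),
            Real.sq_sqrt (resForm_self_nonneg S hlam _)]
          rw [← Real.sqrt_sq hσ.le, ← Real.sqrt_mul (sq_nonneg σ), Real.sqrt_sq hσ.le]
          congr 1
          rw [resForm_add_left, resForm_add_right, resForm_add_right,
            resForm_comm S hlam (Y i ω) s]
          ring
        rw [h2]
        calc _ ≤ _ := h1
          _ = _ := by rw [hD]; ring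
      · have := ((hmean i hi (resolvent S lam s)).1).const_mul D
        refine this.congr (Filter.Eventually.of_forall fun ω => ?_)
        simp only
        rw [resForm_comm S hlam, resForm, real_inner_comm]
      · have := (hmean i hi (resolvent S lam s)).2
        rw [integral_const_mul]
        have h3 : ∀ ω, resForm S lam s (Y i ω) = inner ℝ (resolvent S lam s) (Y i ω) := fun ω => by
          rw [resForm_comm S hlam, resForm, real_inner_comm]
        simp_rw [h3, this, mul_zero]
      · have h4 : Measurable fun ω => σ * N (Y i ω) := (hNm.comp (hY i)).const_mul σ
        exact ((h4.exp.sub_const 1).sub h4).const_mul _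
      · have := Real.add_one_le_exp (σ * N (Y i ω))
        exact mul_nonneg (Real.cosh_pos _).le (by linarith)
      · simp_rw [ENNReal.ofReal_mul (Real.cosh_pos (σ * N s)).le]
        rw [lintegral_const_mul' _ _ ENNReal.ofReal_ne_top]
        exact mul_le_mul_right (hexp i hi) _
    simp only [hφ]
    simp_rw [div_eq_mul_inv, ENNReal.ofReal_mul (Real.cosh_pos _).le]
    rw [lintegral_mul_const' _ _ ENNReal.ofReal_ne_top]
    refine (mul_le_mul_left hmain _).trans (le_of_eq ?_)
    rw [← ENNReal.ofReal_mul (by have := Real.cosh_pos (σ * N s); positivity),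
      ← ENNReal.ofReal_mul (Real.cosh_pos _).le]
    congr 1
    rw [pow_succ]
    field_simp
  have hmain := lintegral_potential_le hY hindep ⊤ (fun _ _ => trivial) φ hφm J.card J hstep le_rfl
  have h0 : φ 0 0 = 1 := by simp [hφ, hN, resForm]
  rw [h0] at hmain
  set W : Ω → H := fun ω => ∑ i ∈ J, Y i ω with hW
  have hWm : Measurable W := Finset.measurable_sum _ fun i _ => hY i
  set c := Real.exp (σ * t - J.card * v) / 2 with hc
  have hcpos : 0 < c := by positivity
  have hsub : {ω | t ≤ N (W ω)} ⊆ {ω | ENNReal.ofReal c ≤ φ J.card (W ω)} := by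
    intro ω hω
    refine ENNReal.ofReal_le_ofReal ?_
    have h1 : Real.exp (σ * t) / 2 ≤ Real.cosh (σ * N (W ω)) := by
      rw [Real.cosh_eq]
      have h2 : Real.exp (σ * t) ≤ Real.exp (σ * N (W ω)) :=
        Real.exp_le_exp.2 (mul_le_mul_of_nonneg_left hω hσ.le)
      have := Real.exp_pos (-(σ * N (W ω)))
      linarith
    have h3 : (1 + v) ^ J.card ≤ Real.exp (J.card * v) := by
      rw [Real.exp_nat_mul]
      gcongr
      rw [add_comm]; exact Real.add_one_le_exp v
    rw [hc, Real.exp_sub]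
    calc _ = Real.exp (σ * t) / 2 / Real.exp (J.card * v) := by ring
      _ ≤ _ := by gcongr
  calc P {ω | t ≤ N (W ω)} ≤ P {ω | ENNReal.ofReal c ≤ φ J.card (W ω)} := measure_mono hsub
    _ ≤ (∫⁻ ω, φ J.card (W ω) ∂P) / ENNReal.ofReal c :=
        meas_ge_le_lintegral_div ((hφm _).comp hWm).aemeasurable
          (ENNReal.ofReal_pos.2 hcpos).ne' ENNReal.ofReal_ne_top
    _ ≤ 1 / ENNReal.ofReal c := ENNReal.div_le_div_right hmain _
    _ = _ := by
        rw [one_div, ← ENNReal.ofReal_inv_of_pos hcpos, hc, inv_div, div_eq_mul_inv,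
          ← Real.exp_neg, neg_sub]

end Bernstein

/-! ### Trace inequalities for powers of inverse matrices -/

section Trace

open Matrix

variable {ι : Type*}

theorem transpose_eq_of_posSemidef {M : Matrix ι ι ℝ} (hM : M.PosSemidef) : Mᵀ = M := by
  have := hM.isHermitian
  rwa [IsHermitian, conjTranspose_eq_transpose_of_trivial] at this

variable [Fintype ι]

theorem dotProduct_mulVec_nonneg_of_posSemidef {M : Matrix ι ι ℝ} (hM : M.PosSemidef) (x : ι → ℝ) :
    0 ≤ x ⬝ᵥ M *ᵥ x := by
  simpa using hM.dotProduct_mulVec_nonneg x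

theorem posSemidef_conj {M : Matrix ι ι ℝ} (hM : M.PosSemidef) {A : Matrix ι ι ℝ} (hA : Aᵀ = A) :
    (A * M * A).PosSemidef := by
  have := hM.mul_mul_conjTranspose_same A
  rwa [conjTranspose_eq_transpose_of_trivial, hA] at this

theorem posSemidef_vecMulVec (y : ι → ℝ) : (vecMulVec y y).PosSemidef := by
  simpa using posSemidef_vecMulVec_self_star y

variable [DecidableEq ι]

theorem exists_diagonalization {M : Matrix ι ι ℝ} (hM : M.PosSemidef) :
    ∃ (U : Matrix ι ι ℝ) (d : ι → ℝ), Uᵀ * U = 1 ∧ U * Uᵀ = 1 ∧ (∀ t, 0 ≤ d t) ∧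
      M = U * diagonal d * Uᵀ := by
  have hs : star (hM.isHermitian.eigenvectorUnitary : Matrix ι ι ℝ)
      = (hM.isHermitian.eigenvectorUnitary : Matrix ι ι ℝ)ᵀ := by
    rw [star_eq_conjTranspose, conjTranspose_eq_transpose_of_trivial]
  refine ⟨hM.isHermitian.eigenvectorUnitary, hM.isHermitian.eigenvalues, ?_, ?_,
    fun t => hM.eigenvalues_nonneg t, ?_⟩
  · rw [← hs]; exact Unitary.coe_star_mul_self _
  · rw [← hs]; exact Unitary.coe_mul_star_self _
  · have h := hM.isHermitian.spectral_theorem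
    rw [Unitary.conjStarAlgAut_apply, hs] at h
    exact h

theorem trace_mul_nonneg {A B : Matrix ι ι ℝ} (hA : A.PosSemidef) (hB : B.PosSemidef) :
    0 ≤ (A * B).trace := by
  obtain ⟨U, d, -, -, hd, rfl⟩ := exists_diagonalization hB
  have h1 : (A * (U * diagonal d * Uᵀ)).trace = (Uᵀ * A * U * diagonal d).trace := by
    rw [← Matrix.mul_assoc, trace_mul_comm, ← Matrix.mul_assoc, ← Matrix.mul_assoc]
  rw [h1, trace]
  refine Finset.sum_nonneg fun t _ => ?_
  rw [diag_apply, mul_diagonal]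
  have h2 : (Uᵀ * A * U).PosSemidef := by
    have := hA.conjTranspose_mul_mul_same U
    rwa [conjTranspose_eq_transpose_of_trivial] at this
  exact mul_nonneg h2.diag_nonneg (hd t)

/-- The tangent line inequality `x ^ p ≥ y ^ p + p y ^ (p - 1) (x - y)` for a positive semidefinite
matrix `x` and a number `y`, with `p = q + 1`; the difference `G_p` of the two sides satisfies
`G_(p+1) = x G_p + p y ^ (p - 1) (x - y) ^ 2`. -/
theorem posSemidef_pow_sub_tangent {F : Matrix ι ι ℝ} (hF : F.PosSemidef) {y : ℝ} (hy : 0 ≤ y)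
    (q : ℕ) : (F ^ (q + 1) - (((q + 1 : ℕ) : ℝ) * y ^ q) • F
      + ((q : ℝ) * y ^ (q + 1)) • (1 : Matrix ι ι ℝ)).PosSemidef := by
  have key : ∀ (q k : ℕ), (F ^ k * (F ^ (q + 1) - (((q + 1 : ℕ) : ℝ) * y ^ q) • F
      + ((q : ℝ) * y ^ (q + 1)) • (1 : Matrix ι ι ℝ))).PosSemidef := by
    intro q
    induction q with
    | zero => intro k; simpa using PosSemidef.zero
    | succ q ih =>
      intro k
      have h1 := ih (k + 1)
      have hsymm : (F - y • (1 : Matrix ι ι ℝ))ᵀ = F - y • (1 : Matrix ι ι ℝ) := by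
        simp [transpose_eq_of_posSemidef hF]
      have h2 := (posSemidef_conj (hF.pow k) hsymm).smul
        (show (0 : ℝ) ≤ ((q + 1 : ℕ) : ℝ) * y ^ q by positivity)
      convert h1.add h2 using 1
      have hc : (F - y • (1 : Matrix ι ι ℝ)) * F ^ k = F ^ k * (F - y • (1 : Matrix ι ι ℝ)) := by
        rw [sub_mul, mul_sub, smul_mul_assoc, mul_smul_comm, one_mul, mul_one, ← pow_succ,
          ← pow_succ']
      rw [hc, pow_succ F k, mul_assoc, mul_assoc, ← mul_smul_comm, ← mul_add]
      congr 1
      simp only [mul_add, mul_sub, sub_mul, smul_mul_assoc, mul_smul_comm, one_mul, mul_one,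
        smul_sub, smul_smul]
      rw [← pow_succ' F (q + 1)]
      push_cast
      module
  have := key q 0
  rwa [pow_zero, one_mul] at this

/-- Klein's inequality for the convex function `x ↦ x ^ p`, with `p = q + 1`. -/
theorem trace_pow_add_le {A B : Matrix ι ι ℝ} (hA : A.PosSemidef) (hB : B.PosSemidef) (q : ℕ) :
    (A ^ (q + 1)).trace + ((q + 1 : ℕ) : ℝ) * (A ^ q * (B - A)).trace ≤ (B ^ (q + 1)).trace := by
  obtain ⟨U, d, hU1, hU2, hd, hAd⟩ := exists_diagonalization hA
  have hconjpow : ∀ (M : Matrix ι ι ℝ) (k : ℕ), (Uᵀ * M * U) ^ k = Uᵀ * M ^ k * U := by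
    intro M k
    induction k with
    | zero => simp [hU1]
    | succ k ih =>
      rw [pow_succ, ih, pow_succ]
      calc Uᵀ * M ^ k * U * (Uᵀ * M * U) = Uᵀ * M ^ k * (U * Uᵀ) * M * U := by
            simp only [Matrix.mul_assoc]
        _ = _ := by rw [hU2, Matrix.mul_one]; simp only [Matrix.mul_assoc]
  have hconjtr : ∀ M : Matrix ι ι ℝ, (Uᵀ * M * U).trace = M.trace := by
    intro M
    rw [trace_mul_comm, ← Matrix.mul_assoc, hU2, Matrix.one_mul]
  have hAdiag : Uᵀ * A * U = diagonal d := by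
    rw [hAd]
    calc Uᵀ * (U * diagonal d * Uᵀ) * U = (Uᵀ * U) * diagonal d * (Uᵀ * U) := by
          simp only [Matrix.mul_assoc]
      _ = _ := by rw [hU1]; simp
  set F := Uᵀ * B * U with hF
  have hFpsd : F.PosSemidef := by
    have := hB.conjTranspose_mul_mul_same U
    rwa [conjTranspose_eq_transpose_of_trivial] at this
  have h1 : (A ^ (q + 1)).trace = ∑ t, d t ^ (q + 1) := by
    rw [← hconjtr, ← hconjpow, hAdiag, diagonal_pow, trace_diagonal]; simp
  have h2 : (A ^ q * (B - A)).trace = ∑ t, d t ^ q * (F t t - d t) := by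
    have : Uᵀ * (A ^ q * (B - A)) * U = diagonal (d ^ q) * (F - diagonal d) := by
      rw [← diagonal_pow, ← hAdiag, hconjpow, hF, ← Matrix.sub_mul, ← Matrix.mul_sub]
      calc Uᵀ * (A ^ q * (B - A)) * U = Uᵀ * A ^ q * 1 * ((B - A) * U) := by
            simp only [Matrix.mul_assoc, Matrix.one_mul]
        _ = _ := by rw [← hU2]; simp only [Matrix.mul_assoc]
    rw [← hconjtr, this, trace]
    refine Finset.sum_congr rfl fun t _ => ?_
    simp [diagonal_mul]
  have h3 : (B ^ (q + 1)).trace = ∑ t, (F ^ (q + 1)) t t := by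
    rw [← hconjtr, ← hconjpow]; rfl
  rw [h1, h2, h3, Finset.mul_sum, ← Finset.sum_add_distrib]
  refine Finset.sum_le_sum fun t _ => ?_
  have h4 := (posSemidef_pow_sub_tangent hFpsd (hd t) q).diag_nonneg (i := t)
  simp only [Matrix.add_apply, Matrix.sub_apply, Matrix.smul_apply, one_apply_eq, smul_eq_mul,
    mul_one] at h4
  rw [pow_succ (d t)] at h4 ⊢
  push_cast at h4 ⊢
  linarith

theorem inv_add_eq {B C : Matrix ι ι ℝ} (hB : IsUnit B) (hBC : IsUnit (B + C)) :
    (B + C)⁻¹ = B⁻¹ - B⁻¹ * C * B⁻¹ + B⁻¹ * C * (B + C)⁻¹ * C * B⁻¹ := by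
  have hB' := (isUnit_iff_isUnit_det B).1 hB
  have hBC' := (isUnit_iff_isUnit_det (B + C)).1 hBC
  have h1 : (B + C)⁻¹ = B⁻¹ - B⁻¹ * C * (B + C)⁻¹ := by
    have : B⁻¹ * (B + C) * (B + C)⁻¹ = B⁻¹ := by
      rw [Matrix.mul_assoc, mul_nonsing_inv _ hBC', Matrix.mul_one]
    rw [Matrix.mul_add, nonsing_inv_mul _ hB', Matrix.add_mul, Matrix.one_mul] at this
    exact eq_sub_of_add_eq this
  have h2 : (B + C)⁻¹ = B⁻¹ - (B + C)⁻¹ * C * B⁻¹ := by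
    have : (B + C)⁻¹ * (B + C) * B⁻¹ = B⁻¹ := by
      rw [nonsing_inv_mul _ hBC', Matrix.one_mul]
    rw [Matrix.mul_assoc, Matrix.add_mul, mul_nonsing_inv _ hB', Matrix.mul_add, Matrix.mul_one,
      ← Matrix.mul_assoc] at this
    exact eq_sub_of_add_eq this
  conv_lhs => rw [h1, h2]
  simp only [Matrix.mul_sub, Matrix.mul_assoc]
  abel

/-- The tangent line inequality for the convex function `B ↦ Tr B⁻ᵖ`, with `p = q + 1`. -/
theorem trace_inv_pow_le_add {B C : Matrix ι ι ℝ} (hB : B.PosDef) (hC : C.PosSemidef) (q : ℕ) :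
    (B⁻¹ ^ (q + 1)).trace
      ≤ ((B + C)⁻¹ ^ (q + 1)).trace + ((q + 1 : ℕ) : ℝ) * (B⁻¹ ^ (q + 2) * C).trace := by
  have hBC : (B + C).PosDef := hB.add_posSemidef hC
  have h1 := trace_pow_add_le hB.inv.posSemidef hBC.inv.posSemidef q
  have hBt := transpose_eq_of_posSemidef hB.inv.posSemidef
  have hCt := transpose_eq_of_posSemidef hC
  have h2 : 0 ≤ (B⁻¹ ^ q * (B⁻¹ * C * (B + C)⁻¹ * C * B⁻¹)).trace := by
    refine trace_mul_nonneg (hB.inv.posSemidef.pow q) ?_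
    have := posSemidef_conj (posSemidef_conj hBC.inv.posSemidef hCt) hBt
    simpa only [Matrix.mul_assoc] using this
  have h3 : (B⁻¹ ^ q * (B⁻¹ * C * B⁻¹)).trace = (B⁻¹ ^ (q + 2) * C).trace := by
    rw [← Matrix.mul_assoc, trace_mul_comm, pow_succ', pow_succ]
    simp only [Matrix.mul_assoc]
  have h4 : (B + C)⁻¹ - B⁻¹ = -(B⁻¹ * C * B⁻¹) + B⁻¹ * C * (B + C)⁻¹ * C * B⁻¹ := by
    nth_rw 1 [inv_add_eq hB.isUnit hBC.isUnit]
    abel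
  rw [h4, Matrix.mul_add, trace_add, Matrix.mul_neg, trace_neg, h3] at h1
  have h5 : (0 : ℝ) ≤ ((q + 1 : ℕ) : ℝ) := Nat.cast_nonneg _
  nlinarith [mul_nonneg h5 h2]

theorem dotProduct_pow_mulVec_sq_le {E : Matrix ι ι ℝ} (hE : E.PosDef) (y : ι → ℝ) (k : ℕ) :
    (y ⬝ᵥ E ^ (k + 1) *ᵥ y) ^ 2 ≤ (y ⬝ᵥ E ^ k *ᵥ y) * (y ⬝ᵥ E ^ (k + 2) *ᵥ y) := by
  have hEt := transpose_eq_of_posSemidef hE.posSemidef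
  have hquad : ∀ t : ℝ, 0 ≤ (y ⬝ᵥ E ^ k *ᵥ y) * (t * t)
      + (2 * (y ⬝ᵥ E ^ (k + 1) *ᵥ y)) * t + y ⬝ᵥ E ^ (k + 2) *ᵥ y := by
    intro t
    have hs : (t • (1 : Matrix ι ι ℝ) + E)ᵀ = t • (1 : Matrix ι ι ℝ) + E := by simp [hEt]
    have h1 := dotProduct_mulVec_nonneg_of_posSemidef
      (posSemidef_conj (hE.posSemidef.pow k) hs) y
    have h2 : (t • (1 : Matrix ι ι ℝ) + E) * E ^ k * (t • (1 : Matrix ι ι ℝ) + E)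
        = (t * t) • E ^ k + (2 * t) • E ^ (k + 1) + E ^ (k + 2) := by
      simp only [add_mul, mul_add, smul_mul_assoc, mul_smul_comm, one_mul, mul_one]
      rw [← pow_succ', ← pow_succ, ← pow_succ]
      module
    rw [h2] at h1
    simp only [add_mulVec, smul_mulVec, dotProduct_add, dotProduct_smul, smul_eq_mul] at h1
    linarith
  have := discrim_le_zero hquad
  rw [discrim] at this
  nlinarith

/-- Log-convexity of the moments `k ↦ yᵀ Eᵏ y`. -/
theorem dotProduct_pow_mul_le {E : Matrix ι ι ℝ} (hE : E.PosDef) (y : ι → ℝ) (s i j : ℕ) :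
    (y ⬝ᵥ E ^ (s + i) *ᵥ y) * (y ⬝ᵥ E ^ (s + j) *ᵥ y)
      ≤ (y ⬝ᵥ E ^ s *ᵥ y) * (y ⬝ᵥ E ^ (s + i + j) *ᵥ y) := by
  rcases eq_or_ne y 0 with rfl | hy
  · simp
  have hpd : ∀ k : ℕ, (E ^ k).PosDef := by
    intro k
    refine (hE.posSemidef.pow k).posDef_iff_isUnit.2 (hE.isUnit.pow k)
  have hpos : ∀ k, 0 < y ⬝ᵥ E ^ k *ᵥ y := fun k => by
    simpa using (hpd k).dotProduct_mulVec_pos hy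
  have hmono : Monotone fun k => (y ⬝ᵥ E ^ (k + 1) *ᵥ y) / (y ⬝ᵥ E ^ k *ᵥ y) := by
    refine monotone_nat_of_le_succ fun k => ?_
    rw [div_le_div_iff₀ (hpos _) (hpos _), ← sq, mul_comm]
    exact dotProduct_pow_mulVec_sq_le hE y k
  induction i with
  | zero => simp
  | succ i ih =>
    have h1 := hmono (Nat.le_add_right (s + i) j)
    simp only at h1
    have h2 : y ⬝ᵥ E ^ (s + i + 1) *ᵥ y
        = (y ⬝ᵥ E ^ (s + i + 1) *ᵥ y) / (y ⬝ᵥ E ^ (s + i) *ᵥ y) * (y ⬝ᵥ E ^ (s + i) *ᵥ y) := by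
      rw [div_mul_cancel₀ _ (hpos (s + i)).ne']
    calc _ = (y ⬝ᵥ E ^ (s + i + 1) *ᵥ y) / (y ⬝ᵥ E ^ (s + i) *ᵥ y)
            * ((y ⬝ᵥ E ^ (s + i) *ᵥ y) * (y ⬝ᵥ E ^ (s + j) *ᵥ y)) := by
          rw [← mul_assoc, ← h2, add_assoc]
      _ ≤ (y ⬝ᵥ E ^ (s + i + j + 1) *ᵥ y) / (y ⬝ᵥ E ^ (s + i + j) *ᵥ y)
            * ((y ⬝ᵥ E ^ s *ᵥ y) * (y ⬝ᵥ E ^ (s + i + j) *ᵥ y)) :=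
          mul_le_mul h1 ih (mul_pos (hpos _) (hpos _)).le
            (div_nonneg (hpos _).le (hpos _).le)
      _ = _ := by
          have := (hpos (s + i + j)).ne'
          rw [show s + (i + 1) + j = s + i + j + 1 by ring]
          field_simp

/-- The decrease of `Tr B⁻ᵖ`, with `p = q + 1`, under the rank one update `B + y yᵀ`. In terms of
`a = yᵀ B⁻¹ y` it is at least `p (1 - q a) / (1 + a) · yᵀ B⁻⁽ᵖ⁺¹⁾ y`. The inverse of the update is
`B⁻¹ - z zᵀ / (1 + a)` with `z = B⁻¹ y` (Sherman-Morrison), and the powers are compared by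
telescoping sums. -/
theorem trace_inv_pow_add_vecMulVec_le {B : Matrix ι ι ℝ} (hB : B.PosDef) (y : ι → ℝ) (q : ℕ) :
    ((B + vecMulVec y y)⁻¹ ^ (q + 1)).trace + ((q + 1 : ℕ) : ℝ)
        * ((1 - q * (y ⬝ᵥ B⁻¹ *ᵥ y)) / (1 + y ⬝ᵥ B⁻¹ *ᵥ y)) * (y ⬝ᵥ B⁻¹ ^ (q + 2) *ᵥ y)
      ≤ (B⁻¹ ^ (q + 1)).trace := by
  set E := B⁻¹ with hEdef
  have hE : E.PosDef := hB.inv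
  have hEt := transpose_eq_of_posSemidef hE.posSemidef
  have hBu := (isUnit_iff_isUnit_det B).1 hB.isUnit
  set z := E *ᵥ y with hz
  set a := y ⬝ᵥ z with ha
  have ha0 : 0 ≤ a := dotProduct_mulVec_nonneg_of_posSemidef hE.posSemidef y
  set c := 1 / (1 + a) with hc
  have hc0 : 0 ≤ c := by positivity
  have hc1 : c ≤ 1 := by rw [hc, div_le_one (by positivity)]; linarith
  set E' := (B + vecMulVec y y)⁻¹ with hE'def
  have hBy : (B + vecMulVec y y).PosDef := hB.add_posSemidef (posSemidef_vecMulVec y)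
  have hE' : E'.PosDef := hBy.inv
  have hE't := transpose_eq_of_posSemidef hE'.posSemidef
  have hdiff : E = E' + c • vecMulVec z z := by
    have : E' = E - c • vecMulVec z z := by
      refine inv_eq_right_inv ?_
      have h1 : B *ᵥ z = y := by
        rw [hz, mulVec_mulVec, hEdef, mul_nonsing_inv _ hBu, one_mulVec]
      have h2 : y ᵥ* E = z := by rw [← mulVec_transpose, hEt]
      rw [Matrix.mul_sub, Matrix.add_mul, Matrix.add_mul, hEdef, mul_nonsing_inv _ hBu, ← hEdef,
        Matrix.mul_smul, Matrix.mul_smul, mul_vecMulVec, h1, vecMulVec_mul, h2,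
        vecMulVec_mul_vecMulVec, ← ha]
      have h3 : vecMulVec y (a • z) = a • vecMulVec y z := vecMulVec_smul _ _ _
      rw [h3, smul_smul, ← add_smul]
      have h4 : c + c * a = 1 := by rw [hc]; field_simp
      rw [h4, one_smul, add_sub_cancel_right]
    rw [this, sub_add_cancel]
  -- the mixed moments, and the exchange of one factor `E'` for a factor `E`
  set g : ℕ → ℕ → ℝ := fun j i => z ⬝ᵥ (E' ^ j * E ^ i) *ᵥ z with hg
  have hexch : ∀ j i, E' ^ j * E ^ (i + 1)
      = E' ^ (j + 1) * E ^ i + c • (E' ^ j * vecMulVec z z * E ^ i) := by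
    intro j i
    rw [pow_succ' E i]
    have : E' ^ j * (E * E ^ i) = E' ^ j * (E' + c • vecMulVec z z) * E ^ i := by
      rw [← hdiff, Matrix.mul_assoc]
    rw [this, Matrix.mul_add, Matrix.add_mul, ← pow_succ, Matrix.mul_smul, Matrix.smul_mul]
  have hrec : ∀ j i, g j (i + 1) = g (j + 1) i + c * (g j 0 * g 0 i) := by
    intro j i
    simp only [hg]
    rw [hexch, add_mulVec, dotProduct_add, smul_mulVec, dotProduct_smul, smul_eq_mul]
    congr 2
    rw [mul_vecMulVec, vecMulVec_mul, vecMulVec_mulVec]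
    simp [dotProduct_smul, dotProduct_mulVec, mul_comm]
  have htr : ∀ j i, (E' ^ j * E ^ (i + 1)).trace = (E' ^ (j + 1) * E ^ i).trace + c * g j i := by
    intro j i
    rw [hexch, trace_add, trace_smul, smul_eq_mul]
    congr 2
    simp only [hg]
    have hEi : (E ^ i)ᵀ = E ^ i := by rw [transpose_pow, hEt]
    have hEj : (E' ^ j)ᵀ = E' ^ j := by rw [transpose_pow, hE't]
    rw [mul_vecMulVec, vecMulVec_mul, trace_vecMulVec, ← mulVec_transpose, hEi,
      ← mulVec_mulVec, dotProduct_mulVec z, ← mulVec_transpose, hEj]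
  have hg0 : ∀ j, 0 ≤ g j 0 := fun j => by
    simpa [hg] using dotProduct_mulVec_nonneg_of_posSemidef (hE'.posSemidef.pow j) z
  have hf0 : ∀ i, 0 ≤ g 0 i := fun i => by
    simpa [hg] using dotProduct_mulVec_nonneg_of_posSemidef (hE.posSemidef.pow i) z
  have hfy : ∀ i, g 0 i = y ⬝ᵥ E ^ (i + 2) *ᵥ y := by
    intro i
    simp only [hg, pow_zero, Matrix.one_mul]
    rw [hz, dotProduct_comm, dotProduct_mulVec, ← mulVec_transpose, hEt, dotProduct_comm,
      mulVec_mulVec, mulVec_mulVec, Matrix.mul_assoc, ← pow_succ, ← pow_succ']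
  have hmix : ∀ j i, g j i ≤ g 0 (j + i) := by
    intro j
    induction j with
    | zero => intro i; simp
    | succ j ih =>
      intro i
      have h1 := hrec j i
      have h2 := mul_nonneg hc0 (mul_nonneg (hg0 j) (hf0 i))
      have h3 := ih (i + 1)
      rw [show j + (i + 1) = j + 1 + i by ring] at h3
      linarith
  have hlow : ∀ j i, (1 - j * a) * g 0 (j + i) ≤ g j i := by
    intro j
    induction j with
    | zero => intro i; simp
    | succ j ih =>
      intro i
      have h1 := hrec j i
      have h2 : c * (g j 0 * g 0 i) ≤ a * g 0 (j + 1 + i) := by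
        have h4 : g j 0 * g 0 i ≤ g 0 j * g 0 i :=
          mul_le_mul_of_nonneg_right (hmix j 0) (hf0 i)
        have h5 : g 0 j * g 0 i ≤ a * g 0 (j + 1 + i) := by
          have := dotProduct_pow_mul_le hE y 1 (j + 1) (i + 1)
          rw [hfy, hfy, hfy, ha, hz]
          rw [pow_one] at this
          rw [show j + 2 = 1 + (j + 1) by ring, show i + 2 = 1 + (i + 1) by ring,
            show j + 1 + i + 2 = 1 + (j + 1) + (i + 1) by ring]
          exact this
        have h6 := mul_nonneg (hg0 j) (hf0 i)
        nlinarith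
      have h3 := ih (i + 1)
      rw [show j + (i + 1) = j + 1 + i by ring] at h3
      push_cast
      linarith
  have htel : ∀ i j, j + i = q + 1 →
      (E' ^ (q + 1)).trace + i * (c * ((1 - q * a) * g 0 q)) ≤ (E' ^ j * E ^ i).trace := by
    intro i
    induction i with
    | zero => intro j hj; simp [show j = q + 1 by omega]
    | succ i ih =>
      intro j hj
      have h1 := ih (j + 1) (by omega)
      have h2 := hlow j i
      have hji : j + i = q := by omega
      rw [hji] at h2
      have h3 : (1 - q * a) * g 0 q ≤ (1 - j * a) * g 0 q := by
        have : (j : ℝ) ≤ q := by exact_mod_cast (by omega : j ≤ q)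
        have := mul_le_mul_of_nonneg_right this ha0
        exact mul_le_mul_of_nonneg_right (by linarith) (hf0 q)
      have h4 := mul_le_mul_of_nonneg_left (h3.trans h2) hc0
      rw [htr]
      push_cast
      linarith
  have h1 := htel (q + 1) 0 (by omega)
  rw [pow_zero, Matrix.one_mul, hfy] at h1
  refine le_trans (le_of_eq ?_) h1
  rw [hc]
  ring

end Trace

/-! ### A lower bound for sums of independent random matrices of rank one -/

section RankOne

open Matrix

variable {ι : Type*} [Fintype ι] [DecidableEq ι]

theorem trace_inv_pow_eq {M : Matrix ι ι ℝ} (hM : M.PosDef) (q : ℕ) :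
    ∃ (U : Matrix ι ι ℝ) (d : ι → ℝ), Uᵀ * U = 1 ∧ U * Uᵀ = 1 ∧ (∀ t, 0 < d t) ∧
      M = U * diagonal d * Uᵀ ∧ (M⁻¹ ^ q).trace = ∑ t, (d t)⁻¹ ^ q := by
  obtain ⟨U, d, hU1, hU2, hd, hMd⟩ := exists_diagonalization hM.posSemidef
  have hdpos : ∀ t, 0 < d t := by
    intro t
    rcases (hd t).lt_or_eq with h | h
    · exact h
    exfalso
    have h1 : M *ᵥ (U *ᵥ Pi.single t 1) = 0 := by
      rw [hMd, mulVec_mulVec, Matrix.mul_assoc, hU1, Matrix.mul_one, ← mulVec_mulVec]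
      have : diagonal d *ᵥ Pi.single t 1 = 0 := by
        ext s
        rw [mulVec_diagonal]
        rcases eq_or_ne s t with rfl | hs
        · simp [← h]
        · simp [hs]
      rw [this, mulVec_zero]
    have h2 : U *ᵥ Pi.single t 1 ≠ (0 : ι → ℝ) := by
      intro h0
      have : (Uᵀ * U) *ᵥ Pi.single t 1 = (0 : ι → ℝ) := by
        rw [← mulVec_mulVec, h0, mulVec_zero]
      rw [hU1, one_mulVec] at this
      simpa using congrFun this t
    have h3 := hM.dotProduct_mulVec_pos h2
    rw [h1] at h3
    simp at h3
  refine ⟨U, d, hU1, hU2, hdpos, hMd, ?_⟩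
  have hinv : M⁻¹ = U * diagonal (fun t => (d t)⁻¹) * Uᵀ := by
    refine inv_eq_right_inv ?_
    rw [hMd]
    calc U * diagonal d * Uᵀ * (U * diagonal (fun t => (d t)⁻¹) * Uᵀ)
        = U * (diagonal d * (Uᵀ * U) * diagonal (fun t => (d t)⁻¹)) * Uᵀ := by
          simp only [Matrix.mul_assoc]
      _ = 1 := by
          rw [hU1, Matrix.mul_one, diagonal_mul_diagonal]
          have : (fun i => d i * (d i)⁻¹) = 1 := by
            ext i; simp [(hdpos i).ne']
          rw [this]
          simp [hU2]
  have hpow : M⁻¹ ^ q = U * diagonal (fun t => (d t)⁻¹ ^ q) * Uᵀ := by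
    induction q with
    | zero => simp [hU2]
    | succ q ih =>
      rw [pow_succ, ih, hinv]
      calc U * diagonal (fun t => (d t)⁻¹ ^ q) * Uᵀ * (U * diagonal (fun t => (d t)⁻¹) * Uᵀ)
          = U * (diagonal (fun t => (d t)⁻¹ ^ q) * (Uᵀ * U) * diagonal fun t => (d t)⁻¹) * Uᵀ := by
            simp only [Matrix.mul_assoc]
        _ = _ := by
            rw [hU1, Matrix.mul_one, diagonal_mul_diagonal]
            simp [pow_succ]
  rw [hpow, trace_mul_comm, ← Matrix.mul_assoc, hU1, Matrix.one_mul, trace_diagonal]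

theorem one_add_mul_le_inv_pow {x : ℝ} (hx : 0 < x) (p : ℕ) : 1 + p * (1 - x) ≤ x⁻¹ ^ p := by
  have h1 : 1 - x ≤ x⁻¹ - 1 := by
    have h2 : x * x⁻¹ = 1 := mul_inv_cancel₀ hx.ne'
    have h3 : 0 < x⁻¹ := inv_pos.2 hx
    nlinarith [mul_nonneg h3.le (sq_nonneg (x - 1))]
  have h4 : -2 ≤ x⁻¹ - 1 := by linarith [inv_pos.2 hx]
  have h5 := one_add_mul_le_pow h4 p
  rw [add_sub_cancel] at h5
  have : (p : ℝ) * (1 - x) ≤ p * (x⁻¹ - 1) := mul_le_mul_of_nonneg_left h1 (Nat.cast_nonneg p)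
  linarith

theorem card_add_mul_le_trace_inv_pow {M : Matrix ι ι ℝ} (hM : M.PosDef) (p : ℕ) :
    Fintype.card ι + p * (Fintype.card ι - M.trace) ≤ (M⁻¹ ^ p).trace := by
  obtain ⟨U, d, hU1, hU2, hd, hMd, htr⟩ := trace_inv_pow_eq hM p
  have h1 : M.trace = ∑ t, d t := by
    rw [hMd, trace_mul_comm, ← Matrix.mul_assoc, hU1, Matrix.one_mul, trace_diagonal]
  have h2 : (Fintype.card ι : ℝ) + p * (Fintype.card ι - M.trace)
      = ∑ t, (1 + p * (1 - d t)) := by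
    rw [h1]
    simp [Finset.sum_add_distrib, ← Finset.mul_sum]
  rw [h2, htr]
  exact Finset.sum_le_sum fun t _ => one_add_mul_le_inv_pow (hd t) p

theorem six_pow_add_le_eight_pow {p : ℕ} (hp : 2 ≤ p) : (6 : ℝ) ^ p + 1 + p ≤ 8 ^ p := by
  induction p, hp using Nat.le_induction with
  | base => norm_num
  | succ p hp ih =>
    have h1 : (0 : ℝ) < 6 ^ p := by positivity
    have h2 : (0 : ℝ) ≤ p := Nat.cast_nonneg p
    rw [pow_succ, pow_succ]
    push_cast
    nlinarith

/-- A direction in which the quadratic form of `M` is small makes `Tr M⁻ᵖ` exponentially large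
in `p`. -/
theorem card_add_mul_add_pow_le_trace_inv_pow {M : Matrix ι ι ℝ} (hM : M.PosDef) {p : ℕ}
    (hp : 2 ≤ p) {v : ι → ℝ} (hv : v ⬝ᵥ M *ᵥ v < 1 / 8 * (v ⬝ᵥ v)) :
    Fintype.card ι + p * (Fintype.card ι - M.trace) + 6 ^ p ≤ (M⁻¹ ^ p).trace := by
  obtain ⟨U, d, hU1, hU2, hd, hMd, htr⟩ := trace_inv_pow_eq hM p
  have h1 : M.trace = ∑ t, d t := by
    rw [hMd, trace_mul_comm, ← Matrix.mul_assoc, hU1, Matrix.one_mul, trace_diagonal]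
  have h2 : (Fintype.card ι : ℝ) + p * (Fintype.card ι - M.trace)
      = ∑ t, (1 + p * (1 - d t)) := by
    rw [h1]
    simp [Finset.sum_add_distrib, ← Finset.mul_sum]
  obtain ⟨s, hs⟩ : ∃ s, d s < 1 / 8 := by
    by_contra! hcon
    have h3 : v ⬝ᵥ M *ᵥ v = ∑ t, d t * ((Uᵀ *ᵥ v) t) ^ 2 := by
      rw [hMd, ← mulVec_mulVec, ← mulVec_mulVec, dotProduct_mulVec, ← mulVec_transpose, dotProduct]
      refine Finset.sum_congr rfl fun t _ => ?_
      rw [mulVec_diagonal]; ring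
    have h4 : v ⬝ᵥ v = ∑ t, ((Uᵀ *ᵥ v) t) ^ 2 := by
      have : v ⬝ᵥ v = v ⬝ᵥ (U * Uᵀ) *ᵥ v := by rw [hU2, one_mulVec]
      rw [this, ← mulVec_mulVec, dotProduct_mulVec, ← mulVec_transpose, dotProduct]
      exact Finset.sum_congr rfl fun t _ => (sq _).symm
    rw [h3, h4, Finset.mul_sum] at hv
    exact absurd hv (not_lt.2 (Finset.sum_le_sum fun t _ =>
      mul_le_mul_of_nonneg_right (hcon t) (sq_nonneg _)))
  rw [h2, htr, ← Finset.add_sum_erase _ _ (Finset.mem_univ s),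
    ← Finset.add_sum_erase _ (fun t => (d t)⁻¹ ^ p) (Finset.mem_univ s)]
  have h5 : ∑ t ∈ Finset.univ.erase s, (1 + p * (1 - d t))
      ≤ ∑ t ∈ Finset.univ.erase s, (d t)⁻¹ ^ p :=
    Finset.sum_le_sum fun t _ => one_add_mul_le_inv_pow (hd t) p
  have h6 : (8 : ℝ) ≤ (d s)⁻¹ := by
    rw [le_inv_comm₀ (by norm_num) (hd s)]
    linarith
  have h7 : (8 : ℝ) ^ p ≤ (d s)⁻¹ ^ p := pow_le_pow_left₀ (by norm_num) h6 p
  have h8 := six_pow_add_le_eight_pow hp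
  have h9 : (p : ℝ) * (1 - d s) ≤ p := by
    have := mul_nonneg (Nat.cast_nonneg (α := ℝ) p) (hd s).le
    linarith
  linarith

theorem dotProduct_inv_mulVec_le {B : Matrix ι ι ℝ} (hB : B.PosDef) {w : ι → ℝ} (hw : ∀ a, 0 < w a)
    (hwB : (B - diagonal w).PosSemidef) (y : ι → ℝ) :
    y ⬝ᵥ B⁻¹ *ᵥ y ≤ ∑ a, y a ^ 2 / w a := by
  have hBu := (isUnit_iff_isUnit_det B).1 hB.isUnit
  set z := B⁻¹ *ᵥ y with hz
  have hBz : B *ᵥ z = y := by rw [hz, mulVec_mulVec, mul_nonsing_inv _ hBu, one_mulVec]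
  have h1 := dotProduct_mulVec_nonneg_of_posSemidef hwB z
  rw [sub_mulVec, dotProduct_sub, hBz] at h1
  have h2 : z ⬝ᵥ diagonal w *ᵥ z = ∑ a, w a * z a ^ 2 := by
    refine Finset.sum_congr rfl fun a _ => ?_
    rw [mulVec_diagonal]; ring
  have h3 : 2 * (y ⬝ᵥ z) ≤ ∑ a, y a ^ 2 / w a + ∑ a, w a * z a ^ 2 := by
    rw [dotProduct, Finset.mul_sum, ← Finset.sum_add_distrib]
    refine Finset.sum_le_sum fun a _ => ?_
    have h4 : y a ^ 2 / w a + w a * z a ^ 2 - 2 * (y a * z a) = (y a - w a * z a) ^ 2 / w a := by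
      have := (hw a).ne'
      field_simp
      ring
    have h5 : 0 ≤ (y a - w a * z a) ^ 2 / w a := div_nonneg (sq_nonneg _) (hw a).le
    linarith
  rw [h2, dotProduct_comm] at h1
  linarith

theorem measurable_trace_inv_pow [MeasurableSpace (Matrix ι ι ℝ)] [BorelSpace (Matrix ι ι ℝ)]
    (C : Matrix ι ι ℝ) (p : ℕ) :
    Measurable fun s : Matrix ι ι ℝ => ((C + s)⁻¹ ^ p).trace := by
  have h1 : ∀ s : Matrix ι ι ℝ,
      ((C + s)⁻¹ ^ p).trace = ((C + s).det⁻¹) ^ p * ((C + s).adjugate ^ p).trace := by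
    intro s
    rw [inv_def, smul_pow, trace_smul, smul_eq_mul, Ring.inverse_eq_inv']
  simp_rw [h1]
  have h2 : Continuous fun s : Matrix ι ι ℝ => (C + s).det :=
    (continuous_const.add continuous_id).matrix_det
  have h3 : Continuous fun s : Matrix ι ι ℝ => ((C + s).adjugate ^ p).trace :=
    (((continuous_const.add continuous_id).matrix_adjugate).pow p).matrix_trace
  exact (h2.measurable.inv.pow_const p).mul h3.measurable

end RankOne

section RankOneSum

open Matrix

variable {ι : Type*} [Fintype ι] [DecidableEq ι]
  {Ω : Type*} [MeasurableSpace Ω] {P : Measure Ω} [IsProbabilityMeasure P]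

/-- One step of the supermartingale argument: adding `(1 / n) y yᵀ` to `B` decreases the mean of
`Tr B⁻ᵖ` at least as much as adding half of its mean does. -/
theorem lintegral_trace_inv_pow_le {Y : Ω → ι → ℝ} {σ : ι → ℝ}
    (hσ0 : ∀ a, 0 ≤ σ a) (hσ1 : ∀ a, σ a < 1)
    (hcov : ∀ a b, Integrable (fun ω => Y ω a * Y ω b) P ∧
      ∫ ω, Y ω a * Y ω b ∂P = if a = b then σ a else 0)
    {q0 : ℝ} (hq : ∀ ω, ∑ a, Y ω a ^ 2 / (1 - σ a) ≤ q0) {n : ℝ} (hn : 0 < n) (q : ℕ)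
    (hqn : 4 * ((q + 1 : ℕ) * q0) ≤ n) {B : Matrix ι ι ℝ} (hB : B.PosDef)
    (hwB : (B - diagonal fun a => 1 - σ a).PosSemidef) :
    ∫⁻ ω, ENNReal.ofReal (((B + n⁻¹ • vecMulVec (Y ω) (Y ω))⁻¹ ^ (q + 1)).trace) ∂P
      ≤ ENNReal.ofReal (((B + (2 * n)⁻¹ • diagonal σ)⁻¹ ^ (q + 1)).trace) := by
  set D : Matrix ι ι ℝ := B⁻¹ ^ (q + 2) with hD
  have hDp : D.PosSemidef := hB.inv.posSemidef.pow _
  set c : ℝ := (q + 1 : ℕ) * (2 * n)⁻¹ with hc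
  have hc0 : 0 ≤ c := by positivity
  have hquad : ∀ y : ι → ℝ, y ⬝ᵥ D *ᵥ y = ∑ a, ∑ b, D a b * (y a * y b) := by
    intro y
    rw [dotProduct]
    refine Finset.sum_congr rfl fun a _ => ?_
    rw [mulVec, dotProduct, Finset.mul_sum]
    exact Finset.sum_congr rfl fun b _ => by ring
  have hint : Integrable (fun ω => Y ω ⬝ᵥ D *ᵥ Y ω) P := by
    simp_rw [hquad]
    exact integrable_finsetSum _ fun a _ => integrable_finsetSum _ fun b _ =>
      ((hcov a b).1).const_mul _
  have hmean : ∫ ω, Y ω ⬝ᵥ D *ᵥ Y ω ∂P = (D * diagonal σ).trace := by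
    have hI : ∀ a b, Integrable (fun ω => D a b * (Y ω a * Y ω b)) P := fun a b =>
      (hcov a b).1.const_mul _
    simp_rw [hquad]
    refine (integral_finsetSum _ fun a _ => integrable_finsetSum _ fun b _ => hI a b).trans ?_
    rw [trace]
    refine Finset.sum_congr rfl fun a _ => ?_
    refine (integral_finsetSum _ fun b _ => hI a b).trans ?_
    simp_rw [integral_const_mul, (hcov a _).2]
    simp [mul_diagonal]
  have hdiag : (diagonal σ : Matrix ι ι ℝ).PosSemidef := PosSemidef.diagonal hσ0
  -- the pointwise decrease of the potential
  have hpt : ∀ ω, ((B + n⁻¹ • vecMulVec (Y ω) (Y ω))⁻¹ ^ (q + 1)).trace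
      ≤ ((B⁻¹ ^ (q + 1)).trace - c * (D * diagonal σ).trace)
        + -(c * (Y ω ⬝ᵥ D *ᵥ Y ω - (D * diagonal σ).trace)) + 0 := by
    intro ω
    have hy : n⁻¹ • vecMulVec (Y ω) (Y ω) = vecMulVec ((√n)⁻¹ • Y ω) ((√n)⁻¹ • Y ω) := by
      rw [smul_vecMulVec, vecMulVec_smul, smul_smul, ← mul_inv, Real.mul_self_sqrt hn.le]
    have h1 := trace_inv_pow_add_vecMulVec_le hB ((√n)⁻¹ • Y ω) q
    have hsc : ∀ M : Matrix ι ι ℝ, ((√n)⁻¹ • Y ω) ⬝ᵥ M *ᵥ ((√n)⁻¹ • Y ω)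
        = n⁻¹ * (Y ω ⬝ᵥ M *ᵥ Y ω) := by
      intro M
      rw [mulVec_smul, smul_dotProduct, dotProduct_smul, smul_eq_mul, smul_eq_mul, ← mul_assoc,
        ← mul_inv, Real.mul_self_sqrt hn.le]
    rw [← hy, hsc, hsc, ← hD] at h1
    set a := n⁻¹ * (Y ω ⬝ᵥ B⁻¹ *ᵥ Y ω) with ha
    have ha0 : 0 ≤ a :=
      mul_nonneg (inv_nonneg.2 hn.le) (dotProduct_mulVec_nonneg_of_posSemidef hB.inv.posSemidef _)
    have ha1 : (q + 1 : ℕ) * a ≤ 1 / 4 := by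
      have h2 : Y ω ⬝ᵥ B⁻¹ *ᵥ Y ω ≤ q0 :=
        (dotProduct_inv_mulVec_le hB (fun a => sub_pos.2 (hσ1 a)) hwB _).trans (hq ω)
      have h3 : ((q + 1 : ℕ) : ℝ) * (Y ω ⬝ᵥ B⁻¹ *ᵥ Y ω) ≤ n / 4 := by
        have := mul_le_mul_of_nonneg_left h2 (Nat.cast_nonneg (α := ℝ) (q + 1))
        linarith
      calc _ = n⁻¹ * (((q + 1 : ℕ) : ℝ) * (Y ω ⬝ᵥ B⁻¹ *ᵥ Y ω)) := by rw [ha]; ring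
        _ ≤ n⁻¹ * (n / 4) := mul_le_mul_of_nonneg_left h3 (inv_nonneg.2 hn.le)
        _ = 1 / 4 := by field_simp
    have h4 : (1 : ℝ) / 2 ≤ (1 - q * a) / (1 + a) := by
      rw [div_le_div_iff₀ (by norm_num) (by positivity)]
      push_cast at ha1
      have := mul_nonneg (Nat.cast_nonneg (α := ℝ) q) ha0
      nlinarith
    have h5 : 0 ≤ n⁻¹ * (Y ω ⬝ᵥ D *ᵥ Y ω) :=
      mul_nonneg (inv_nonneg.2 hn.le) (dotProduct_mulVec_nonneg_of_posSemidef hDp _)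
    have h6 : c * (Y ω ⬝ᵥ D *ᵥ Y ω)
        ≤ (q + 1 : ℕ) * ((1 - q * a) / (1 + a)) * (n⁻¹ * (Y ω ⬝ᵥ D *ᵥ Y ω)) := by
      calc c * (Y ω ⬝ᵥ D *ᵥ Y ω) = (q + 1 : ℕ) * (1 / 2) * (n⁻¹ * (Y ω ⬝ᵥ D *ᵥ Y ω)) := by
            rw [hc, mul_inv]; ring
        _ ≤ _ := by gcongr
    linarith
  have h7 := lintegral_ofReal_le_of_le_add (P := P) (w := 0) (fun ω => ?_) hpt
    ((hint.sub (integrable_const _)).const_mul c).neg ?_ measurable_const (fun _ => le_rfl)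
    (by simp) le_rfl
  · refine h7.trans (ENNReal.ofReal_le_ofReal ?_)
    have h8 := trace_inv_pow_le_add hB (hdiag.smul (inv_nonneg.2 (by positivity : 0 ≤ 2 * n))) q
    rw [Matrix.mul_smul, trace_smul, smul_eq_mul, ← mul_assoc, ← hc] at h8
    linarith
  · exact (((hB.add_posSemidef ((posSemidef_vecMulVec (Y ω)).smul
      (inv_nonneg.2 hn.le))).inv.posSemidef).pow (q + 1)).trace_nonneg
  · have e1 := integral_neg (μ := P)
      (f := fun ω => c * (Y ω ⬝ᵥ D *ᵥ Y ω - (D * diagonal σ).trace))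
    have e2 := integral_sub hint (integrable_const ((D * diagonal σ).trace))
    have e3 := integral_const_mul (μ := P) c
      (fun ω => Y ω ⬝ᵥ D *ᵥ Y ω - (D * diagonal σ).trace)
    refine e1.trans ?_
    rw [e3, e2, hmean]
    simp

/-- The empirical second moment matrix of whitened vectors `Y`, with mean `diag σ` and regularized
by `diag (1 - σ)`, is bounded below by `1 / 8`, up to an exponentially small probability. -/
theorem measure_exists_quadForm_lt_le {κ : Type*} {Y : κ → Ω → ι → ℝ} (hY : ∀ j, Measurable (Y j))
    (hindep : iIndepFun Y P) {J : Finset κ} (hJ : J.Nonempty) {σ : ι → ℝ}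
    (hσ0 : ∀ a, 0 ≤ σ a) (hσ1 : ∀ a, σ a < 1)
    (hcov : ∀ j ∈ J, ∀ a b, Integrable (fun ω => Y j ω a * Y j ω b) P ∧
      ∫ ω, Y j ω a * Y j ω b ∂P = if a = b then σ a else 0)
    {q0 : ℝ} (hq : ∀ j ω, ∑ a, Y j ω a ^ 2 / (1 - σ a) ≤ q0) {p : ℕ} (hp : 2 ≤ p)
    (hqn : 4 * (p * q0) ≤ J.card) :
    P {ω | ∃ v : ι → ℝ, ∑ a, (1 - σ a) * v a ^ 2
        + (J.card : ℝ)⁻¹ * ∑ j ∈ J, (∑ a, Y j ω a * v a) ^ 2 < 1 / 8 * ∑ a, v a ^ 2}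
      ≤ ENNReal.ofReal (J.card * Real.exp (-p)) := by
  let _ : MeasurableSpace (Matrix ι ι ℝ) := borel _
  have : BorelSpace (Matrix ι ι ℝ) := ⟨rfl⟩
  have : SecondCountableTopology (Matrix ι ι ℝ) :=
    inferInstanceAs (SecondCountableTopology (ι → ι → ℝ))
  have : Nonempty Ω := P.nonempty_of_neZero
  obtain ⟨j0, hj0⟩ := hJ
  obtain ⟨q, rfl⟩ : ∃ q, p = q + 1 := ⟨p - 1, by omega⟩
  set n : ℝ := (J.card : ℝ) with hn
  have hn0 : 0 < n := by
    rw [hn]; exact_mod_cast Finset.card_pos.2 ⟨j0, hj0⟩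
  have hq00 : 0 ≤ q0 := by
    refine le_trans (Finset.sum_nonneg fun a _ => ?_) (hq j0 (Classical.arbitrary Ω))
    exact div_nonneg (sq_nonneg _) (sub_pos.2 (hσ1 a)).le
  have hsumY : ∀ j ω, ∑ a, Y j ω a ^ 2 ≤ q0 := by
    intro j ω
    refine le_trans (Finset.sum_le_sum fun a _ => ?_) (hq j ω)
    rw [le_div_iff₀ (sub_pos.2 (hσ1 a))]
    nlinarith [sq_nonneg (Y j ω a), hσ0 a]
  have hsumσ : ∑ a, σ a ≤ q0 := by
    have h1 : ∑ a, σ a = ∫ ω, ∑ a, Y j0 ω a ^ 2 ∂P := by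
      simp_rw [sq]
      rw [integral_finsetSum _ fun a _ => (hcov j0 hj0 a a).1]
      exact Finset.sum_congr rfl fun a _ => by rw [(hcov j0 hj0 a a).2, if_pos rfl]
    rw [h1]
    calc _ ≤ ∫ _, q0 ∂P := by
          refine integral_mono ?_ (integrable_const _) (hsumY j0)
          simp_rw [sq]
          exact integrable_finsetSum _ fun a _ => (hcov j0 hj0 a a).1
      _ = q0 := by simp
  -- the potential
  set w : ℕ → ι → ℝ := fun k a => 1 - σ a + (n - k) / (2 * n) * σ a with hw
  set C : ℕ → Matrix ι ι ℝ := fun k => diagonal (w k) with hC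
  set W : κ → Ω → Matrix ι ι ℝ := fun j ω => n⁻¹ • vecMulVec (Y j ω) (Y j ω) with hWdef
  have hWm : ∀ j, Measurable (W j) := by
    intro j
    have : Continuous fun y : ι → ℝ => n⁻¹ • vecMulVec y y :=
      Continuous.const_smul (Continuous.matrix_vecMulVec continuous_id continuous_id) n⁻¹
    exact this.measurable.comp (hY j)
  have hWindep : iIndepFun W P := by
    have : Continuous fun y : ι → ℝ => n⁻¹ • vecMulVec y y :=
      Continuous.const_smul (Continuous.matrix_vecMulVec continuous_id continuous_id) n⁻¹
    exact hindep.comp (fun _ y => n⁻¹ • vecMulVec y y) fun _ => this.measurable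
  have hWpsd : ∀ j ω, (W j ω).PosSemidef := fun j ω =>
    (posSemidef_vecMulVec _).smul (inv_nonneg.2 hn0.le)
  let M : AddSubmonoid (Matrix ι ι ℝ) :=
    { carrier := {s | s.PosSemidef}
      add_mem' := fun ha hb => ha.add hb
      zero_mem' := PosSemidef.zero }
  have hwk : ∀ k : ℕ, k ≤ J.card → ∀ a, 1 - σ a ≤ w k a := by
    intro k hk a
    have : (k : ℝ) ≤ n := by rw [hn]; exact_mod_cast hk
    have : 0 ≤ (n - k) / (2 * n) * σ a :=
      mul_nonneg (div_nonneg (by linarith) (by positivity)) (hσ0 a)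
    simp only [hw]
    linarith
  have hCpd : ∀ k : ℕ, k ≤ J.card → (C k).PosDef := fun k hk =>
    PosDef.diagonal fun a => (sub_pos.2 (hσ1 a)).trans_le (hwk k hk a)
  have hstep : ∀ k < J.card, ∀ i ∈ J, ∀ s ∈ M,
      ∫⁻ ω, ENNReal.ofReal (((C (k + 1) + (s + W i ω))⁻¹ ^ (q + 1)).trace) ∂P
        ≤ ENNReal.ofReal (((C k + s)⁻¹ ^ (q + 1)).trace) := by
    intro k hk i hi s hs
    have hs' : s.PosSemidef := hs
    have hB : (C (k + 1) + s).PosDef := (hCpd (k + 1) hk).add_posSemidef hs'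
    have hwB : (C (k + 1) + s - diagonal fun a => 1 - σ a).PosSemidef := by
      have : C (k + 1) + s - diagonal (fun a => 1 - σ a)
          = diagonal (fun a => w (k + 1) a - (1 - σ a)) + s := by
        have hsplit : C (k + 1) = diagonal (fun a => w (k + 1) a - (1 - σ a))
            + diagonal (fun a => 1 - σ a) := by
          rw [diagonal_add]
          exact congrArg diagonal (funext fun a => by ring)
        rw [hsplit]
        abel
      rw [this]
      exact (PosSemidef.diagonal fun a => sub_nonneg.2 (hwk (k + 1) hk a)).add hs'
    have h1 := lintegral_trace_inv_pow_le (P := P) hσ0 hσ1 (hcov i hi) (hq i) hn0 q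
      hqn hB hwB
    have h2 : C (k + 1) + s + (2 * n)⁻¹ • diagonal σ = C k + s := by
      have : C k = C (k + 1) + (2 * n)⁻¹ • diagonal σ := by
        simp only [hC]
        rw [← diagonal_smul, diagonal_add]
        congr 1
        ext a
        simp only [hw, Pi.smul_apply, smul_eq_mul]
        push_cast
        field_simp
        ring
      rw [this]; abel
    rw [h2] at h1
    simpa only [hWdef, add_assoc] using h1
  have hchain := lintegral_potential_le hWm hWindep M hWpsd
    (fun k s => ENNReal.ofReal (((C k + s)⁻¹ ^ (q + 1)).trace))
    (fun k => (measurable_trace_inv_pow _ _).ennreal_ofReal) J.card J hstep le_rfl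
  -- the final state, and its trace
  set Mf : Ω → Matrix ι ι ℝ := fun ω => C J.card + ∑ j ∈ J, W j ω with hMf
  have hMpd : ∀ ω, (Mf ω).PosDef := fun ω =>
    (hCpd _ le_rfl).add_posSemidef (M.sum_mem fun j _ => hWpsd j ω)
  have hCn : C J.card = diagonal fun a => 1 - σ a := by
    simp only [hC, hw, ← hn, sub_self, zero_div, zero_mul, add_zero]
  have hquadM : ∀ ω v, v ⬝ᵥ Mf ω *ᵥ v = ∑ a, (1 - σ a) * v a ^ 2
      + n⁻¹ * ∑ j ∈ J, (∑ a, Y j ω a * v a) ^ 2 := by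
    intro ω v
    simp only [hMf, hCn, hWdef]
    rw [add_mulVec, dotProduct_add]
    congr 1
    · refine Finset.sum_congr rfl fun a _ => ?_
      rw [mulVec_diagonal]; ring
    · rw [sum_mulVec, dotProduct_sum, Finset.mul_sum]
      refine Finset.sum_congr rfl fun j _ => ?_
      rw [smul_mulVec, dotProduct_smul, vecMulVec_mulVec, smul_eq_mul]
      congr 1
      have : v ⬝ᵥ Y j ω = Y j ω ⬝ᵥ v := dotProduct_comm _ _
      rw [dotProduct_smul, this, MulOpposite.smul_eq_mul_unop, MulOpposite.unop_op, ← sq]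
      rfl
  have htrM : ∀ ω, (Mf ω).trace ≤ Fintype.card ι + q0 := by
    intro ω
    simp only [hMf, hCn, hWdef]
    rw [trace_add, trace_sum, trace_diagonal]
    have h1 : ∑ a, (1 - σ a) ≤ Fintype.card ι := by
      rw [Finset.sum_sub_distrib]
      have := Finset.sum_nonneg fun a (_ : a ∈ Finset.univ) => hσ0 a
      simp only [Finset.sum_const, Finset.card_univ, nsmul_eq_mul, mul_one]
      linarith
    have h2 : ∑ j ∈ J, (n⁻¹ • vecMulVec (Y j ω) (Y j ω)).trace ≤ ∑ _j ∈ J, n⁻¹ * q0 := by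
      refine Finset.sum_le_sum fun j _ => ?_
      rw [trace_smul, trace_vecMulVec, smul_eq_mul]
      refine mul_le_mul_of_nonneg_left ?_ (inv_nonneg.2 hn0.le)
      refine le_trans (le_of_eq ?_) (hsumY j ω)
      exact Finset.sum_congr rfl fun a _ => (sq _).symm
    have h3 : ∑ _j ∈ J, n⁻¹ * q0 = q0 := by
      rw [Finset.sum_const, nsmul_eq_mul, ← hn]
      field_simp
    linarith
  set F : Ω → ℝ := fun ω => ((Mf ω)⁻¹ ^ (q + 1)).trace with hF
  have hFm : Measurable F :=
    (measurable_trace_inv_pow (C J.card) (q + 1)).comp (Finset.measurable_sum _ fun j _ => hWm j)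
  have hF0 : ∀ ω, 0 ≤ F ω := fun ω => ((hMpd ω).inv.posSemidef.pow _).trace_nonneg
  have hFint : Integrable F P := by
    refine ⟨hFm.aestronglyMeasurable, ?_⟩
    rw [hasFiniteIntegral_iff_ofReal (Filter.Eventually.of_forall hF0)]
    exact hchain.trans_lt ENNReal.ofReal_lt_top
  -- the initial value of the potential
  have hstart : ((C 0)⁻¹ ^ (q + 1)).trace ≤ Fintype.card ι + (2 ^ (q + 1) - 1) * q0 := by
    have hC0 : C 0 = diagonal fun a => 1 - σ a / 2 := by
      simp only [hC, hw]
      congr 1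
      ext a
      push_cast
      field_simp
      ring
    have hinv : (C 0)⁻¹ = diagonal fun a => (1 - σ a / 2)⁻¹ := by
      refine inv_eq_right_inv ?_
      rw [hC0, diagonal_mul_diagonal, ← diagonal_one]
      congr 1
      ext a
      exact mul_inv_cancel₀ (by linarith [hσ1 a])
    rw [hinv, diagonal_pow, trace_diagonal]
    have hterm : ∀ a, (1 - σ a / 2)⁻¹ ^ (q + 1) ≤ 1 + (2 ^ (q + 1) - 1) * σ a := by
      intro a
      have h1 : (1 - σ a / 2)⁻¹ ≤ 1 + σ a := by
        rw [inv_le_iff_one_le_mul₀ (by linarith [hσ1 a])]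
        nlinarith [hσ0 a, hσ1 a]
      have h2 : 0 ≤ (1 - σ a / 2)⁻¹ := inv_nonneg.2 (by linarith [hσ1 a])
      refine (pow_le_pow_left₀ h2 h1 _).trans ?_
      have h3 : ∀ k : ℕ, (1 + σ a) ^ k ≤ 1 + (2 ^ k - 1) * σ a := by
        intro k
        induction k with
        | zero => simp
        | succ k ih =>
          have h4 : (1 : ℝ) ≤ 2 ^ k := one_le_pow₀ (by norm_num)
          rw [pow_succ, pow_succ]
          nlinarith [mul_le_mul_of_nonneg_right ih (by linarith [hσ0 a] : (0 : ℝ) ≤ 1 + σ a),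
            hσ0 a, mul_nonneg (mul_nonneg (sub_nonneg.2 h4) (hσ0 a)) (sub_nonneg.2 (hσ1 a).le)]
      exact h3 _
    calc _ ≤ ∑ a, (1 + (2 ^ (q + 1) - 1) * σ a) := Finset.sum_le_sum fun a _ => hterm a
      _ = Fintype.card ι + (2 ^ (q + 1) - 1) * ∑ a, σ a := by
        simp [Finset.sum_add_distrib, ← Finset.mul_sum]
      _ ≤ _ := by
        have h4 : (1 : ℝ) ≤ 2 ^ (q + 1) := one_le_pow₀ (by norm_num)
        have := mul_le_mul_of_nonneg_left hsumσ (sub_nonneg.2 h4)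
        linarith
  have hFmean : ∫ ω, F ω ∂P ≤ Fintype.card ι + (2 ^ (q + 1) - 1) * q0 := by
    refine le_trans ?_ hstart
    rw [add_zero] at hchain
    rw [integral_eq_lintegral_of_nonneg_ae (Filter.Eventually.of_forall hF0)
      hFm.aestronglyMeasurable]
    exact ENNReal.toReal_le_of_le_ofReal
      (((hCpd 0 (Nat.zero_le _)).inv.posSemidef.pow _).trace_nonneg) hchain
  -- Markov's inequality for the excess of the trace
  set c : ℝ := Fintype.card ι - (q + 1 : ℕ) * q0 with hc
  have hcF : ∀ ω, c ≤ F ω := by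
    intro ω
    have h1 := card_add_mul_le_trace_inv_pow (hMpd ω) (q + 1)
    have h2 := mul_le_mul_of_nonneg_left (htrM ω) (Nat.cast_nonneg (α := ℝ) (q + 1))
    simp only [hF, hc]
    linarith
  have hbad : {ω | ∃ v : ι → ℝ, ∑ a, (1 - σ a) * v a ^ 2
        + n⁻¹ * ∑ j ∈ J, (∑ a, Y j ω a * v a) ^ 2 < 1 / 8 * ∑ a, v a ^ 2}
      ⊆ {ω | (6 : ℝ) ^ (q + 1) ≤ F ω - c} := by
    rintro ω ⟨v, hv⟩
    have hvv : v ⬝ᵥ v = ∑ a, v a ^ 2 := Finset.sum_congr rfl fun a _ => (sq _).symm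
    rw [← hquadM, ← hvv] at hv
    have h1 := card_add_mul_add_pow_le_trace_inv_pow (hMpd ω) hp hv
    have h2 := mul_le_mul_of_nonneg_left (htrM ω) (Nat.cast_nonneg (α := ℝ) (q + 1))
    simp only [Set.mem_ofPred_eq, hF, hc]
    linarith
  have hmarkov := mul_meas_ge_le_integral_of_nonneg (μ := P)
    (Filter.Eventually.of_forall fun ω => sub_nonneg.2 (hcF ω)) (hFint.sub (integrable_const c))
    ((6 : ℝ) ^ (q + 1))
  have hmean2 : ∫ ω, (F ω - c) ∂P ≤ (2 ^ (q + 1) + (q + 1 : ℕ)) * q0 := by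
    rw [integral_sub hFint (integrable_const c)]
    simp only [integral_const, probReal_univ, one_smul, hc]
    linarith
  have hreal : P.real {ω | (6 : ℝ) ^ (q + 1) ≤ F ω - c} ≤ n * Real.exp (-(q + 1 : ℕ)) := by
    have h6 : (0 : ℝ) < 6 ^ (q + 1) := by positivity
    have h1 : (6 : ℝ) ^ (q + 1) * P.real {ω | (6 : ℝ) ^ (q + 1) ≤ F ω - c}
        ≤ (2 ^ (q + 1) + (q + 1 : ℕ)) * q0 := hmarkov.trans hmean2
    have h2 : ((q + 1 : ℕ) : ℝ) ≤ 2 ^ (q + 1) := by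
      exact_mod_cast (Nat.lt_two_pow_self (n := q + 1)).le
    have h3 : 8 * q0 ≤ n := by
      have : (2 : ℝ) ≤ (q + 1 : ℕ) := by exact_mod_cast hp
      nlinarith
    have h4 : (6 : ℝ) ^ (q + 1) = 2 ^ (q + 1) * 3 ^ (q + 1) := by
      rw [← mul_pow]; norm_num
    have h5 : 1 ≤ (3 : ℝ) ^ (q + 1) * Real.exp (-(q + 1 : ℕ)) := by
      rw [← Real.rpow_natCast, ← Real.exp_log (show (0 : ℝ) < 3 by norm_num), ← Real.exp_mul,
        ← Real.exp_add, Real.one_le_exp_iff]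
      have h7 : 1 ≤ Real.log 3 := by
        rw [Real.le_log_iff_exp_le (by norm_num)]
        exact Real.exp_one_lt_three.le
      have h8 : (0 : ℝ) ≤ (q + 1 : ℕ) := Nat.cast_nonneg _
      nlinarith
    refine le_of_mul_le_mul_left (h1.trans ?_) h6
    have h9 : (0 : ℝ) < 2 ^ (q + 1) := by positivity
    calc ((2 : ℝ) ^ (q + 1) + (q + 1 : ℕ)) * q0 ≤ (2 ^ (q + 1) + 2 ^ (q + 1)) * q0 := by gcongr
      _ ≤ 2 ^ (q + 1) * n := by nlinarith
      _ ≤ 2 ^ (q + 1) * n * (3 ^ (q + 1) * Real.exp (-(q + 1 : ℕ))) :=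
          le_mul_of_one_le_right (by positivity) h5
      _ = _ := by rw [h4]; ring
  calc _ ≤ P {ω | (6 : ℝ) ^ (q + 1) ≤ F ω - c} := measure_mono hbad
    _ = ENNReal.ofReal (P.real {ω | (6 : ℝ) ^ (q + 1) ≤ F ω - c}) :=
        (ofReal_measureReal (measure_ne_top _ _)).symm
    _ ≤ _ := ENNReal.ofReal_le_ofReal hreal

end RankOneSum

/-! ### Comparison of the population and the empirical norm -/

section Eigenbasis

variable {H E : Type*} [NormedAddCommGroup H] [InnerProductSpace ℝ H]
  [NormedAddCommGroup E] [InnerProductSpace ℝ E]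

/-- The compression of `S† S` to a finite dimensional subspace `F` has an orthonormal basis of
eigenvectors. -/
theorem exists_eigenbasis [CompleteSpace E] (S : H →L[ℝ] E) (F : Submodule ℝ H)
    [FiniteDimensional ℝ F] :
    ∃ (d : ℕ) (b : Fin d → H) (μ : Fin d → ℝ), (∀ i, 0 ≤ μ i) ∧ Orthonormal ℝ b ∧
      (∀ i j, inner ℝ (S (b i)) (S (b j)) = if i = j then μ i else 0) ∧
      ∀ v ∈ F, ∑ i, inner ℝ (b i) v • b i = v := by
  have : CompleteSpace F := FiniteDimensional.complete ℝ F
  set SF : F →L[ℝ] E := S ∘L F.subtypeL with hSF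
  set A : F →L[ℝ] F := ContinuousLinearMap.adjoint SF ∘L SF with hA
  have hAi : ∀ x y : F, inner ℝ (A x) y = inner ℝ (SF x) (SF y) := fun x y => by
    rw [hA, ContinuousLinearMap.comp_apply, ContinuousLinearMap.adjoint_inner_left]
  have hsym : (A : F →ₗ[ℝ] F).IsSymmetric := by
    intro x y
    have h1 := hAi x y
    have h2 := hAi y x
    rw [real_inner_comm] at h2
    exact h1.trans ((real_inner_comm _ _).trans h2.symm)
  set B := hsym.eigenvectorBasis rfl with hB
  have hSB : ∀ i j, inner ℝ (S (B i : H)) (S (B j : H))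
      = if i = j then hsym.eigenvalues rfl i else 0 := by
    intro i j
    have h1 : A (B i) = (hsym.eigenvalues rfl i : ℝ) • B i := hsym.apply_eigenvectorBasis rfl i
    have h2 := hAi (B i) (B j)
    rw [h1, real_inner_smul_left, orthonormal_iff_ite.1 B.orthonormal] at h2
    rw [mul_ite, mul_one, mul_zero] at h2
    exact h2.symm
  refine ⟨_, fun i => (B i : H), hsym.eigenvalues rfl, fun i => ?_, ?_, hSB, fun v hv => ?_⟩
  · have := hSB i i
    rw [if_pos rfl, real_inner_self_eq_norm_sq] at this
    rw [← this]; positivity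
  · exact B.orthonormal.comp_linearIsometry F.subtypeₗᵢ
  · have := congrArg (Subtype.val) (B.sum_repr' ⟨v, hv⟩)
    simpa using this

/-- The spans of the first elements of a dense sequence. -/
noncomputable def denseSpan (H : Type*) [NormedAddCommGroup H] [InnerProductSpace ℝ H]
    [TopologicalSpace.SeparableSpace H] (k : ℕ) : Submodule ℝ H :=
  Submodule.span ℝ (TopologicalSpace.denseSeq H '' Set.Iio k)

theorem finiteDimensional_denseSpan [TopologicalSpace.SeparableSpace H] (k : ℕ) :
    FiniteDimensional ℝ (denseSpan H k) :=
  FiniteDimensional.span_of_finite ℝ ((Set.finite_Iio k).image _)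

theorem denseSpan_mono [TopologicalSpace.SeparableSpace H] : Monotone (denseSpan H) :=
  fun _ _ hkl => Submodule.span_mono (Set.image_mono (Set.Iio_subset_Iio hkl))

theorem exists_mem_denseSpan [TopologicalSpace.SeparableSpace H] {U : Set H} (hU : IsOpen U)
    (hne : U.Nonempty) : ∃ k, ∃ v ∈ denseSpan H k, v ∈ U := by
  obtain ⟨v, hvU, k, rfl⟩ :=
    (TopologicalSpace.denseRange_denseSeq H).inter_open_nonempty U hU hne
  exact ⟨k + 1, _, Submodule.subset_span ⟨k, by simp, rfl⟩, hvU⟩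

theorem norm_sq_sum_smul {d : ℕ} {b : Fin d → H} (hb : Orthonormal ℝ b) (c : Fin d → ℝ) :
    ‖∑ i, c i • b i‖ ^ 2 = ∑ i, c i ^ 2 := by
  rw [← real_inner_self_eq_norm_sq, hb.inner_sum]
  simp [sq]

theorem norm_map_sq_sum_smul (S : H →L[ℝ] E) {d : ℕ} {b : Fin d → H} {μ : Fin d → ℝ}
    (hμ : ∀ i j, inner ℝ (S (b i)) (S (b j)) = if i = j then μ i else 0) (c : Fin d → ℝ) :
    ‖S (∑ i, c i • b i)‖ ^ 2 = ∑ i, μ i * c i ^ 2 := by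
  rw [← real_inner_self_eq_norm_sq, map_sum, sum_inner]
  refine Finset.sum_congr rfl fun i _ => ?_
  rw [inner_sum]
  simp only [map_smul, real_inner_smul_left, real_inner_smul_right, hμ]
  simp
  ring

theorem apply_sum_smul {X : Type*} [CompleteSpace H] [RKHS ℝ H X ℝ] {d : ℕ}
    (b : Fin d → H) (c : Fin d → ℝ) (x : X) :
    (∑ i, c i • b i : H) x = ∑ i, c i * b i x := by
  rw [← inner_point, inner_sum]
  simp [real_inner_smul_right, inner_point]

end Eigenbasis

section Isometry

variable {X : Type*} [MeasurableSpace X] {H : Type*} [NormedAddCommGroup H]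
  [InnerProductSpace ℝ H] [CompleteSpace H] [RKHS ℝ H X ℝ]
  (hK : Measurable (Function.uncurry (ker H : X → X → ℝ))) {κ : ℝ}
  (hκ : ∀ x : X, Real.sqrt (ker H x x) ≤ κ) (ρ : Measure X) [IsProbabilityMeasure ρ]

variable {Ω : Type*} [MeasurableSpace Ω] {P : Measure Ω} [IsProbabilityMeasure P]

theorem measure_exists_mem_regNorm_lt_le {τ : Type*} {Z : τ → Ω → X} (hZ : ∀ j, Measurable (Z j))
    (hindep : iIndepFun Z P) {J : Finset τ} (hJ : J.Nonempty) (hlaw : ∀ j ∈ J, P.map (Z j) = ρ)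
    {lam : ℝ} (hlam : 0 < lam) {p : ℕ} (hp : 2 ≤ p) (hpn : 4 * (p * (κ ^ 2 / lam)) ≤ J.card)
    (F : Submodule ℝ H) [FiniteDimensional ℝ F] :
    P {ω | ∃ f ∈ F, (J.card : ℝ)⁻¹ * ∑ j ∈ J, f (Z j ω) ^ 2 + lam * ‖f‖ ^ 2
        < 1 / 8 * regNorm (incl hK hκ ρ) lam f ^ 2}
      ≤ ENNReal.ofReal (J.card * Real.exp (-p)) := by
  obtain ⟨d, b, μ, hμ0, hb, hSb, hF⟩ := exists_eigenbasis (incl hK hκ ρ) F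
  have hw : ∀ i, 0 < μ i + lam := fun i => add_pos_of_nonneg_of_pos (hμ0 i) hlam
  have hsw : ∀ i, √(μ i + lam) ≠ 0 := fun i => (Real.sqrt_pos.2 (hw i)).ne'
  have hsq : ∀ i, √(μ i + lam) ^ 2 = μ i + lam := fun i => Real.sq_sqrt (hw i).le
  set σ : Fin d → ℝ := fun i => μ i / (μ i + lam) with hσ
  have hσ1 : ∀ i, 1 - σ i = lam / (μ i + lam) := by
    intro i
    have := (hw i).ne'
    simp only [hσ]
    field_simp
    ring
  set y : X → Fin d → ℝ := fun x i => b i x / √(μ i + lam) with hy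
  have hym : Measurable y := measurable_pi_iff.2 fun i => (measurable_coe hK (b i)).div_const _
  have hmain := measure_exists_quadForm_lt_le (P := P) (Y := fun j ω => y (Z j ω))
    (fun j => hym.comp (hZ j)) (hindep.comp (fun _ => y) fun _ => hym) hJ (σ := σ)
    (fun i => div_nonneg (hμ0 i) (hw i).le)
    (fun i => by have := div_pos hlam (hw i); rw [← hσ1] at this; linarith)
    (fun j hj a c => ?_) (q0 := κ ^ 2 / lam) (fun j ω => ?_) hp hpn
  · refine (measure_mono ?_).trans hmain
    rintro ω ⟨f, hfF, hf⟩
    set c : Fin d → ℝ := fun i => inner ℝ (b i) f with hc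
    have hfc : f = ∑ i, c i • b i := (hF f hfF).symm
    refine ⟨fun i => √(μ i + lam) * c i, ?_⟩
    have e1 : ∑ i, (1 - σ i) * (√(μ i + lam) * c i) ^ 2 = lam * ‖f‖ ^ 2 := by
      rw [hfc, norm_sq_sum_smul hb, Finset.mul_sum]
      refine Finset.sum_congr rfl fun i _ => ?_
      have := (hw i).ne'
      rw [hσ1, mul_pow, hsq]
      field_simp
    have e2 : ∀ j, ∑ i, y (Z j ω) i * (√(μ i + lam) * c i) = f (Z j ω) := by
      intro j
      rw [hfc, apply_sum_smul]
      refine Finset.sum_congr rfl fun i _ => ?_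
      have := hsw i
      simp only [hy]
      field_simp
    have e3 : ∑ i, (√(μ i + lam) * c i) ^ 2 = regNorm (incl hK hκ ρ) lam f ^ 2 := by
      rw [regNorm_sq _ hlam.le, hfc, norm_sq_sum_smul hb, norm_map_sq_sum_smul _ hSb,
        Finset.mul_sum, ← Finset.sum_add_distrib]
      refine Finset.sum_congr rfl fun i _ => ?_
      rw [mul_pow, hsq]; ring
    simp only [e1, e2, e3]
    linarith
  · have e1 : ∀ ω, y (Z j ω) a * y (Z j ω) c
        = (fun x => (√(μ a + lam) * √(μ c + lam))⁻¹ * (b a x * b c x)) (Z j ω) := by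
      intro ω
      simp only [hy]
      field_simp
    have hI : Integrable (fun x => (√(μ a + lam) * √(μ c + lam))⁻¹ * (b a x * b c x)) ρ :=
      (integrable_mul_coe hK hκ ρ (b a) (b c)).const_mul _
    rw [← hlaw j hj] at hI
    simp_rw [e1]
    refine ⟨hI.comp_measurable (hZ j), ?_⟩
    rw [← integral_map (hZ j).aemeasurable hI.1, hlaw j hj, integral_const_mul,
      ← inner_incl hK hκ ρ, hSb]
    rcases eq_or_ne a c with rfl | hac
    · simp only [if_true, hσ]
      rw [Real.mul_self_sqrt (hw a).le]
      field_simp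
    · simp [hac]
  · have e1 : ∀ i, y (Z j ω) i ^ 2 / (1 - σ i) = ‖inner ℝ (b i) (point H (Z j ω))‖ ^ 2 / lam := by
      intro i
      have := (hw i).ne'
      rw [hσ1, real_inner_comm, inner_point, Real.norm_eq_abs, sq_abs]
      simp only [hy]
      rw [div_pow, hsq]
      field_simp
    simp_rw [e1]
    rw [← Finset.sum_div]
    refine div_le_div_of_nonneg_right ?_ hlam.le
    refine (hb.sum_inner_products_le (s := Finset.univ) (point H (Z j ω))).trans ?_
    exact pow_le_pow_left₀ (norm_nonneg _) (norm_point_le hκ _) 2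

/-- The lower isometry: with high probability, the regularized empirical norm dominates the
regularized population norm on all of `H`. -/
theorem measure_exists_regNorm_lt_le [TopologicalSpace.SeparableSpace H] {τ : Type*}
    {Z : τ → Ω → X} (hZ : ∀ j, Measurable (Z j))
    (hindep : iIndepFun Z P) {J : Finset τ} (hJ : J.Nonempty) (hlaw : ∀ j ∈ J, P.map (Z j) = ρ)
    {lam : ℝ} (hlam : 0 < lam) {p : ℕ} (hp : 2 ≤ p) (hpn : 4 * (p * (κ ^ 2 / lam)) ≤ J.card) :
    P {ω | ∃ f : H, (J.card : ℝ)⁻¹ * ∑ j ∈ J, f (Z j ω) ^ 2 + lam * ‖f‖ ^ 2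
        < 1 / 8 * regNorm (incl hK hκ ρ) lam f ^ 2}
      ≤ ENNReal.ofReal (J.card * Real.exp (-p)) := by
  set A : ℕ → Set Ω := fun k => {ω | ∃ f ∈ denseSpan H k,
    (J.card : ℝ)⁻¹ * ∑ j ∈ J, f (Z j ω) ^ 2 + lam * ‖f‖ ^ 2
      < 1 / 8 * regNorm (incl hK hκ ρ) lam f ^ 2} with hA
  have hmono : Monotone A := fun k l hkl ω ⟨f, hf, h⟩ => ⟨f, denseSpan_mono hkl hf, h⟩
  have hsub : {ω | ∃ f : H, (J.card : ℝ)⁻¹ * ∑ j ∈ J, f (Z j ω) ^ 2 + lam * ‖f‖ ^ 2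
      < 1 / 8 * regNorm (incl hK hκ ρ) lam f ^ 2} ⊆ ⋃ k, A k := by
    rintro ω ⟨f, hf⟩
    have hopen : IsOpen {f : H | (J.card : ℝ)⁻¹ * ∑ j ∈ J, f (Z j ω) ^ 2 + lam * ‖f‖ ^ 2
        < 1 / 8 * regNorm (incl hK hκ ρ) lam f ^ 2} := by
      simp_rw [← inner_point (H := H), regNorm_sq _ hlam.le]
      refine isOpen_lt ?_ ?_ <;> fun_prop
    obtain ⟨k, v, hv, hvU⟩ := exists_mem_denseSpan hopen ⟨f, hf⟩
    exact Set.mem_iUnion.2 ⟨k, v, hv, hvU⟩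
  refine (measure_mono hsub).trans ?_
  rw [hmono.measure_iUnion]
  refine iSup_le fun k => ?_
  have := finiteDimensional_denseSpan (H := H) k
  exact measure_exists_mem_regNorm_lt_le hK hκ ρ hZ hindep hJ hlaw hlam hp hpn _

/-! ### The effective dimension as a mean -/

/-- The mean of `⟪K_x, (S† S + lam)⁻¹ K_x⟫` is at most the effective dimension: on finite
dimensional subspaces this is a finite trace computation, and the general case is Fatou's lemma. -/
theorem lintegral_resForm_point_le [TopologicalSpace.SeparableSpace H] {lam : ℝ}
    (hlam : 0 < lam) :
    ∫⁻ x, ENNReal.ofReal (resForm (incl hK hκ ρ) lam (point H x) (point H x)) ∂ρ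
      ≤ effDim (LK H hK hκ ρ) lam := by
  set S := incl hK hκ ρ with hS
  have hfd : ∀ k, FiniteDimensional ℝ (denseSpan H k) := finiteDimensional_denseSpan
  choose d b μ hμ0 hb hSb hF using fun k => exists_eigenbasis S (denseSpan H k)
  have hw : ∀ k i, 0 < μ k i + lam := fun k i => add_pos_of_nonneg_of_pos (hμ0 k i) hlam
  set R : ℕ → X → ℝ≥0∞ := fun k x => ∑ i, ENNReal.ofReal (b k i x ^ 2 / (μ k i + lam)) with hR
  have hRm : ∀ k, Measurable (R k) := fun k => Finset.measurable_sum _ fun i _ =>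
    (((measurable_coe hK (b k i)).pow_const 2).div_const _).ennreal_ofReal
  have hRint : ∀ k, ∫⁻ x, R k x ∂ρ ≤ effDim (LK H hK hκ ρ) lam := by
    intro k
    rw [LK_eq]
    set w : Fin (d k) → H := fun i => (√(μ k i + lam))⁻¹ • b k i with hwdef
    have hw1 : ∀ i j, inner ℝ (S (w i)) (S (w j)) + lam * inner ℝ (w i) (w j)
        = if i = j then 1 else 0 := by
      intro i j
      simp only [hwdef, map_smul, real_inner_smul_left, real_inner_smul_right, hSb,
        orthonormal_iff_ite.1 (hb k)]
      rcases eq_or_ne i j with rfl | hij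
      · simp only [if_true]
        have h1 : √(μ k i + lam) * √(μ k i + lam) = μ k i + lam := Real.mul_self_sqrt (hw k i).le
        have h2 := (hw k i).ne'
        calc _ = (√(μ k i + lam))⁻¹ * (√(μ k i + lam))⁻¹ * (μ k i + lam) := by ring
          _ = 1 := by rw [← mul_inv, h1, inv_mul_cancel₀ h2]
      · simp [hij]
    refine le_trans (le_of_eq ?_) (sum_norm_sq_le_effDim S hlam w hw1)
    rw [hR, lintegral_finsetSum _ fun i _ =>
      (((measurable_coe hK (b k i)).pow_const 2).div_const _).ennreal_ofReal]
    refine Finset.sum_congr rfl fun i _ => ?_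
    have hI : Integrable (fun x => b k i x ^ 2 / (μ k i + lam)) ρ := by
      have := (integrable_mul_coe hK hκ ρ (b k i) (b k i)).div_const (μ k i + lam)
      simpa only [sq] using this
    rw [← ofReal_integral_eq_lintegral_ofReal hI
      (Filter.Eventually.of_forall fun x => div_nonneg (sq_nonneg _) (hw k i).le),
      integral_div, ← norm_incl_sq hK hκ ρ]
    congr 1
    simp only [hwdef, map_smul, norm_smul, mul_pow, norm_inv, Real.norm_eq_abs, sq_abs, inv_pow]
    rw [Real.sq_sqrt (hw k i).le, ← hS]
    field_simp
  have hquad : ∀ k x, ∀ v ∈ denseSpan H k,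
      ENNReal.ofReal (v x ^ 2) ≤ R k x * ENNReal.ofReal (regNorm S lam v ^ 2) := by
    intro k x v hv
    simp only [hR]
    rw [← ENNReal.ofReal_sum_of_nonneg fun i _ => div_nonneg (sq_nonneg _) (hw k i).le,
      ← ENNReal.ofReal_mul (Finset.sum_nonneg fun i _ => div_nonneg (sq_nonneg _) (hw k i).le)]
    refine ENNReal.ofReal_le_ofReal ?_
    set c : Fin (d k) → ℝ := fun i => inner ℝ (b k i) v with hc
    have hvc : v = ∑ i, c i • b k i := (hF k v hv).symm
    have e3 : regNorm S lam v ^ 2 = ∑ i, (√(μ k i + lam) * c i) ^ 2 := by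
      rw [regNorm_sq _ hlam.le, hvc, norm_sq_sum_smul (hb k), norm_map_sq_sum_smul _ (hSb k),
        Finset.mul_sum, ← Finset.sum_add_distrib]
      refine Finset.sum_congr rfl fun i _ => ?_
      rw [mul_pow, Real.sq_sqrt (hw k i).le]; ring
    have e4 : v x = ∑ i, (b k i x / √(μ k i + lam)) * (√(μ k i + lam) * c i) := by
      rw [hvc, apply_sum_smul]
      refine Finset.sum_congr rfl fun i _ => ?_
      have := (Real.sqrt_pos.2 (hw k i)).ne'
      field_simp
    have e5 : ∑ i, b k i x ^ 2 / (μ k i + lam) = ∑ i, (b k i x / √(μ k i + lam)) ^ 2 := by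
      refine Finset.sum_congr rfl fun i _ => ?_
      rw [div_pow, Real.sq_sqrt (hw k i).le]
    rw [e3, e4, e5]
    exact Finset.sum_mul_sq_le_sq_mul_sq _ _ _
  have hlim : ∀ x, ENNReal.ofReal (resForm S lam (point H x) (point H x))
      ≤ Filter.liminf (fun k => R k x) Filter.atTop := by
    intro x
    set u := resolvent S lam (point H x) with hu
    have h1 : resForm S lam (point H x) (point H x) = u x := inner_point x u
    have h2 : resForm S lam (point H x) (point H x) = regNorm S lam u ^ 2 := by
      rw [resForm_self S hlam]
    refine le_of_forall_lt fun a ha => ?_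
    have hatop := ne_top_of_lt ha
    rw [ENNReal.lt_ofReal_iff_toReal_lt hatop] at ha
    set t := a.toReal with ht
    have hupos : 0 < u x := by rw [← h1]; exact ENNReal.toReal_nonneg.trans_lt ha
    -- near `u` the quotient `v x ^ 2 / regNorm v ^ 2` exceeds a number above `t`
    obtain ⟨s, hts, hs⟩ := exists_between ha
    have hopen : IsOpen {v : H | s * regNorm S lam v ^ 2 < v x ^ 2 ∧ 0 < regNorm S lam v ^ 2} := by
      simp_rw [← inner_point (H := H), regNorm_sq _ hlam.le]
      refine IsOpen.and (isOpen_lt ?_ ?_) (isOpen_lt ?_ ?_) <;> fun_prop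
    obtain ⟨k, v, hv, hv1, hv2⟩ := exists_mem_denseSpan hopen ⟨u, by
      constructor
      · rw [← h2, h1, sq]
        rw [h1] at hs
        exact mul_lt_mul_of_pos_right hs hupos
      · rw [← h2, h1]; exact hupos⟩
    have hs0 : 0 ≤ s := ENNReal.toReal_nonneg.trans hts.le
    have hle : ∀ l ≥ k, ENNReal.ofReal s ≤ R l x := by
      intro l hl
      have h3 := hquad l x v (denseSpan_mono hl hv)
      have h4 : ENNReal.ofReal s * ENNReal.ofReal (regNorm S lam v ^ 2)
          ≤ R l x * ENNReal.ofReal (regNorm S lam v ^ 2) := by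
        rw [← ENNReal.ofReal_mul hs0]
        exact (ENNReal.ofReal_le_ofReal hv1.le).trans h3
      exact (ENNReal.mul_le_mul_iff_left (ENNReal.ofReal_pos.2 hv2).ne'
        ENNReal.ofReal_ne_top).1 h4
    calc a < ENNReal.ofReal s := by
          rwa [ENNReal.lt_ofReal_iff_toReal_lt hatop]
      _ ≤ _ := Filter.le_liminf_of_le (by isBoundedDefault)
          (Filter.eventually_atTop.2 ⟨k, hle⟩)
  calc _ ≤ ∫⁻ x, Filter.liminf (fun k => R k x) Filter.atTop ∂ρ := lintegral_mono hlim
    _ ≤ Filter.liminf (fun k => ∫⁻ x, R k x ∂ρ) Filter.atTop := lintegral_liminf_le hRm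
    _ ≤ _ := Filter.liminf_le_of_le (by isBoundedDefault) fun c hc => by
        obtain ⟨k, hk⟩ := hc.exists
        exact hk.trans (hRint k)

end Isometry

/-! ### Concentration of the noise -/

section ExpRemainder

theorem exp_sub_one_sub_nonneg (t : ℝ) : 0 ≤ Real.exp t - 1 - t := by
  linarith [Real.add_one_le_exp t]

theorem exp_sub_one_sub_mono {s t : ℝ} (hs : 0 ≤ s) (hst : s ≤ t) :
    Real.exp s - 1 - s ≤ Real.exp t - 1 - t := by
  have h1 : Real.exp t = Real.exp s * Real.exp (t - s) := by rw [← Real.exp_add]; ring_nf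
  have h2 := Real.add_one_le_exp (t - s)
  have h3 : 1 ≤ Real.exp s := Real.one_le_exp hs
  nlinarith

theorem exp_sub_one_sub_mul_le {θ t : ℝ} (hθ0 : 0 ≤ θ) (hθ1 : θ ≤ 1) (ht : 0 ≤ t) :
    Real.exp (θ * t) - 1 - θ * t ≤ θ ^ 2 * (Real.exp t - 1 - t) := by
  have hsum : ∀ x : ℝ, HasSum (fun k : ℕ => x ^ (k + 2) / (k + 2).factorial)
      (Real.exp x - 1 - x) := by
    intro x
    have h1 := NormedSpace.expSeries_div_hasSum_exp x
    rw [← Real.exp_eq_exp_ℝ] at h1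
    have h2 := (hasSum_nat_add_iff' 2).2 h1
    simpa [Finset.sum_range_succ, sub_sub] using h2
  refine hasSum_le (fun k => ?_) (hsum (θ * t)) ((hsum t).mul_left (θ ^ 2))
  rw [mul_pow, ← mul_div_assoc]
  have : θ ^ (k + 2) ≤ θ ^ 2 := pow_le_pow_of_le_one hθ0 hθ1 (by omega)
  gcongr

theorem exp_sub_one_sub_le_sq {t : ℝ} (ht0 : 0 ≤ t) (ht1 : t ≤ 1) :
    Real.exp t - 1 - t ≤ t ^ 2 :=
  (le_abs_self _).trans (Real.abs_exp_sub_one_sub_id_le (by rwa [abs_of_nonneg ht0]))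

theorem exp_sub_one_sub_add_add_le (a b c : ℝ) :
    Real.exp (a + b + c) - 1 - (a + b + c) ≤ 1 / 3 * (Real.exp (3 * a) - 1 - 3 * a)
      + 1 / 3 * (Real.exp (3 * b) - 1 - 3 * b) + 1 / 3 * (Real.exp (3 * c) - 1 - 3 * c) := by
  have h3 : ∀ x : ℝ, Real.exp (3 * x) = Real.exp x ^ 3 := fun x => by
    rw [← Real.exp_nat_mul]; norm_num
  rw [Real.exp_add, Real.exp_add, h3, h3, h3]
  have := Real.exp_pos a
  have := Real.exp_pos b
  have := Real.exp_pos c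
  nlinarith [mul_nonneg (by positivity : 0 ≤ Real.exp a + Real.exp b + Real.exp c)
    (add_nonneg (add_nonneg (sq_nonneg (Real.exp a - Real.exp b))
      (sq_nonneg (Real.exp b - Real.exp c))) (sq_nonneg (Real.exp a - Real.exp c)))]

end ExpRemainder

section NoiseVector

variable {X : Type*} [MeasurableSpace X] {H : Type*} [NormedAddCommGroup H]
  [InnerProductSpace ℝ H] [CompleteSpace H] [RKHS ℝ H X ℝ]
  (hK : Measurable (Function.uncurry (ker H : X → X → ℝ))) {κ : ℝ}
  (hκ : ∀ x : X, Real.sqrt (ker H x x) ≤ κ) (ρ : Measure X) [IsProbabilityMeasure ρ]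

/-- The centered residual `(y - c x) K_x - S† S (f - c)` of an observation `z = (x, y)` with
regression function `f`. -/
noncomputable def residual (f c : H) (z : X × ℝ) : H :=
  (z.2 - c z.1) • point H z.1
    - ContinuousLinearMap.adjoint (incl hK hκ ρ) (incl hK hκ ρ (f - c))

theorem inner_residual (f c a : H) (z : X × ℝ) :
    inner ℝ a (residual hK hκ ρ f c z) = (z.2 - c z.1) * a z.1
      - inner ℝ (incl hK hκ ρ (f - c)) (incl hK hκ ρ a) := by
  rw [residual, inner_sub_right, real_inner_smul_right, ContinuousLinearMap.adjoint_inner_right,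
    real_inner_comm, inner_point, real_inner_comm]

theorem measurable_residual [TopologicalSpace.SeparableSpace H] [MeasurableSpace H] [BorelSpace H]
    (f c : H) : Measurable (residual hK hκ ρ f c) := by
  refine Measurable.sub_const ?_ _
  exact (measurable_snd.sub ((measurable_coe hK c).comp measurable_fst)).smul
    ((measurable_point hK).comp measurable_fst)

theorem integral_inner_residual {η : Kernel X ℝ} [IsMarkovKernel η] {f : H}
    (hreg : IsRegression ρ η f) (hsq : MemLp (fun z : X × ℝ => z.2) 2 (ρ.compProd η)) (c a : H) :
    Integrable (fun z => inner ℝ a (residual hK hκ ρ f c z)) (ρ.compProd η) ∧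
      ∫ z, inner ℝ a (residual hK hκ ρ f c z) ∂(ρ.compProd η) = 0 := by
  have hy : Integrable (fun z : X × ℝ => z.2) (ρ.compProd η) := hsq.integrable (by norm_num)
  have hbd : ∀ (v : H) (z : X × ℝ), ‖v z.1‖ ≤ κ * ‖v‖ := fun v z => abs_apply_le hκ v z.1
  have hmv : ∀ v : H, Measurable fun z : X × ℝ => v z.1 := fun v =>
    (measurable_coe hK v).comp measurable_fst
  have hcI : Integrable (fun z : X × ℝ => c z.1) (ρ.compProd η) :=
    Integrable.of_bound (hmv c).aestronglyMeasurable (κ * ‖c‖)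
      (Filter.Eventually.of_forall (hbd c))
  have h1 : Integrable (fun z : X × ℝ => (z.2 - c z.1) * a z.1) (ρ.compProd η) :=
    (hy.sub hcI).mul_bdd (hmv a).aestronglyMeasurable (Filter.Eventually.of_forall (hbd a))
  simp_rw [inner_residual]
  refine ⟨h1.sub (integrable_const _), ?_⟩
  rw [integral_sub h1 (integrable_const _), Measure.integral_compProd h1]
  have h2 : ∀ᵐ x ∂ρ, ∫ y, (y - c x) * a x ∂(η x) = (f - c) x * a x := by
    have h3 := ((Measure.integrable_compProd_iff hy.1).1 hy).1
    filter_upwards [hreg, h3] with x hx hIx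
    rw [integral_mul_const, integral_sub hIx (integrable_const _), ← hx]
    simp
  rw [integral_congr_ae h2, ← inner_incl hK hκ ρ]
  simp

/-- The mean of `x ↦ ⟪K_x, (S† S + lam)⁻¹ K_x⟫` controls functionals of the form
`v ↦ ⟪S g, S v⟫` for bounded `g`. -/
theorem resForm_adjoint_incl_le {lam : ℝ} (hlam : 0 < lam) {g : H} {b : ℝ} (hb : ∀ x, |g x| ≤ b)
    {D : ℝ} (hD : ∫⁻ x, ENNReal.ofReal (resForm (incl hK hκ ρ) lam (point H x) (point H x)) ∂ρ
      ≤ ENNReal.ofReal D) (hD0 : 0 ≤ D) [TopologicalSpace.SeparableSpace H] :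
    resForm (incl hK hκ ρ) lam
      (ContinuousLinearMap.adjoint (incl hK hκ ρ) (incl hK hκ ρ g))
      (ContinuousLinearMap.adjoint (incl hK hκ ρ) (incl hK hκ ρ g)) ≤ b ^ 2 * D := by
  set S := incl hK hκ ρ with hS
  have : Nonempty X := ρ.nonempty_of_neZero
  have hb0 : 0 ≤ b := (abs_nonneg _).trans (hb (Classical.arbitrary X))
  let _ : MeasurableSpace H := borel H
  have : BorelSpace H := ⟨rfl⟩
  set V : X → ℝ := fun x => √(resForm S lam (point H x) (point H x)) with hV
  have hVm : Measurable V := (measurable_resForm_self S lam).comp (measurable_point hK)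
  have hVsq : ∀ x, V x ^ 2 = resForm S lam (point H x) (point H x) := fun x =>
    Real.sq_sqrt (resForm_self_nonneg S hlam _)
  have hV2 : Integrable (fun x => V x ^ 2) ρ := by
    refine ⟨(hVm.pow_const 2).aestronglyMeasurable, ?_⟩
    rw [hasFiniteIntegral_iff_ofReal (Filter.Eventually.of_forall fun x => sq_nonneg _)]
    simp_rw [hVsq]
    exact hD.trans_lt ENNReal.ofReal_lt_top
  have hV2le : ∫ x, V x ^ 2 ∂ρ ≤ D := by
    rw [integral_eq_lintegral_of_nonneg_ae (Filter.Eventually.of_forall fun x => sq_nonneg _)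
      (hVm.pow_const 2).aestronglyMeasurable]
    simp_rw [hVsq]
    exact ENNReal.toReal_le_of_le_ofReal hD0 hD
  have hVLp : MemLp V 2 ρ := (memLp_two_iff_integrable_sq hVm.aestronglyMeasurable).2 hV2
  have hVI : Integrable V ρ := hVLp.integrable (by norm_num)
  have hV1 : ∫ x, V x ∂ρ ≤ √D := by
    refine Real.le_sqrt_of_sq_le (le_trans ?_ hV2le)
    have h1 : 0 ≤ ∫ x, (V x - ∫ x', V x' ∂ρ) ^ 2 ∂ρ := integral_nonneg fun x => sq_nonneg _
    have h2 : ∫ x, (V x - ∫ x', V x' ∂ρ) ^ 2 ∂ρ = ∫ x, V x ^ 2 ∂ρ - (∫ x, V x ∂ρ) ^ 2 := by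
      set e := ∫ x', V x' ∂ρ with he
      have h3 : ∀ x, (V x - e) ^ 2 = V x ^ 2 - (2 * e) * V x + e ^ 2 := fun x => by ring
      simp_rw [h3]
      have e1 := integral_add (hV2.sub (hVI.const_mul (2 * e))) (integrable_const (μ := ρ) (e ^ 2))
      have e2 := integral_sub hV2 (hVI.const_mul (2 * e))
      refine e1.trans ?_
      rw [show (∫ a, (((fun x => V x ^ 2) - fun x => 2 * e * V x) a) ∂ρ)
        = ∫ x, V x ^ 2 ∂ρ - ∫ x, 2 * e * V x ∂ρ from e2, integral_const_mul, ← he]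
      simp
      ring
    linarith
  have h4 : ∀ v, |inner ℝ (ContinuousLinearMap.adjoint S (S g)) v|
      ≤ (b * √D) * regNorm S lam v := by
    intro v
    rw [ContinuousLinearMap.adjoint_inner_left, hS, inner_incl hK hκ ρ, ← hS]
    have h5 : ∀ x, |g x * v x| ≤ b * V x * regNorm S lam v := by
      intro x
      rw [abs_mul, mul_assoc]
      refine mul_le_mul (hb x) ?_ (abs_nonneg _) hb0
      rw [← inner_point (H := H) x v]
      exact abs_inner_le_resForm S hlam _ _
    calc |∫ x, g x * v x ∂ρ| ≤ ∫ x, |g x * v x| ∂ρ := abs_integral_le_integral_abs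
      _ ≤ ∫ x, b * V x * regNorm S lam v ∂ρ :=
        integral_mono (integrable_mul_coe hK hκ ρ g v).abs ((hVI.const_mul b).mul_const _) h5
      _ = b * (∫ x, V x ∂ρ) * regNorm S lam v := by
        rw [integral_mul_const, integral_const_mul]
      _ ≤ _ := by
        have := regNorm_nonneg S lam v
        gcongr
  refine (resForm_self_le S hlam h4).trans (le_of_eq ?_)
  rw [mul_pow, Real.sq_sqrt hD0]

end NoiseVector

section NoiseTail

variable {X : Type*} [MeasurableSpace X] {H : Type*} [NormedAddCommGroup H]
  [InnerProductSpace ℝ H] [CompleteSpace H] [RKHS ℝ H X ℝ] [TopologicalSpace.SeparableSpace H]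
  (hK : Measurable (Function.uncurry (ker H : X → X → ℝ))) {κ : ℝ}
  (hκ : ∀ x : X, Real.sqrt (ker H x x) ≤ κ) (ρ : Measure X) [IsProbabilityMeasure ρ]

/-- The exponential moment of the residual. The residual is split into the noise
`(y - f x) K_x`, the bounded part `(f - c)(x) K_x` and the mean `S† S (f - c)`. -/
theorem lintegral_exp_residual_le {η : Kernel X ℝ} [IsMarkovKernel η] {f : H} {B γ : ℝ}
    (hB : 0 < B) (hnoise : SubExpNoise ρ η f B γ) {c : H} {b : ℝ} (hb : ∀ x, |(f - c) x| ≤ b)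
    {lam : ℝ} (hlam : 0 < lam) {D : ℝ}
    (hD : ∫⁻ x, ENNReal.ofReal (resForm (incl hK hκ ρ) lam (point H x) (point H x)) ∂ρ
      ≤ ENNReal.ofReal D) (hD0 : 0 ≤ D) {σ : ℝ} (hσ : 0 ≤ σ) (hσB : 3 * σ * (κ * B) ≤ √lam)
    (hσb : 3 * σ * (κ * b) ≤ √lam) :
    ∫⁻ z, ENNReal.ofReal (Real.exp (σ * √(resForm (incl hK hκ ρ) lam (residual hK hκ ρ f c z)
        (residual hK hκ ρ f c z))) - 1 - σ * √(resForm (incl hK hκ ρ) lam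
        (residual hK hκ ρ f c z) (residual hK hκ ρ f c z))) ∂(ρ.compProd η)
      ≤ ENNReal.ofReal (σ ^ 2 * D * (3 / 2 * γ ^ 2 + 6 * b ^ 2)) := by
  set S := incl hK hκ ρ with hS
  have : Nonempty X := ρ.nonempty_of_neZero
  have hb0 : 0 ≤ b := (abs_nonneg _).trans (hb (Classical.arbitrary X))
  have hκ0 : 0 ≤ κ := (Real.sqrt_nonneg _).trans (hκ (Classical.arbitrary X))
  let _ : MeasurableSpace H := borel H
  have : BorelSpace H := ⟨rfl⟩
  have hsl : 0 < √lam := Real.sqrt_pos.2 hlam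
  set V : X → ℝ := fun x => √(resForm S lam (point H x) (point H x)) with hV
  have hVm : Measurable V := (measurable_resForm_self S lam).comp (measurable_point hK)
  have hVsq : ∀ x, V x ^ 2 = resForm S lam (point H x) (point H x) := fun x =>
    Real.sq_sqrt (resForm_self_nonneg S hlam _)
  have hV0 : ∀ x, 0 ≤ V x := fun x => Real.sqrt_nonneg _
  have hVle : ∀ x, V x ≤ κ / √lam := by
    intro x
    have h1 := resForm_self_le_norm_sq S hlam (point H x)
    have h2 : (‖point H x‖ / √lam) ^ 2 ≤ (κ / √lam) ^ 2 := by
      have := norm_point_le hκ x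
      gcongr
    exact Real.sqrt_le_iff.2 ⟨by positivity, h1.trans h2⟩
  set g : H := f - c with hg
  set Tg : H := ContinuousLinearMap.adjoint S (S g) with hTg
  set NT : ℝ := √(resForm S lam Tg Tg) with hNT
  have hNTsq : NT ^ 2 ≤ b ^ 2 * D := by
    rw [hNT, Real.sq_sqrt (resForm_self_nonneg S hlam _)]
    exact resForm_adjoint_incl_le hK hκ ρ hlam hb hD hD0
  have hNTle : NT ≤ b * κ / √lam := by
    have hle : ∫⁻ x, ENNReal.ofReal (resForm S lam (point H x) (point H x)) ∂ρ
        ≤ ENNReal.ofReal ((κ / √lam) ^ 2) := by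
      calc _ ≤ ∫⁻ _, ENNReal.ofReal ((κ / √lam) ^ 2) ∂ρ := by
            refine lintegral_mono fun x => ENNReal.ofReal_le_ofReal ?_
            rw [← hVsq]
            exact pow_le_pow_left₀ (hV0 x) (hVle x) 2
        _ = _ := by simp
    have h1 := resForm_adjoint_incl_le hK hκ ρ hlam hb hle (sq_nonneg _)
    refine Real.sqrt_le_iff.2 ⟨by positivity, h1.trans (le_of_eq ?_)⟩
    ring
  set ψ : ℝ → ℝ := fun t => Real.exp t - 1 - t with hψ
  set A1 : X × ℝ → ℝ := fun z => 3 * (σ * V z.1 * B) ^ 2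
    * (Real.exp (|z.2 - f z.1| / B) - |z.2 - f z.1| / B - 1) with hA1
  set A2 : X × ℝ → ℝ := fun z => 3 * (σ * b) ^ 2 * V z.1 ^ 2 with hA2
  set a3 : ℝ := 3 * σ ^ 2 * (b ^ 2 * D) with ha3
  have hA1m : Measurable A1 := by
    have h1 : Measurable fun z : X × ℝ => |z.2 - f z.1| / B :=
      ((continuous_abs.measurable.comp (measurable_snd.sub
        ((measurable_coe hK f).comp measurable_fst)))).div_const B
    have h2 : Measurable fun z : X × ℝ => V z.1 := hVm.comp measurable_fst
    exact ((((h2.const_mul σ).mul_const B).pow_const 2).const_mul 3).mul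
      ((h1.exp.sub h1).sub_const 1)
  have hA2m : Measurable A2 := ((hVm.comp measurable_fst).pow_const 2).const_mul _
  have hA10 : ∀ z, 0 ≤ A1 z := by
    intro z
    have := exp_sub_one_sub_nonneg (|z.2 - f z.1| / B)
    exact mul_nonneg (by positivity) (by linarith)
  have hA20 : ∀ z, 0 ≤ A2 z := fun z => by positivity
  have hpt : ∀ z : X × ℝ, ψ (σ * √(resForm S lam (residual hK hκ ρ f c z)
      (residual hK hκ ρ f c z))) ≤ A1 z + A2 z + a3 := by
    intro z
    have hsplit : residual hK hκ ρ f c z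
        = ((z.2 - f z.1) • point H z.1 + g z.1 • point H z.1) + (-1 : ℝ) • Tg := by
      rw [residual, ← add_smul, neg_one_smul, ← sub_eq_add_neg, hTg, hg]
      congr 2
      simp
    have htri : √(resForm S lam (residual hK hκ ρ f c z) (residual hK hκ ρ f c z))
        ≤ |z.2 - f z.1| * V z.1 + b * V z.1 + NT := by
      rw [hsplit]
      refine (sqrt_resForm_add_le S hlam _ _).trans ?_
      rw [sqrt_resForm_smul S lam (-1) Tg]
      refine add_le_add ((sqrt_resForm_add_le S hlam _ _).trans ?_) (by simp [hNT])
      rw [sqrt_resForm_smul, sqrt_resForm_smul]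
      exact add_le_add le_rfl (mul_le_mul_of_nonneg_right (hb z.1) (hV0 _))
    have hVs : 3 * σ * B * V z.1 ≤ 1 := by
      calc 3 * σ * B * V z.1 ≤ 3 * σ * B * (κ / √lam) := by
            have := hVle z.1
            gcongr
        _ = 3 * σ * (κ * B) / √lam := by ring
        _ ≤ 1 := by rwa [div_le_one hsl]
    have hVb : 3 * σ * b * V z.1 ≤ 1 := by
      calc 3 * σ * b * V z.1 ≤ 3 * σ * b * (κ / √lam) := by
            have := hVle z.1
            gcongr
        _ = 3 * σ * (κ * b) / √lam := by ring
        _ ≤ 1 := by rwa [div_le_one hsl]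
    have hTb : 3 * σ * NT ≤ 1 := by
      calc 3 * σ * NT ≤ 3 * σ * (b * κ / √lam) := by gcongr
        _ = 3 * σ * (κ * b) / √lam := by ring
        _ ≤ 1 := by rwa [div_le_one hsl]
    have hVz := hV0 z.1
    have hNT0 : 0 ≤ NT := Real.sqrt_nonneg _
    have h1 : ψ (σ * √(resForm S lam (residual hK hκ ρ f c z) (residual hK hκ ρ f c z)))
        ≤ ψ (σ * |z.2 - f z.1| * V z.1 + σ * b * V z.1 + σ * NT) := by
      refine exp_sub_one_sub_mono (mul_nonneg hσ (Real.sqrt_nonneg _)) ?_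
      calc _ ≤ σ * (|z.2 - f z.1| * V z.1 + b * V z.1 + NT) := by gcongr
        _ = _ := by ring
    have h2 : ψ (3 * (σ * |z.2 - f z.1| * V z.1)) ≤ 3 * A1 z := by
      have h3 := exp_sub_one_sub_mul_le (θ := 3 * σ * B * V z.1) (t := |z.2 - f z.1| / B)
        (by positivity) hVs (by positivity)
      have h4 : 3 * σ * B * V z.1 * (|z.2 - f z.1| / B) = 3 * (σ * |z.2 - f z.1| * V z.1) := by
        field_simp
      rw [h4] at h3
      refine h3.trans (le_of_eq ?_)
      simp only [hA1]
      ring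
    have h5 : ψ (3 * (σ * b * V z.1)) ≤ 3 * A2 z := by
      refine (exp_sub_one_sub_le_sq (by positivity) (by linarith)).trans (le_of_eq ?_)
      simp only [hA2]
      ring
    have h6 : ψ (3 * (σ * NT)) ≤ 3 * a3 := by
      refine (exp_sub_one_sub_le_sq (by positivity) (by linarith)).trans ?_
      have := mul_le_mul_of_nonneg_left hNTsq (sq_nonneg σ)
      simp only [ha3]
      nlinarith
    have h7 := exp_sub_one_sub_add_add_le (σ * |z.2 - f z.1| * V z.1) (σ * b * V z.1) (σ * NT)
    simp only [hψ] at h1 h2 h5 h6 ⊢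
    linarith
  have hA1int : ∫⁻ z, ENNReal.ofReal (A1 z) ∂(ρ.compProd η)
      ≤ ENNReal.ofReal (3 / 2 * σ ^ 2 * γ ^ 2) * ENNReal.ofReal D := by
    rw [Measure.lintegral_compProd hA1m.ennreal_ofReal]
    calc _ ≤ ∫⁻ x, ENNReal.ofReal (3 / 2 * σ ^ 2 * γ ^ 2)
          * ENNReal.ofReal (resForm S lam (point H x) (point H x)) ∂ρ := by
          refine lintegral_mono_ae ?_
          filter_upwards [hnoise.2] with x hx
          have h8 : (0 : ℝ) ≤ 3 * (σ * V x * B) ^ 2 := by positivity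
          simp only [hA1, ENNReal.ofReal_mul h8]
          rw [lintegral_const_mul' _ _ ENNReal.ofReal_ne_top]
          refine (mul_le_mul_right hx _).trans (le_of_eq ?_)
          rw [← ENNReal.ofReal_mul h8, ← ENNReal.ofReal_mul (by positivity), ← hVsq]
          congr 1
          field_simp
      _ ≤ _ := by
          rw [lintegral_const_mul' _ _ ENNReal.ofReal_ne_top]
          exact mul_le_mul_right hD _
  have hA2int : ∫⁻ z, ENNReal.ofReal (A2 z) ∂(ρ.compProd η)
      ≤ ENNReal.ofReal (3 * (σ * b) ^ 2) * ENNReal.ofReal D := by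
    rw [Measure.lintegral_compProd hA2m.ennreal_ofReal]
    simp only [hA2, lintegral_const, measure_univ, mul_one]
    simp_rw [ENNReal.ofReal_mul (by positivity : 0 ≤ 3 * (σ * b) ^ 2), hVsq]
    rw [lintegral_const_mul' _ _ ENNReal.ofReal_ne_top]
    exact mul_le_mul_right hD _
  calc _ ≤ ∫⁻ z, (ENNReal.ofReal (A1 z) + ENNReal.ofReal (A2 z) + ENNReal.ofReal a3)
        ∂(ρ.compProd η) := by
        refine lintegral_mono fun z => ?_
        rw [← ENNReal.ofReal_add (hA10 z) (hA20 z),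
          ← ENNReal.ofReal_add (add_nonneg (hA10 z) (hA20 z)) (by positivity)]
        exact ENNReal.ofReal_le_ofReal (hpt z)
    _ = ∫⁻ z, ENNReal.ofReal (A1 z) ∂(ρ.compProd η) + ∫⁻ z, ENNReal.ofReal (A2 z) ∂(ρ.compProd η)
        + ENNReal.ofReal a3 := by
        rw [lintegral_add_right _ measurable_const, lintegral_add_left hA1m.ennreal_ofReal]
        simp
    _ ≤ ENNReal.ofReal (3 / 2 * σ ^ 2 * γ ^ 2) * ENNReal.ofReal D
        + ENNReal.ofReal (3 * (σ * b) ^ 2) * ENNReal.ofReal D + ENNReal.ofReal a3 := by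
        gcongr
    _ = _ := by
        rw [← ENNReal.ofReal_mul (by positivity), ← ENNReal.ofReal_mul (by positivity),
          ← ENNReal.ofReal_add (by positivity) (by positivity),
          ← ENNReal.ofReal_add (by positivity) (by positivity)]
        congr 1
        simp only [ha3]
        ring

variable {Ω : Type*} [MeasurableSpace Ω] {P : Measure Ω} [IsProbabilityMeasure P]

/-- With high probability, the empirical functional `v ↦ ∑ (y_j - c x_j) v x_j` is close to its
mean, uniformly in `v`. -/
theorem measure_exists_lt_abs_sum_residual_le {τ : Type*} {Z : τ → Ω → X × ℝ}
    (hZ : ∀ j, Measurable (Z j)) (hindep : iIndepFun Z P) (J : Finset τ)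
    {η : τ → Kernel X ℝ} [∀ j, IsMarkovKernel (η j)] {f : τ → H}
    (hlaw : ∀ j ∈ J, P.map (Z j) = ρ.compProd (η j))
    (hreg : ∀ j, IsRegression ρ (η j) (f j)) {B γ : ℝ} (hB : 0 < B) (hγ : 0 < γ)
    (hnoise : ∀ j, SubExpNoise ρ (η j) (f j) B γ) (hκ0 : 0 < κ)
    {c : H} {b : ℝ} (hb0 : 0 ≤ b) (hb : ∀ j ∈ J, ∀ x, |(f j - c) x| ≤ b)
    {lam : ℝ} (hlam : 0 < lam) {D : ℝ}
    (hD : ∫⁻ x, ENNReal.ofReal (resForm (incl hK hκ ρ) lam (point H x) (point H x)) ∂ρ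
      ≤ ENNReal.ofReal D) (hD0 : 0 ≤ D) {L : ℝ} (hL : 0 < L) :
    P {ω | ∃ v : H, (B + γ + b) * (6 * κ * L / √lam + 5 * √(J.card * D * L))
        * regNorm (incl hK hκ ρ) lam v
        < |∑ j ∈ J, (((Z j ω).2 - c (Z j ω).1) * v (Z j ω).1
          - inner ℝ (incl hK hκ ρ (f j - c)) (incl hK hκ ρ v))|}
      ≤ ENNReal.ofReal (2 * Real.exp (-L)) := by
  set S := incl hK hκ ρ with hS
  let _ : MeasurableSpace H := borel H
  have : BorelSpace H := ⟨rfl⟩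
  have hsl : 0 < √lam := Real.sqrt_pos.2 hlam
  set M := B + γ + b with hM
  have hM0 : 0 < M := by positivity
  set n : ℝ := (J.card : ℝ) with hn
  have hn0 : 0 ≤ n := Nat.cast_nonneg _
  set s : ℝ := M * (3 * κ / √lam + √(6 * (n * D) / L)) with hs
  have hs0 : 0 < s := by positivity
  set σ : ℝ := s⁻¹ with hσ
  have hσ0 : 0 < σ := inv_pos.2 hs0
  have hσs : ∀ t : ℝ, t ≤ s → σ * t ≤ 1 := by
    intro t ht
    rw [hσ, inv_mul_le_iff₀ hs0, mul_one]; exact ht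
  have hs1 : 3 * κ / √lam * M ≤ s := by
    rw [hs, mul_comm _ M]
    gcongr
    linarith [Real.sqrt_nonneg (6 * (n * D) / L)]
  have hs2 : M * √(6 * (n * D) / L) ≤ s := by
    rw [hs]
    gcongr
    have : 0 ≤ 3 * κ / √lam := by positivity
    linarith
  have hcond : ∀ t : ℝ, 0 ≤ t → t ≤ M → 3 * σ * (κ * t) ≤ √lam := by
    intro t ht0 ht
    have h1 := hσs _ ((mul_le_mul_of_nonneg_left ht (by positivity)).trans hs1)
    have h2 : σ * (3 * κ / √lam * t) = 3 * σ * (κ * t) / √lam := by ring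
    rwa [h2, div_le_one hsl] at h1
  set v : ℝ := σ ^ 2 * D * (6 * M ^ 2) with hv
  have hv0 : 0 ≤ v := by positivity
  have hexp : ∀ j ∈ J, ∫⁻ ω, ENNReal.ofReal (Real.exp (σ * √(resForm S lam
      (residual hK hκ ρ (f j) c (Z j ω)) (residual hK hκ ρ (f j) c (Z j ω)))) - 1
      - σ * √(resForm S lam (residual hK hκ ρ (f j) c (Z j ω))
        (residual hK hκ ρ (f j) c (Z j ω)))) ∂P ≤ ENNReal.ofReal v := by
    intro j hj
    have h1 := lintegral_exp_residual_le hK hκ ρ hB (hnoise j) (hb j hj) hlam hD hD0 hσ0.le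
      (hcond B hB.le (by linarith)) (hcond b hb0 (by linarith))
    have hm : Measurable fun z : X × ℝ => σ * √(resForm S lam
        (residual hK hκ ρ (f j) c z) (residual hK hκ ρ (f j) c z)) :=
      ((measurable_resForm_self S lam).comp (measurable_residual hK hκ ρ (f j) c)).const_mul σ
    have hm' : Measurable fun z : X × ℝ => ENNReal.ofReal (Real.exp (σ * √(resForm S lam
        (residual hK hκ ρ (f j) c z) (residual hK hκ ρ (f j) c z))) - 1 - σ * √(resForm S lam
        (residual hK hκ ρ (f j) c z) (residual hK hκ ρ (f j) c z))) :=
      ((hm.exp.sub_const 1).sub hm).ennreal_ofReal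
    rw [← hlaw j hj, lintegral_map hm' (hZ j)] at h1
    refine h1.trans (ENNReal.ofReal_le_ofReal ?_)
    have h2 : 3 / 2 * γ ^ 2 + 6 * b ^ 2 ≤ 6 * M ^ 2 := by
      rw [hM]
      nlinarith [mul_nonneg hB.le hγ.le, mul_nonneg hB.le hb0, mul_nonneg hγ.le hb0]
    exact mul_le_mul_of_nonneg_left h2 (by positivity)
  have hmean : ∀ j ∈ J, ∀ a : H,
      Integrable (fun ω => inner ℝ a (residual hK hκ ρ (f j) c (Z j ω))) P ∧
      ∫ ω, inner ℝ a (residual hK hκ ρ (f j) c (Z j ω)) ∂P = 0 := by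
    intro j hj a
    have h1 := integral_inner_residual hK hκ ρ (hreg j) (hnoise j).1 c a
    rw [← hlaw j hj] at h1
    refine ⟨h1.1.comp_measurable (hZ j), ?_⟩
    rw [← integral_map (hZ j).aemeasurable h1.1.1]
    exact h1.2
  have hY : ∀ j, Measurable fun ω => residual hK hκ ρ (f j) c (Z j ω) := fun j =>
    (measurable_residual hK hκ ρ (f j) c).comp (hZ j)
  have hYi : iIndepFun (fun j ω => residual hK hκ ρ (f j) c (Z j ω)) P :=
    hindep.comp (fun j => residual hK hκ ρ (f j) c) fun j => measurable_residual hK hκ ρ (f j) c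
  have hmain := measure_le_sqrt_resForm_sum_le S hlam hY hYi J hmean hσ0 hv0 hexp (2 * L * s)
  have hexponent : n * v - σ * (2 * L * s) ≤ -L := by
    have h1 : σ * (2 * L * s) = 2 * L := by rw [hσ]; field_simp
    have h2 : n * v ≤ L := by
      have h3 := hσs _ hs2
      have h4 : (σ * (M * √(6 * (n * D) / L))) ^ 2 ≤ 1 := pow_le_one₀ (by positivity) h3
      have h5 : (σ * (M * √(6 * (n * D) / L))) ^ 2 = n * v / L := by
        rw [mul_pow, mul_pow, Real.sq_sqrt (by positivity), hv]; ring
      rwa [h5, div_le_one hL] at h4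
    linarith
  refine (measure_mono ?_).trans (hmain.trans (ENNReal.ofReal_le_ofReal ?_))
  · rintro ω ⟨w, hw⟩
    have h1 : ∑ j ∈ J, (((Z j ω).2 - c (Z j ω).1) * w (Z j ω).1 - inner ℝ (S (f j - c)) (S w))
        = inner ℝ (∑ j ∈ J, residual hK hκ ρ (f j) c (Z j ω)) w := by
      rw [sum_inner]
      refine Finset.sum_congr rfl fun j _ => ?_
      exact (inner_residual hK hκ ρ (f j) c w (Z j ω)).symm.trans (real_inner_comm _ _)
    rw [h1] at hw
    have h2 := hw.trans_le (abs_inner_le_resForm S hlam _ _)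
    have h3 := lt_of_mul_lt_mul_right h2 (regNorm_nonneg S lam w)
    refine le_trans ?_ h3.le
    have h4 : L * √(6 * (n * D) / L) ≤ 5 / 2 * √(n * D * L) := by
      have e1 : L * √(6 * (n * D) / L) = √(6 * (n * D * L)) := by
        rw [show 6 * (n * D * L) = L ^ 2 * (6 * (n * D) / L) by field_simp,
          Real.sqrt_mul (sq_nonneg L), Real.sqrt_sq hL.le]
      rw [e1, Real.sqrt_mul (by norm_num)]
      refine mul_le_mul_of_nonneg_right ?_ (Real.sqrt_nonneg _)
      rw [Real.sqrt_le_left (by norm_num)]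
      norm_num
    calc 2 * L * s = M * (6 * κ * L / √lam + 2 * (L * √(6 * (n * D) / L))) := by rw [hs]; ring
      _ ≤ M * (6 * κ * L / √lam + 5 * √(n * D * L)) := by
        have : 2 * (L * √(6 * (n * D) / L)) ≤ 5 * √(n * D * L) := by linarith
        gcongr
  · have := Real.exp_le_exp.2 hexponent
    linarith

end NoiseTail

/-! ### Empirical norms of vectors that are independent of the sample -/

section FreshSample

variable {Ω : Type*} [MeasurableSpace Ω] {P : Measure Ω} [IsProbabilityMeasure P]

/-- A multiplicative Chernoff bound for sums of independent random variables with values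
in `[0, 1]`. -/
theorem measureReal_sum_ge_le {τ : Type*} {W : τ → Ω → ℝ} (hW : ∀ j, Measurable (W j))
    (hindep : iIndepFun W P) (J : Finset τ) (hW01 : ∀ j ω, W j ω ∈ Set.Icc (0 : ℝ) 1) {m : ℝ}
    (hm : ∀ j ∈ J, ∫ ω, W j ω ∂P ≤ m) (L : ℝ) :
    P.real {ω | 2 * (J.card * m) + L ≤ ∑ j ∈ J, W j ω} ≤ Real.exp (-L) := by
  have hint : ∀ j, Integrable (W j) P := fun j =>
    Integrable.of_bound (hW j).aestronglyMeasurable 1 (Filter.Eventually.of_forall fun ω => by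
      rw [Real.norm_eq_abs, abs_of_nonneg (hW01 j ω).1]; exact (hW01 j ω).2)
  have hmgf : ∀ j ∈ J, mgf (W j) P 1 ≤ Real.exp (2 * m) := by
    intro j hj
    have hle : ∀ ω, Real.exp (1 * W j ω) ≤ 1 + 2 * W j ω := by
      intro ω
      have h1 := convexOn_exp.2 (Set.mem_univ 0) (Set.mem_univ 1)
        (sub_nonneg.2 (hW01 j ω).2) (hW01 j ω).1 (sub_add_cancel 1 (W j ω))
      simp only [smul_eq_mul, mul_zero, mul_one, zero_add, Real.exp_zero] at h1
      have h2 := Real.exp_one_lt_three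
      have h3 := (hW01 j ω).1
      rw [one_mul]
      nlinarith
    calc mgf (W j) P 1 ≤ ∫ ω, (1 + 2 * W j ω) ∂P := by
          refine integral_mono_of_nonneg (Filter.Eventually.of_forall fun ω => (Real.exp_pos _).le)
            ((integrable_const _).add ((hint j).const_mul 2)) (Filter.Eventually.of_forall hle)
      _ = 1 + 2 * ∫ ω, W j ω ∂P := by
          rw [integral_add (integrable_const _) ((hint j).const_mul 2), integral_const_mul]
          simp
      _ ≤ 2 * m + 1 := by linarith [hm j hj]
      _ ≤ _ := Real.add_one_le_exp _
  have hsumI : Integrable (fun ω => Real.exp (1 * (∑ j ∈ J, W j) ω)) P := by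
    have hmeas : Measurable fun ω => Real.exp (1 * (∑ j ∈ J, W j) ω) := by
      have : Measurable (∑ j ∈ J, W j) := by
        rw [show (∑ j ∈ J, W j) = fun ω => ∑ j ∈ J, W j ω by ext ω; simp]
        exact Finset.measurable_sum J fun j _ => hW j
      exact (this.const_mul 1).exp
    refine Integrable.of_bound hmeas.aestronglyMeasurable (Real.exp J.card)
      (Filter.Eventually.of_forall fun ω => ?_)
    rw [Real.norm_eq_abs, abs_of_pos (Real.exp_pos _), one_mul, Finset.sum_apply]
    refine Real.exp_le_exp.2 ((Finset.sum_le_sum fun j _ => (hW01 j ω).2).trans ?_)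
    simp
  have h1 := measure_ge_le_exp_mul_mgf (μ := P) (X := ∑ j ∈ J, W j) (2 * (J.card * m) + L)
    zero_le_one hsumI
  rw [hindep.mgf_sum hW] at h1
  have h2 : ∏ j ∈ J, mgf (W j) P 1 ≤ Real.exp (2 * m) ^ J.card := by
    rw [← Finset.prod_const]
    exact Finset.prod_le_prod (fun j _ => mgf_nonneg) hmgf
  rw [← Real.exp_nat_mul] at h2
  have h3 : {ω | 2 * (J.card * m) + L ≤ ∑ j ∈ J, W j ω}
      = {ω | 2 * (J.card * m) + L ≤ (∑ j ∈ J, W j) ω} := by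
    simp only [Finset.sum_apply]
  rw [h3]
  refine h1.trans ((mul_le_mul_of_nonneg_left h2 (Real.exp_pos _).le).trans (le_of_eq ?_))
  rw [← Real.exp_add]
  congr 1
  ring

variable {X : Type*} [MeasurableSpace X] {H : Type*} [NormedAddCommGroup H]
  [InnerProductSpace ℝ H] [CompleteSpace H] [RKHS ℝ H X ℝ]
  (hK : Measurable (Function.uncurry (ker H : X → X → ℝ))) {κ : ℝ}
  (hκ : ∀ x : X, Real.sqrt (ker H x x) ≤ κ) (ρ : Measure X) [IsProbabilityMeasure ρ]

theorem measure_sum_sq_gt_le (hκ0 : 0 < κ) {τ : Type*} {Z : τ → Ω → X × ℝ}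
    (hZ : ∀ j, Measurable (Z j)) (hindep : iIndepFun Z P) {J : Finset τ}
    (hlaw : ∀ j ∈ J, P.map (fun ω => (Z j ω).1) = ρ) (L : ℝ) (u : H) :
    P {ω | 2 * (J.card * ‖incl hK hκ ρ u‖ ^ 2) + κ ^ 2 * ‖u‖ ^ 2 * L
      < ∑ j ∈ J, u (Z j ω).1 ^ 2} ≤ ENNReal.ofReal (Real.exp (-L)) := by
  rcases eq_or_ne u 0 with rfl | hu
  · have : {ω | 2 * (J.card * ‖incl hK hκ ρ 0‖ ^ 2) + κ ^ 2 * ‖(0 : H)‖ ^ 2 * L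
      < ∑ j ∈ J, (0 : H) (Z j ω).1 ^ 2} = ∅ := by
      ext ω
      have h0 : ∀ x : X, (0 : H) x = 0 := fun x => by rw [← inner_point, inner_zero_right]
      simp [h0]
    rw [this]
    simp
  have hun : 0 < ‖u‖ := norm_pos_iff.2 hu
  set a : ℝ := κ ^ 2 * ‖u‖ ^ 2 with ha
  have ha0 : 0 < a := by positivity
  set φ : X × ℝ → ℝ := fun z => u z.1 ^ 2 / a with hφ
  have hφm : Measurable φ := (((measurable_coe hK u).comp measurable_fst).pow_const 2).div_const a
  have hφ01 : ∀ z, φ z ∈ Set.Icc (0 : ℝ) 1 := by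
    intro z
    refine ⟨by positivity, ?_⟩
    simp only [hφ]
    rw [div_le_one ha0, ha, ← mul_pow, ← sq_abs]
    exact pow_le_pow_left₀ (abs_nonneg _) (abs_apply_le hκ u z.1) 2
  have hmean : ∀ j ∈ J, ∫ ω, φ (Z j ω) ∂P ≤ ‖incl hK hκ ρ u‖ ^ 2 / a := by
    intro j hj
    have hm : Measurable fun ω => (Z j ω).1 := measurable_fst.comp (hZ j)
    have h1 : ∫ x, u x ^ 2 / a ∂ρ = ∫ ω, φ (Z j ω) ∂P := by
      rw [← hlaw j hj, integral_map hm.aemeasurable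
        (((measurable_coe hK u).pow_const 2).div_const a).aestronglyMeasurable]
    rw [← h1, integral_div, ← norm_incl_sq hK hκ ρ]
  have hmain := measureReal_sum_ge_le (fun j => hφm.comp (hZ j))
    (hindep.comp (fun _ => φ) fun _ => hφm) J (fun j ω => hφ01 (Z j ω)) hmean L
  calc _ ≤ P {ω | 2 * (J.card * (‖incl hK hκ ρ u‖ ^ 2 / a)) + L
        ≤ ∑ j ∈ J, (φ ∘ Z j) ω} := by
        refine measure_mono fun ω hω => ?_
        have h2 : 2 * (J.card * ‖incl hK hκ ρ u‖ ^ 2) + a * L < ∑ j ∈ J, u (Z j ω).1 ^ 2 := hω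
        change _ ≤ ∑ j ∈ J, u (Z j ω).1 ^ 2 / a
        rw [← Finset.sum_div, le_div_iff₀ ha0]
        refine le_trans (le_of_eq ?_) h2.le
        field_simp
    _ ≤ _ := by
        rw [← ofReal_measureReal]
        exact ENNReal.ofReal_le_ofReal hmain

/-- The empirical norm of a random vector that is independent of the sample. -/
theorem measure_sum_sq_gt_le_of_indep [TopologicalSpace.SeparableSpace H] [MeasurableSpace H]
    [BorelSpace H] (hκ0 : 0 < κ) {τ : Type*} {Z : τ → Ω → X × ℝ}
    (hZ : ∀ j, Measurable (Z j)) (hindep : iIndepFun Z P) {I J : Finset τ} (hIJ : Disjoint I J)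
    (hlaw : ∀ j ∈ J, P.map (fun ω => (Z j ω).1) = ρ) (L : ℝ)
    {u : (I → X × ℝ) → H} (hu : Measurable u) :
    P {ω | 2 * (J.card * ‖incl hK hκ ρ (u fun i => Z i ω)‖ ^ 2)
        + κ ^ 2 * ‖u fun i => Z i ω‖ ^ 2 * L < ∑ j ∈ J, (u fun i => Z i ω) (Z j ω).1 ^ 2}
      ≤ ENNReal.ofReal (Real.exp (-L)) := by
  have hind := hindep.indepFun_finset I J hIJ hZ
  have hmI : Measurable fun ω (i : I) => Z i ω := measurable_pi_iff.2 fun i => hZ i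
  have hmJ : Measurable fun ω (j : J) => Z j ω := measurable_pi_iff.2 fun i => hZ i
  have hprod := (indepFun_iff_map_prod_eq_prod_map_map hmI.aemeasurable hmJ.aemeasurable).1 hind
  set E : Set ((I → X × ℝ) × (J → X × ℝ)) := {q | 2 * (J.card * ‖incl hK hκ ρ (u q.1)‖ ^ 2)
    + κ ^ 2 * ‖u q.1‖ ^ 2 * L < ∑ j, (u q.1) (q.2 j).1 ^ 2} with hE
  have hEm : MeasurableSet E := by
    have hu1 : Measurable fun q : (I → X × ℝ) × (J → X × ℝ) => u q.1 := hu.comp measurable_fst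
    have h1 : Measurable fun q : (I → X × ℝ) × (J → X × ℝ) => ‖incl hK hκ ρ (u q.1)‖ :=
      ((incl hK hκ ρ).continuous.norm.measurable).comp hu1
    refine measurableSet_lt (((h1.pow_const 2).const_mul _).const_mul 2 |>.add
      (((hu1.norm.pow_const 2).const_mul _).mul_const L)) ?_
    refine Finset.measurable_sum _ fun j _ => ?_
    simp_rw [← inner_point (H := H)]
    have h2 : Measurable fun q : (I → X × ℝ) × (J → X × ℝ) => point H (q.2 j).1 :=
      (measurable_point hK).comp (measurable_fst.comp ((measurable_pi_apply j).comp measurable_snd))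
    exact (h2.inner hu1).pow_const 2
  have hset : {ω | 2 * (J.card * ‖incl hK hκ ρ (u fun i => Z i ω)‖ ^ 2)
      + κ ^ 2 * ‖u fun i => Z i ω‖ ^ 2 * L < ∑ j ∈ J, (u fun i => Z i ω) (Z j ω).1 ^ 2}
      = (fun ω => ((fun i : I => Z i ω), (fun j : J => Z j ω))) ⁻¹' E := by
    ext ω
    simp only [hE, Set.mem_ofPred_eq, Set.mem_preimage]
    rw [← Finset.sum_coe_sort J fun j => (u fun i => Z i ω) (Z j ω).1 ^ 2]
  rw [hset, ← Measure.map_apply (hmI.prodMk hmJ) hEm, hprod, Measure.prod_apply hEm]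
  have hbound : ∀ s, (P.map fun ω (j : J) => Z j ω) (Prod.mk s ⁻¹' E)
      ≤ ENNReal.ofReal (Real.exp (-L)) := by
    intro s
    rw [Measure.map_apply hmJ (measurable_prodMk_left hEm)]
    refine le_trans (measure_mono fun ω hω => ?_)
      (measure_sum_sq_gt_le hK hκ ρ hκ0 hZ hindep hlaw L (u s))
    simp only [hE, Set.mem_ofPred_eq, Set.mem_preimage] at hω ⊢
    rwa [← Finset.sum_coe_sort J fun j => (u s) (Z j ω).1 ^ 2]
  have : IsProbabilityMeasure (P.map fun ω (i : I) => Z i ω) :=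
    Measure.isProbabilityMeasure_map hmI.aemeasurable
  calc _ ≤ ∫⁻ _, ENNReal.ofReal (Real.exp (-L)) ∂(P.map fun ω (i : I) => Z i ω) :=
        lintegral_mono hbound
    _ = _ := by simp

end FreshSample

section EmpiricalSolution

variable {H : Type*} [NormedAddCommGroup H] [InnerProductSpace ℝ H] {ι : Type*}

/-- The operator `t ∑ i ∈ J, q_i ⊗ q_i + lam` of an empirical ridge regression equation. -/
noncomputable def ridgeOp (J : Finset ι) (t lam : ℝ) (q : ι → H) : H →L[ℝ] H :=
  t • ∑ i ∈ J, (innerSL ℝ (q i)).smulRight (q i) + lam • (1 : H →L[ℝ] H)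

theorem inner_ridgeOp (J : Finset ι) (t lam : ℝ) (q : ι → H) (w v : H) :
    inner ℝ (ridgeOp J t lam q w) v
      = t * ∑ i ∈ J, inner ℝ (q i) w * inner ℝ (q i) v + lam * inner ℝ w v := by
  simp [ridgeOp, inner_add_left, real_inner_smul_left, sum_inner]

theorem continuous_ridgeOp (J : Finset ι) (t lam : ℝ) :
    Continuous fun q : ι → H => ridgeOp J t lam q := by
  have h2 : Continuous fun x : H => (innerSL ℝ x).smulRight x := by
    have h3 : Continuous fun r : (H →L[ℝ] ℝ) × H => ContinuousLinearMap.smulRightL ℝ H H r.1 r.2 :=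
      (ContinuousLinearMap.smulRightL ℝ H H).continuous₂
    have h4 : Continuous fun x : H => ((innerSL ℝ x, x) : (H →L[ℝ] ℝ) × H) :=
      (innerSL ℝ).continuous.prodMk continuous_id
    exact h3.comp h4
  refine Continuous.add (Continuous.const_smul (continuous_finsetSum _ fun i _ => ?_) t)
    continuous_const
  exact h2.comp (continuous_apply i)

variable [CompleteSpace H]

theorem isUnit_ridgeOp (J : Finset ι) {t lam : ℝ} (ht : 0 ≤ t) (hlam : 0 < lam) (q : ι → H) :
    IsUnit (ridgeOp J t lam q) := by
  refine ContinuousLinearMap.isUnit_of_forall_le_norm_inner_map _ (c := lam.toNNReal)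
    (Real.toNNReal_pos.2 hlam) fun x => le_trans ?_ (le_abs_self _)
  rw [Real.coe_toNNReal _ hlam.le, inner_ridgeOp, real_inner_self_eq_norm_sq]
  have : 0 ≤ t * ∑ i ∈ J, inner ℝ (q i) x * inner ℝ (q i) x :=
    mul_nonneg ht (Finset.sum_nonneg fun i _ => mul_self_nonneg _)
  linarith

theorem continuous_inverse_ridgeOp (J : Finset ι) {t lam : ℝ} (ht : 0 ≤ t) (hlam : 0 < lam) :
    Continuous fun q : ι → H => Ring.inverse (ridgeOp J t lam q) := by
  rw [continuous_iff_continuousAt]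
  intro q
  obtain ⟨x, hx⟩ := isUnit_ridgeOp J ht hlam q
  have h1 := NormedRing.inverse_continuousAt x
  rw [hx] at h1
  exact ContinuousAt.comp (f := fun q : ι → H => ridgeOp J t lam q) h1
    (continuous_ridgeOp J t lam).continuousAt

/-- The solution of an empirical ridge regression equation depends measurably on the data. -/
theorem exists_measurable_solution [TopologicalSpace.SeparableSpace H] [MeasurableSpace H]
    [BorelSpace H] {α : Type*} [MeasurableSpace α] [Finite ι] {p : ι → α → H}
    (hp : ∀ i, Measurable (p i)) {b : α → H} (hb : Measurable b) (J : Finset ι) {t lam : ℝ}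
    (ht : 0 ≤ t) (hlam : 0 < lam) :
    ∃ u : α → H, Measurable u ∧ ∀ a v,
      t * ∑ i ∈ J, inner ℝ (p i a) (u a) * inner ℝ (p i a) v + lam * inner ℝ (u a) v
        = inner ℝ (b a) v := by
  have : SecondCountableTopology H := UniformSpace.secondCountable_of_separable H
  have hpb : Measurable fun a => ((fun i => p i a, b a) : (ι → H) × H) :=
    (measurable_pi_iff.2 hp).prodMk hb
  have hcont : Continuous fun q : (ι → H) × H => Ring.inverse (ridgeOp J t lam q.1) q.2 :=
    ((continuous_inverse_ridgeOp J ht hlam).comp continuous_fst).clm_apply continuous_snd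
  have hb1 : BorelSpace (ι → H) := Pi.borelSpace
  have hb2 : BorelSpace ((ι → H) × H) := Prod.borelSpace
  have hm : Measurable fun q : (ι → H) × H => Ring.inverse (ridgeOp J t lam q.1) q.2 :=
    Continuous.measurable hcont
  have key : ∀ F : (ι → H) × H → H, Measurable F → Measurable fun a => F (fun i => p i a, b a) :=
    fun F hF => hF.comp hpb
  refine ⟨fun a => Ring.inverse (ridgeOp J t lam fun i => p i a) (b a),
    key (fun q => Ring.inverse (ridgeOp J t lam q.1) q.2) hm, fun a v => ?_⟩
  have h := Ring.mul_inverse_cancel _ (isUnit_ridgeOp J ht hlam fun i => p i a)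
  have h1 : ridgeOp J t lam (fun i => p i a) (Ring.inverse (ridgeOp J t lam fun i => p i a) (b a))
      = b a := congrArg (fun T : H →L[ℝ] H => T (b a)) h
  have h2 := inner_ridgeOp J t lam (fun i => p i a)
    (Ring.inverse (ridgeOp J t lam fun i => p i a) (b a)) v
  rw [h1] at h2
  exact h2.symm

end EmpiricalSolution

/-! ### Deterministic analysis of the two-step estimator -/

section EmpiricalNorm

variable {X H τ : Type*} [NormedAddCommGroup H] [InnerProductSpace ℝ H]
  [RKHS ℝ H X ℝ]

/-- The empirical seminorm `√(t ∑ j ∈ J, v x_j ^ 2)`. -/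
noncomputable def empNorm (x : τ → X) (J : Finset τ) (t : ℝ) (v : H) : ℝ :=
  √(t * ∑ j ∈ J, v (x j) ^ 2)

theorem empNorm_nonneg (x : τ → X) (J : Finset τ) (t : ℝ) (v : H) : 0 ≤ empNorm x J t v :=
  Real.sqrt_nonneg _

theorem empNorm_sq (x : τ → X) (J : Finset τ) {t : ℝ} (ht : 0 ≤ t) (v : H) :
    empNorm x J t v ^ 2 = t * ∑ j ∈ J, v (x j) ^ 2 :=
  Real.sq_sqrt (mul_nonneg ht (Finset.sum_nonneg fun _ _ => sq_nonneg _))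

theorem abs_sum_mul_le_empNorm (x : τ → X) (J : Finset τ) {t : ℝ} (ht : 0 ≤ t) (u v : H) :
    |t * ∑ j ∈ J, u (x j) * v (x j)| ≤ empNorm x J t u * empNorm x J t v := by
  refine abs_le_of_sq_le_sq ?_ (mul_nonneg (empNorm_nonneg _ _ _ _) (empNorm_nonneg _ _ _ _))
  rw [mul_pow, mul_pow, empNorm_sq x J ht, empNorm_sq x J ht]
  have := Finset.sum_mul_sq_le_sq_mul_sq J (fun j => u (x j)) fun j => v (x j)
  nlinarith [sq_nonneg t]

theorem empNorm_add_le (x : τ → X) (J : Finset τ) {t : ℝ} (ht : 0 ≤ t) (u v : H) :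
    empNorm x J t (u + v) ≤ empNorm x J t u + empNorm x J t v := by
  refine abs_le_of_sq_le_sq' ?_ (add_nonneg (empNorm_nonneg _ _ _ _) (empNorm_nonneg _ _ _ _)) |>.2
  have h1 := (le_abs_self _).trans (abs_sum_mul_le_empNorm x J ht u v)
  have h2 : empNorm x J t (u + v) ^ 2
      = empNorm x J t u ^ 2 + empNorm x J t v ^ 2 + 2 * (t * ∑ j ∈ J, u (x j) * v (x j)) := by
    rw [empNorm_sq x J ht, empNorm_sq x J ht, empNorm_sq x J ht]
    simp only [Finset.mul_sum]
    rw [← Finset.sum_add_distrib, ← Finset.sum_add_distrib]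
    refine Finset.sum_congr rfl fun j _ => ?_
    simp only [RKHS.coe_add, Pi.add_apply]
    ring
  rw [h2]
  nlinarith

theorem empNorm_le [CompleteSpace H] {κ : ℝ} (hκ : ∀ x : X, Real.sqrt (ker H x x) ≤ κ)
    (hκ0 : 0 ≤ κ) (x : τ → X) (J : Finset τ) {t : ℝ} (ht : 0 ≤ t) (htJ : t * J.card ≤ 1) (v : H) :
    empNorm x J t v ≤ κ * ‖v‖ := by
  refine Real.sqrt_le_iff.2 ⟨by positivity, ?_⟩
  have h1 : ∑ j ∈ J, v (x j) ^ 2 ≤ ∑ _j ∈ J, (κ * ‖v‖) ^ 2 := by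
    refine Finset.sum_le_sum fun j _ => ?_
    rw [← sq_abs]
    exact pow_le_pow_left₀ (abs_nonneg _) (abs_apply_le hκ v (x j)) 2
  rw [Finset.sum_const, nsmul_eq_mul] at h1
  calc _ ≤ t * (J.card * (κ * ‖v‖) ^ 2) := mul_le_mul_of_nonneg_left h1 ht
    _ = t * J.card * (κ * ‖v‖) ^ 2 := by ring
    _ ≤ 1 * (κ * ‖v‖) ^ 2 := mul_le_mul_of_nonneg_right htJ (sq_nonneg _)
    _ = _ := one_mul _

/-- The energy `√(t ∑ j ∈ J, v x_j ^ 2 + lam ‖v‖ ^ 2)` of an empirical ridge regression problem. -/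
noncomputable def energy (x : τ → X) (J : Finset τ) (t lam : ℝ) (v : H) : ℝ :=
  √(t * ∑ j ∈ J, v (x j) ^ 2 + lam * ‖v‖ ^ 2)

theorem energy_nonneg (x : τ → X) (J : Finset τ) (t lam : ℝ) (v : H) : 0 ≤ energy x J t lam v :=
  Real.sqrt_nonneg _

theorem energy_sq (x : τ → X) (J : Finset τ) {t lam : ℝ} (ht : 0 ≤ t) (hlam : 0 ≤ lam) (v : H) :
    energy x J t lam v ^ 2 = t * ∑ j ∈ J, v (x j) ^ 2 + lam * ‖v‖ ^ 2 :=
  Real.sq_sqrt (add_nonneg (mul_nonneg ht (Finset.sum_nonneg fun _ _ => sq_nonneg _))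
    (mul_nonneg hlam (sq_nonneg _)))

theorem empNorm_le_energy (x : τ → X) (J : Finset τ) {t lam : ℝ} (hlam : 0 ≤ lam) (v : H) :
    empNorm x J t v ≤ energy x J t lam v :=
  Real.sqrt_le_sqrt (le_add_of_nonneg_right (mul_nonneg hlam (sq_nonneg _)))

theorem sqrt_mul_norm_le_energy (x : τ → X) (J : Finset τ) {t lam : ℝ} (ht : 0 ≤ t) (v : H) :
    √lam * ‖v‖ ≤ energy x J t lam v := by
  have h1 : √lam * ‖v‖ = √(lam * ‖v‖ ^ 2) := by
    rw [Real.sqrt_mul' _ (sq_nonneg _), Real.sqrt_sq (norm_nonneg v)]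
  rw [h1]
  exact Real.sqrt_le_sqrt (le_add_of_nonneg_left
    (mul_nonneg ht (Finset.sum_nonneg fun _ _ => sq_nonneg _)))

theorem energy_mono (x : τ → X) {J K : Finset τ} (hJK : J ⊆ K) {t lam : ℝ} (ht : 0 ≤ t) (v : H) :
    energy x J t lam v ≤ energy x K t lam v := by
  refine Real.sqrt_le_sqrt (add_le_add_left (mul_le_mul_of_nonneg_left ?_ ht) _)
  exact Finset.sum_le_sum_of_subset_of_nonneg hJK fun _ _ _ => sq_nonneg _

/-- The basic energy estimate for a ridge regression equation tested with its solution. -/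
theorem energy_le_of_eq (x : τ → X) (J : Finset τ) {t lam : ℝ} (ht : 0 ≤ t) (hlam : 0 ≤ lam)
    {u : H} {l a : ℝ} (heq : t * ∑ j ∈ J, u (x j) * u (x j) + lam * inner ℝ u u = l)
    (hl : l ≤ a * energy x J t lam u) (ha : 0 ≤ a) : energy x J t lam u ≤ a := by
  have h1 : energy x J t lam u ^ 2 = l := by
    rw [energy_sq x J ht hlam, ← heq, real_inner_self_eq_norm_sq]
    simp only [sq]
  rw [← h1] at hl
  rcases (energy_nonneg x J t lam u).eq_or_lt with h0 | h0
  · rwa [← h0]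
  · nlinarith

end EmpiricalNorm

section Deterministic

variable {X H E τ : Type*} [NormedAddCommGroup H] [InnerProductSpace ℝ H]
  [RKHS ℝ H X ℝ] [NormedAddCommGroup E] [InnerProductSpace ℝ E] {S : H →L[ℝ] E}

/-- The error of the transferring step, relative to the center `c`. -/
theorem energy_transfer_le {x : τ → X} {J : Finset τ} {t lam I β : ℝ} (ht : 0 ≤ t) (hlam : 0 ≤ lam)
    (hβ : 0 ≤ β) {u : H} {l : H → ℝ}
    (heq : ∀ v, t * ∑ j ∈ J, u (x j) * v (x j) + lam * inner ℝ u v = l v)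
    (hl : ∀ v, |l v| ≤ β * regNorm S lam v)
    (hiso : ∀ v, regNorm S lam v ≤ √I * energy x J t lam v) :
    energy x J t lam u ≤ √I * β := by
  refine energy_le_of_eq x J ht hlam (heq u) ?_ (by positivity)
  calc l u ≤ β * regNorm S lam u := (le_abs_self _).trans (hl u)
    _ ≤ β * (√I * energy x J t lam u) := mul_le_mul_of_nonneg_left (hiso u) hβ
    _ = _ := by ring

/-- The error of the debiasing step: `e` is the total error of the estimator, and `u` that of the
transferring step relative to the center `c`. -/
theorem norm_map_sub_le [CompleteSpace H] {κ : ℝ} (hκ : ∀ x : X, Real.sqrt (ker H x x) ≤ κ)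
    (hκ0 : 0 ≤ κ) {x : τ → X} {J : Finset τ} {t lam I U h β : ℝ} (ht : 0 ≤ t) (htJ : t * J.card ≤ 1)
    (hlam : 0 < lam) (hβ : 0 ≤ β) (hh : 0 ≤ h) {e u d : H} {l : H → ℝ}
    (heq : ∀ v, t * ∑ j ∈ J, (e - u) (x j) * v (x j) + lam * inner ℝ (e - u) v
      = l v - t * ∑ j ∈ J, u (x j) * v (x j) + lam * inner ℝ d v)
    (hl : ∀ v, |l v| ≤ β * regNorm S lam v) (hd : ‖d‖ ≤ h) (hU : empNorm x J t u ≤ U)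
    (hiso : ∀ v, regNorm S lam v ≤ √I * energy x J t lam v) :
    ‖S (e - u)‖ ≤ √I * (√I * β + min 1 (κ / √lam) * U + √lam * h) := by
  have hsl : 0 < √lam := Real.sqrt_pos.2 hlam
  have hU0 : 0 ≤ U := (empNorm_nonneg _ _ _ _).trans hU
  set w := e - u with hw
  set q := energy x J t lam w with hq
  have hq0 : 0 ≤ q := energy_nonneg _ _ _ _ _
  have hnorm : ‖w‖ ≤ q / √lam := by
    rw [le_div_iff₀ hsl, mul_comm]
    exact sqrt_mul_norm_le_energy x J ht w
  have hmin : empNorm x J t w ≤ min 1 (κ / √lam) * q := by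
    rw [min_mul_of_nonneg _ _ hq0]
    refine le_min ?_ ?_
    · rw [one_mul]; exact empNorm_le_energy x J hlam.le w
    · calc _ ≤ κ * ‖w‖ := empNorm_le hκ hκ0 x J ht htJ w
        _ ≤ κ * (q / √lam) := mul_le_mul_of_nonneg_left hnorm hκ0
        _ = _ := by ring
  have hmain : q ≤ √I * β + min 1 (κ / √lam) * U + √lam * h := by
    refine energy_le_of_eq x J ht hlam.le (heq w) ?_ (by positivity)
    have h1 : l w ≤ √I * β * q := by
      calc l w ≤ β * regNorm S lam w := (le_abs_self _).trans (hl w)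
        _ ≤ β * (√I * q) := mul_le_mul_of_nonneg_left (hiso w) hβ
        _ = _ := by ring
    have h2 : -(t * ∑ j ∈ J, u (x j) * w (x j)) ≤ min 1 (κ / √lam) * U * q := by
      refine (neg_le_abs _).trans ((abs_sum_mul_le_empNorm x J ht u w).trans ?_)
      calc _ ≤ U * (min 1 (κ / √lam) * q) := mul_le_mul hU hmin (empNorm_nonneg _ _ _ _) hU0
        _ = _ := by ring
    have h3 : lam * inner ℝ d w ≤ √lam * h * q := by
      have h4 : inner ℝ d w ≤ h * (q / √lam) :=
        (real_inner_le_norm d w).trans (mul_le_mul hd hnorm (norm_nonneg _) hh)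
      calc lam * inner ℝ d w ≤ lam * (h * (q / √lam)) := mul_le_mul_of_nonneg_left h4 hlam.le
        _ = √lam * √lam * (h * (q / √lam)) := by rw [Real.mul_self_sqrt hlam.le]
        _ = _ := by field_simp
    linarith
  calc ‖S w‖ ≤ regNorm S lam w := norm_map_le_regNorm S hlam.le w
    _ ≤ √I * q := hiso w
    _ ≤ _ := mul_le_mul_of_nonneg_left hmain (Real.sqrt_nonneg _)

/-- The empirical norm of the error `u` of the transferring step on the target sample, when the
target sample makes up at least half of the pool. -/
theorem empNorm_le_of_half {x : τ → X} {J0 J : Finset τ} (h0J : J0 ⊆ J) {lam : ℝ}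
    (hlam : 0 ≤ lam) {t t0 : ℝ} (ht : 0 ≤ t) (ht0 : t0 ≤ 2 * t) (u : H) :
    empNorm x J0 t0 u ≤ 2 * energy x J t lam u := by
  have h1 : empNorm x J0 t0 u ≤ √(2 ^ 2 * (t * ∑ j ∈ J, u (x j) ^ 2 + lam * ‖u‖ ^ 2)) := by
    refine Real.sqrt_le_sqrt ?_
    have h2 : ∑ j ∈ J0, u (x j) ^ 2 ≤ ∑ j ∈ J, u (x j) ^ 2 :=
      Finset.sum_le_sum_of_subset_of_nonneg h0J fun _ _ _ => sq_nonneg _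
    have h3 : 0 ≤ ∑ j ∈ J0, u (x j) ^ 2 := Finset.sum_nonneg fun _ _ => sq_nonneg _
    have h4 := mul_nonneg hlam (sq_nonneg ‖u‖)
    nlinarith [mul_le_mul_of_nonneg_right ht0 h3, mul_le_mul_of_nonneg_left h2 ht,
      mul_nonneg ht (h3.trans h2)]
  rwa [Real.sqrt_mul (by norm_num), Real.sqrt_sq (by norm_num)] at h1

/-- The error `u` of the transferring step on the target sample `J0`, compared with the solution
`u'` of the same problem on the source samples `JA` alone. -/
theorem empNorm_le_of_sources {x : τ → X} {J0 JA : Finset τ} [DecidableEq τ]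
    (hdisj : Disjoint J0 JA)
    {t t0 lam I β0 : ℝ} (htpos : 0 < t) (ht0 : 0 < t0) (hlam : 0 ≤ lam)
    (hβ : 0 ≤ β0) {u u' : H} {lA l0 : H → ℝ}
    (heq : ∀ v, t * ∑ j ∈ J0 ∪ JA, u (x j) * v (x j) + lam * inner ℝ u v = lA v + l0 v)
    (heq' : ∀ v, t * ∑ j ∈ JA, u' (x j) * v (x j) + lam * inner ℝ u' v = lA v)
    (hl0 : ∀ v, |l0 v| ≤ β0 * regNorm S lam v)
    (hiso : ∀ v, regNorm S lam v ≤ √I * energy x (J0 ∪ JA) t lam v) :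
    empNorm x J0 t0 u ≤ √(t0 / t) * (√I * β0) + 2 * empNorm x J0 t0 u' := by
  have ht := htpos.le
  set w := u - u' with hw
  set s := √(t / t0) with hs
  have hs0 : 0 < s := Real.sqrt_pos.2 (div_pos htpos ht0)
  -- the empirical norms on the target sample with the weights `t` and `t0`
  have hscale : ∀ v : H, empNorm x J0 t v = s * empNorm x J0 t0 v := by
    intro v
    rw [hs, empNorm, empNorm, ← Real.sqrt_mul (div_nonneg ht ht0.le)]
    congr 1
    field_simp
  set q := energy x (J0 ∪ JA) t lam w with hq
  have hq0 : 0 ≤ q := energy_nonneg _ _ _ _ _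
  have hwq : empNorm x J0 t w ≤ q :=
    (empNorm_le_energy x J0 hlam w).trans (energy_mono x Finset.subset_union_left ht w)
  have hmain : q ≤ √I * β0 + empNorm x J0 t u' := by
    refine energy_le_of_eq x (J0 ∪ JA) ht hlam
      (l := l0 w - t * ∑ j ∈ J0, u' (x j) * w (x j)) ?_ ?_
      (add_nonneg (by positivity) (empNorm_nonneg _ _ _ _))
    · have h1 := heq w
      have h2 := heq' w
      have h3 : ∑ j ∈ J0 ∪ JA, w (x j) * w (x j) = ∑ j ∈ J0 ∪ JA, u (x j) * w (x j)
          - ∑ j ∈ J0, u' (x j) * w (x j) - ∑ j ∈ JA, u' (x j) * w (x j) := by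
        rw [sub_sub, ← Finset.sum_union hdisj, ← Finset.sum_sub_distrib]
        refine Finset.sum_congr rfl fun j _ => ?_
        simp only [hw, RKHS.coe_sub, Pi.sub_apply]
        ring
      have h4 : inner ℝ w w = inner ℝ u w - inner ℝ u' w := by
        rw [← inner_sub_left]
      rw [h3, h4]
      linarith
    · have h5 : l0 w ≤ √I * β0 * q := by
        calc l0 w ≤ β0 * regNorm S lam w := (le_abs_self _).trans (hl0 w)
          _ ≤ β0 * (√I * q) := mul_le_mul_of_nonneg_left (hiso w) hβ
          _ = _ := by ring
      have h6 : -(t * ∑ j ∈ J0, u' (x j) * w (x j)) ≤ empNorm x J0 t u' * q := by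
        refine (neg_le_abs _).trans ((abs_sum_mul_le_empNorm x J0 ht u' w).trans ?_)
        exact mul_le_mul_of_nonneg_left hwq (empNorm_nonneg _ _ _ _)
      linarith
  have hw0 : empNorm x J0 t0 w ≤ √(t0 / t) * (√I * β0) + empNorm x J0 t0 u' := by
    have h1 : s * empNorm x J0 t0 w ≤ √I * β0 + s * empNorm x J0 t0 u' := by
      rw [← hscale, ← hscale]; exact hwq.trans hmain
    have h2 : √(t0 / t) * s = 1 := by
      rw [hs, ← Real.sqrt_mul (by positivity)]
      have : t0 / t * (t / t0) = 1 := by field_simp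
      rw [this, Real.sqrt_one]
    have h3 := mul_le_mul_of_nonneg_left h1 (Real.sqrt_nonneg (t0 / t))
    calc empNorm x J0 t0 w = √(t0 / t) * s * empNorm x J0 t0 w := by rw [h2, one_mul]
      _ = √(t0 / t) * (s * empNorm x J0 t0 w) := by ring
      _ ≤ _ := h3
      _ = √(t0 / t) * (√I * β0) + √(t0 / t) * s * empNorm x J0 t0 u' := by ring
      _ = _ := by rw [h2, one_mul]
  have hsum : u = w + u' := by rw [hw]; abel
  calc empNorm x J0 t0 u = empNorm x J0 t0 (w + u') := by rw [← hsum]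
    _ ≤ empNorm x J0 t0 w + empNorm x J0 t0 u' := empNorm_add_le x J0 ht0.le w u'
    _ ≤ _ := by linarith

end Deterministic

/-! ### The error of the two-step estimator with high probability -/

section HighProbability

variable {X : Type*} [MeasurableSpace X] {H : Type*} [NormedAddCommGroup H]
  [InnerProductSpace ℝ H] [CompleteSpace H] [RKHS ℝ H X ℝ]
  (hK : Measurable (Function.uncurry (ker H : X → X → ℝ))) {κ : ℝ}
  (hκ : ∀ x : X, Real.sqrt (ker H x x) ≤ κ) (ρ : Measure X) [IsProbabilityMeasure ρ]

/-- The lower isometry for one block of the sample, as a bound by the energy of the pool. -/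
theorem regNorm_le_energy {τ : Type*} {x : τ → X} {K J : Finset τ} (hKJ : K ⊆ J) {t lam M : ℝ}
    (ht : 0 ≤ t) (htK : (K.card : ℝ)⁻¹ ≤ 2 * t) (hlam : 0 < lam) (hM : 1 ≤ M)
    (hiso : ∀ f : H, 1 / 8 * regNorm (incl hK hκ ρ) (M * lam) f ^ 2
      ≤ (K.card : ℝ)⁻¹ * ∑ j ∈ K, f (x j) ^ 2 + M * lam * ‖f‖ ^ 2) (v : H) :
    regNorm (incl hK hκ ρ) lam v ≤ √(16 * M) * energy x J t lam v := by
  have hM0 : 0 < M := by linarith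
  refine abs_le_of_sq_le_sq' ?_ (mul_nonneg (Real.sqrt_nonneg _) (energy_nonneg _ _ _ _ _)) |>.2
  rw [mul_pow, Real.sq_sqrt (by positivity), energy_sq x J ht hlam.le, regNorm_sq _ hlam.le]
  have h1 := hiso v
  rw [regNorm_sq _ (by positivity)] at h1
  have h2 : ∑ j ∈ K, v (x j) ^ 2 ≤ ∑ j ∈ J, v (x j) ^ 2 :=
    Finset.sum_le_sum_of_subset_of_nonneg hKJ fun _ _ _ => sq_nonneg _
  have h3 : 0 ≤ ∑ j ∈ K, v (x j) ^ 2 := Finset.sum_nonneg fun _ _ => sq_nonneg _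
  have h4 : (K.card : ℝ)⁻¹ * ∑ j ∈ K, v (x j) ^ 2 ≤ 2 * t * ∑ j ∈ J, v (x j) ^ 2 :=
    (mul_le_mul_of_nonneg_right htK h3).trans (mul_le_mul_of_nonneg_left h2 (by positivity))
  have h5 : 0 ≤ t * ∑ j ∈ J, v (x j) ^ 2 := mul_nonneg ht (h3.trans h2)
  have h6 : 0 ≤ lam * ‖v‖ ^ 2 := by positivity
  nlinarith [mul_nonneg (sub_nonneg.2 hM) h5, mul_nonneg (sub_nonneg.2 hM) h6]

/-- The deterministic part of the error bound of the two-step estimator. The samples with index in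
`J0` are those of the target model, those with index in `JA` come from the transferable sources,
and `w'` is the solution of the transferring problem on the source samples alone. -/
theorem norm_le_of_forall_abs_le {τ : Type*} [DecidableEq τ] {x : τ → X} {y : τ → ℝ} {f : τ → H}
    (hκ0 : 0 < κ) {J0 JA : Finset τ} (hdisj : Disjoint J0 JA) {f0 c : H} {h : ℝ} (hh : 0 ≤ h)
    (hf0 : ∀ j ∈ J0, f j = f0) (hc : ∑ j ∈ J0 ∪ JA, (f j - c) = 0) (hcf0 : ‖c - f0‖ ≤ h)
    {lam1 lam2 M L N n0 : ℝ} (hlam1 : 0 < lam1) (hlam2 : 0 < lam2) (hM : 1 ≤ M) (hL : 0 < L)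
    (hn0 : n0 = J0.card) (hn0pos : 0 < n0) (hcard : N = n0 + JA.card)
    {E0 EA E2 β1 β0 β2 β3 : ℝ} (hE00 : 0 ≤ E0) (hE20 : 0 ≤ E2)
    (hE0 : E0 ≤ N * β1) (hEA : EA ≤ N * β1)
    (hcβ : ∀ v, |inner ℝ c v| * lam1 ≤ β1 * regNorm (incl hK hκ ρ) lam1 v)
    (hβ0 : √(N / n0) * E0 ≤ N * β0) (hβ2 : E2 ≤ n0 * β2)
    (hβ3 : κ * (√(16 * M) * (2 * β1) / √lam1) * √(L / n0) ≤ β3)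
    (hiso1 : ∀ v, regNorm (incl hK hκ ρ) lam1 v ≤ √(16 * M) * energy x (J0 ∪ JA) N⁻¹ lam1 v)
    (hiso2 : ∀ v, regNorm (incl hK hκ ρ) lam2 v ≤ √(16 * M) * energy x J0 n0⁻¹ lam2 v)
    (hcase : N ≤ 2 * n0 ∨
      ∀ v, regNorm (incl hK hκ ρ) lam1 v ≤ √(16 * M) * energy x JA N⁻¹ lam1 v)
    (h3 : ∀ v, |∑ j ∈ JA, ((y j - c (x j)) * v (x j)
      - inner ℝ (incl hK hκ ρ (f j - c)) (incl hK hκ ρ v))| ≤ EA * regNorm (incl hK hκ ρ) lam1 v)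
    (h4 : ∀ v, |∑ j ∈ J0, ((y j - c (x j)) * v (x j)
      - inner ℝ (incl hK hκ ρ (f j - c)) (incl hK hκ ρ v))| ≤ E0 * regNorm (incl hK hκ ρ) lam1 v)
    (h5 : ∀ v, |∑ j ∈ J0, ((y j - f0 (x j)) * v (x j)
      - inner ℝ (incl hK hκ ρ (f j - f0)) (incl hK hκ ρ v))|
        ≤ E2 * regNorm (incl hK hκ ρ) lam2 v)
    {w' : H} (hw' : ∀ v, N⁻¹ * ∑ j ∈ JA, w' (x j) * v (x j) + lam1 * inner ℝ w' v
      = N⁻¹ * ∑ j ∈ JA, ((y j - c (x j)) * v (x j)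
        - inner ℝ (incl hK hκ ρ (f j - c)) (incl hK hκ ρ v)) - lam1 * inner ℝ c v)
    (h6 : ∑ j ∈ J0, w' (x j) ^ 2
      ≤ 2 * (n0 * ‖incl hK hκ ρ w'‖ ^ 2) + κ ^ 2 * ‖w'‖ ^ 2 * L)
    {fp fde : H} (hfp : ∀ v, N⁻¹ * ∑ j ∈ J0 ∪ JA, (fp (x j) - y j) * v (x j)
      + lam1 * inner ℝ fp v = 0)
    (hfde : ∀ v, n0⁻¹ * ∑ j ∈ J0, (fde (x j) - (y j - fp (x j))) * v (x j)
      + lam2 * inner ℝ fde v = 0) :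
    ‖incl hK hκ ρ (fp + fde - f0)‖ ≤ 48 * M * β1 + √(16 * M) * (√(16 * M) * β2
      + min 1 (κ / √lam2) * (16 * M * (18 * β1 + β0) + 2 * β3) + √lam2 * h) := by
  set S := incl hK hκ ρ with hS
  have hM0 : 0 < M := by linarith only [hM]
  set I := 16 * M with hI
  have hI1 : 1 ≤ I := by linarith only [hM, hI]
  have hsI1 : √I ≤ I := by
    rw [Real.sqrt_le_left (by linarith only [hI1])]; nlinarith only [hI1]
  have hsI0 : 0 ≤ √I := Real.sqrt_nonneg _
  have hsII : √I * √I = I := Real.mul_self_sqrt (by linarith only [hI1])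
  have hN0 : 0 < N := by rw [hcard]; positivity
  set t : ℝ := N⁻¹ with ht
  have htpos : 0 < t := inv_pos.2 hN0
  set ζ : τ → H → ℝ := fun j v => (y j - c (x j)) * v (x j) - inner ℝ (S (f j - c)) (S v) with hζ
  have hβ1pos : 0 ≤ β1 := by
    have : 0 ≤ N * β1 := hE00.trans hE0
    exact nonneg_of_mul_nonneg_right this hN0
  have hβ0pos : 0 ≤ β0 := by
    have : 0 ≤ N * β0 := le_trans (by positivity) hβ0
    exact nonneg_of_mul_nonneg_right this hN0
  have hβ2pos : 0 ≤ β2 := by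
    have : 0 ≤ n0 * β2 := le_trans (by positivity) hβ2
    exact nonneg_of_mul_nonneg_right this hn0pos
  have hβ3pos : 0 ≤ β3 := le_trans (by positivity) hβ3
  -- the right hand sides of the equations of the transferring step
  set lA : H → ℝ := fun v => t * ∑ j ∈ JA, ζ j v - lam1 * inner ℝ c v with hlA
  set l0 : H → ℝ := fun v => t * ∑ j ∈ J0, ζ j v with hl0
  have hblock : ∀ (J : Finset τ) (e : ℝ), e ≤ N * β1 → (∀ v, |∑ j ∈ J, ζ j v|
      ≤ e * regNorm S lam1 v) → ∀ v, |t * ∑ j ∈ J, ζ j v| ≤ β1 * regNorm S lam1 v := by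
    intro J e he hJ v
    rw [abs_mul, abs_of_pos htpos, ht, inv_mul_le_iff₀ hN0, ← mul_assoc]
    exact (hJ v).trans (mul_le_mul_of_nonneg_right he (regNorm_nonneg _ _ _))
  have hl0β : ∀ v, |l0 v| ≤ β1 * regNorm S lam1 v :=
    hblock J0 E0 hE0 h4
  have hlAβ : ∀ v, |lA v| ≤ 2 * β1 * regNorm S lam1 v := by
    intro v
    have e1 := hblock JA EA hEA h3 v
    have e2 := hcβ v
    have e3 : |lam1 * inner ℝ c v| ≤ β1 * regNorm S lam1 v := by
      rw [abs_mul, abs_of_pos hlam1, mul_comm]; exact e2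
    have e4 := abs_sub (t * ∑ j ∈ JA, ζ j v) (lam1 * inner ℝ c v)
    simp only [hlA]
    linarith only [e1, e3, e4]
  set u := fp - c with hu
  have hueq : ∀ v, t * ∑ j ∈ J0 ∪ JA, u (x j) * v (x j) + lam1 * inner ℝ u v = lA v + l0 v := by
    intro v
    have e1 := hfp v
    have e2 : ∑ j ∈ J0 ∪ JA, inner ℝ (S (f j - c)) (S v) = 0 := by
      rw [← sum_inner, ← map_sum, hc, map_zero, inner_zero_left]
    have e3 : ∑ j ∈ J0, ζ j v + ∑ j ∈ JA, ζ j v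
        = ∑ j ∈ J0 ∪ JA, (y j - c (x j)) * v (x j) := by
      rw [← Finset.sum_union hdisj]
      simp only [hζ]
      rw [Finset.sum_sub_distrib, e2, sub_zero]
    have e4 : ∑ j ∈ J0 ∪ JA, u (x j) * v (x j) = ∑ j ∈ J0 ∪ JA, (fp (x j) - y j) * v (x j)
        + ∑ j ∈ J0 ∪ JA, (y j - c (x j)) * v (x j) := by
      rw [← Finset.sum_add_distrib]
      refine Finset.sum_congr rfl fun j _ => ?_
      simp only [hu, RKHS.coe_sub, Pi.sub_apply]
      ring
    have e5 : inner ℝ u v = inner ℝ fp v - inner ℝ c v := inner_sub_left _ _ _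
    rw [e4, ← e3, e5]
    simp only [hlA, hl0]
    linear_combination e1
  have huenergy : energy x (J0 ∪ JA) t lam1 u ≤ √I * (3 * β1) := by
    refine energy_transfer_le htpos.le hlam1.le (by positivity) hueq (fun v => ?_) hiso1
    refine (abs_add_le _ _).trans ?_
    linarith only [hlAβ v, hl0β v]
  have hSu : ‖S u‖ ≤ 3 * I * β1 := by
    calc ‖S u‖ ≤ √I * energy x (J0 ∪ JA) t lam1 u :=
          (norm_map_le_regNorm S hlam1.le u).trans (hiso1 u)
      _ ≤ √I * (√I * (3 * β1)) := mul_le_mul_of_nonneg_left huenergy hsI0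
      _ = √I * √I * (3 * β1) := by ring
      _ = _ := by rw [hsII]; ring
  -- the transferring error on the target sample
  have hU : empNorm x J0 n0⁻¹ u ≤ I * (18 * β1 + β0) + 2 * β3 := by
    have hIβ : √I * β1 ≤ I * β1 := mul_le_mul_of_nonneg_right hsI1 hβ1pos
    have hIβ' : 0 ≤ I * β1 := by positivity
    have hIβ0 : √I * β0 ≤ I * β0 := mul_le_mul_of_nonneg_right hsI1 hβ0pos
    have hIβ0' : 0 ≤ I * β0 := by positivity
    rcases hcase with hcase | hisoA
    · have e1 : n0⁻¹ ≤ 2 * t := by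
        rw [inv_le_iff_one_le_mul₀ hn0pos, ht, mul_assoc, ← mul_inv_cancel₀ hN0.ne', mul_comm N,
          mul_left_comm]
        exact mul_le_mul_of_nonneg_left hcase (inv_nonneg.2 hN0.le)
      have e2 := empNorm_le_of_half (x := x) (J0 := J0) (J := J0 ∪ JA) Finset.subset_union_left
        hlam1.le htpos.le e1 u
      linarith only [e2, huenergy, hIβ, hIβ', hIβ0', hβ3pos]
    · have hwenergy : energy x JA t lam1 w' ≤ √I * (2 * β1) :=
        energy_transfer_le htpos.le hlam1.le (by positivity) hw' hlAβ hisoA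
      have hSw : ‖S w'‖ ≤ 2 * I * β1 := by
        calc ‖S w'‖ ≤ √I * energy x JA t lam1 w' :=
              (norm_map_le_regNorm S hlam1.le w').trans (hisoA w')
          _ ≤ √I * (√I * (2 * β1)) := mul_le_mul_of_nonneg_left hwenergy hsI0
          _ = √I * √I * (2 * β1) := by ring
          _ = _ := by rw [hsII]; ring
      have hsl : 0 < √lam1 := Real.sqrt_pos.2 hlam1
      have hwn : ‖w'‖ ≤ √I * (2 * β1) / √lam1 := by
        rw [le_div_iff₀ hsl, mul_comm]
        exact (sqrt_mul_norm_le_energy x JA htpos.le w').trans hwenergy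
      have hwemp : empNorm x J0 n0⁻¹ w' ≤ 4 * I * β1 + β3 := by
        have e1 : κ * ‖w'‖ * √(L / n0) ≤ β3 := by
          refine le_trans ?_ hβ3
          gcongr
        refine Real.sqrt_le_iff.2 ⟨by positivity, ?_⟩
        have e2 : n0⁻¹ * ∑ j ∈ J0, w' (x j) ^ 2
            ≤ 2 * ‖S w'‖ ^ 2 + (κ * ‖w'‖ * √(L / n0)) ^ 2 := by
          rw [inv_mul_le_iff₀ hn0pos]
          refine h6.trans (le_of_eq ?_)
          rw [mul_pow, Real.sq_sqrt (by positivity)]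
          field_simp
        have e3 : (κ * ‖w'‖ * √(L / n0)) ^ 2 ≤ β3 ^ 2 :=
          pow_le_pow_left₀ (by positivity) e1 2
        have e4 : ‖S w'‖ ^ 2 ≤ (2 * I * β1) ^ 2 := pow_le_pow_left₀ (norm_nonneg _) hSw 2
        nlinarith only [mul_nonneg hIβ' hβ3pos, e2, e3, e4]
      have e5 := empNorm_le_of_sources (t0 := n0⁻¹) (S := S) (I := I)
        (β0 := t * E0)
        hdisj htpos (inv_pos.2 hn0pos) hlam1.le (by positivity) hueq hw' (fun v => ?_) hiso1
      · have e6 : √(n0⁻¹ / t) * (√I * (t * E0)) ≤ √I * β0 := by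
          have e7 : n0⁻¹ / t = N / n0 := by rw [ht]; field_simp
          rw [e7]
          calc _ = √I * (t * (√(N / n0) * E0)) := by ring
            _ ≤ √I * (t * (N * β0)) := by gcongr
            _ = √I * β0 := by rw [ht]; field_simp
        linarith only [e5, e6, hwemp, hIβ0, hIβ']
      · simp only [hl0]
        rw [abs_mul, abs_of_pos htpos, mul_assoc]
        exact mul_le_mul_of_nonneg_left (h4 v) htpos.le
  -- the debiasing step
  have hmain := norm_map_sub_le (S := S) (I := I) (U := I * (18 * β1 + β0) + 2 * β3) hκ hκ0.le
    (x := x) (J := J0) (t := n0⁻¹)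
    (β := β2) (h := h) (e := fp + fde - f0) (u := u) (d := c - f0)
    (l := fun v => n0⁻¹ * ∑ j ∈ J0, (y j - f0 (x j)) * v (x j))
    (inv_nonneg.2 hn0pos.le) (by rw [← hn0, inv_mul_cancel₀ hn0pos.ne']) hlam2 hβ2pos hh
    (fun v => ?_) (fun v => ?_) hcf0 hU hiso2
  · have e1 : fp + fde - f0 = (fp + fde - f0 - u) + u := by abel
    calc _ ≤ ‖S (fp + fde - f0 - u)‖ + ‖S u‖ := by
          rw [e1, map_add, ← e1]; exact norm_add_le _ _
      _ ≤ _ := by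
          have e2 : 48 * M * β1 = 3 * I * β1 := by rw [hI]; ring
          rw [e2]
          linarith only [hmain, hSu]
  · have e1 := hfde v
    have e2 : ∑ j ∈ J0, (fp + fde - f0 - u) (x j) * v (x j)
        = ∑ j ∈ J0, (fde (x j) - (y j - fp (x j))) * v (x j)
          + ∑ j ∈ J0, (y j - f0 (x j)) * v (x j) - ∑ j ∈ J0, u (x j) * v (x j) := by
      rw [← Finset.sum_add_distrib, ← Finset.sum_sub_distrib]
      refine Finset.sum_congr rfl fun j _ => ?_
      simp only [RKHS.coe_sub, RKHS.coe_add, Pi.sub_apply, Pi.add_apply]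
      ring
    have e3 : fp + fde - f0 - u = fde + (c - f0) := by rw [hu]; abel
    have e4 : inner ℝ (fp + fde - f0 - u) v = inner ℝ fde v + inner ℝ (c - f0) v := by
      rw [e3, inner_add_left]
    rw [e2, e4]
    linear_combination e1
  · have e1 := h5 v
    have e2 : ∑ j ∈ J0, ((y j - f0 (x j)) * v (x j) - inner ℝ (S (f j - f0)) (S v))
        = ∑ j ∈ J0, (y j - f0 (x j)) * v (x j) := by
      refine Finset.sum_congr rfl fun j hj => ?_
      rw [hf0 j hj, sub_self, map_zero, inner_zero_left, sub_zero]
    rw [e2] at e1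
    rw [abs_mul, abs_of_pos (inv_pos.2 hn0pos), inv_mul_le_iff₀ hn0pos, ← mul_assoc]
    exact e1.trans (mul_le_mul_of_nonneg_right hβ2 (regNorm_nonneg _ _ _))

variable {Ω : Type*} [MeasurableSpace Ω] {P : Measure Ω} [IsProbabilityMeasure P]

/-- The error bound of the two-step estimator in terms of bounds `β1`, `β0`, `β2`, `β3` for the
single error terms. The samples with index in `J0` are those of the target model, and those with
index in `JA` come from the transferable sources. -/
theorem measure_exists_lt_norm_le [TopologicalSpace.SeparableSpace H] {τ : Type*} [DecidableEq τ]
    {Z : τ → Ω → X × ℝ} (hZ : ∀ j, Measurable (Z j)) (hindep : iIndepFun Z P)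
    {η : τ → Kernel X ℝ} [∀ j, IsMarkovKernel (η j)] {f : τ → H}
    (hlaw : ∀ j, P.map (Z j) = ρ.compProd (η j))
    (hreg : ∀ j, IsRegression ρ (η j) (f j)) {B γ : ℝ} (hB : 0 < B) (hγ : 0 < γ)
    (hnoise : ∀ j, SubExpNoise ρ (η j) (f j) B γ) (hκ0 : 0 < κ)
    {J0 JA : Finset τ} (hdisj : Disjoint J0 JA) (hJ0 : J0.Nonempty) {f0 c : H} {h : ℝ} (hh : 0 ≤ h)
    (hf0 : ∀ j ∈ J0, f j = f0) (hc : ∑ j ∈ J0 ∪ JA, (f j - c) = 0) (hcf0 : ‖c - f0‖ ≤ h)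
    {b : ℝ} (hb0 : 0 ≤ b) (hb : ∀ j, ∀ x, |(f j - c) x| ≤ b)
    {lam1 lam2 M : ℝ} (hlam1 : 0 < lam1) (hlam2 : 0 < lam2) (hM : 1 ≤ M) {D1 D2 : ℝ}
    (hD1 : ∫⁻ x, ENNReal.ofReal (resForm (incl hK hκ ρ) lam1 (point H x) (point H x)) ∂ρ
      ≤ ENNReal.ofReal D1) (hD10 : 0 ≤ D1)
    (hD2 : ∫⁻ x, ENNReal.ofReal (resForm (incl hK hκ ρ) lam2 (point H x) (point H x)) ∂ρ
      ≤ ENNReal.ofReal D2) (hD20 : 0 ≤ D2) {L : ℝ} (hL : 0 < L)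
    {N : ℝ} (hN : N = (J0 ∪ JA).card) {p1 p2 : ℕ} (hp1 : 2 ≤ p1) (hp2 : 2 ≤ p2)
    (hpN : 8 * (p1 * (κ ^ 2 / (M * lam1))) ≤ N) (hp0 : 4 * (p2 * (κ ^ 2 / (M * lam2))) ≤ J0.card)
    (hNL : N * Real.exp (-p1) ≤ Real.exp (-L)) (h0L : J0.card * Real.exp (-p2) ≤ Real.exp (-L))
    {β1 β0 β2 β3 : ℝ}
    (hβ1 : (B + γ + b) * (6 * κ * L / √lam1 + 5 * √(N * D1 * L)) ≤ N * β1)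
    (hcβ : ∀ v, |inner ℝ c v| * lam1 ≤ β1 * regNorm (incl hK hκ ρ) lam1 v)
    (hβ0 : √(N / J0.card) * ((B + γ + b) * (6 * κ * L / √lam1 + 5 * √(J0.card * D1 * L)))
      ≤ N * β0)
    (hβ2 : (B + γ + b) * (6 * κ * L / √lam2 + 5 * √(J0.card * D2 * L)) ≤ J0.card * β2)
    (hβ3 : κ * (√(16 * M) * (2 * β1) / √lam1) * √(L / J0.card) ≤ β3) :
    P {ω | ∃ fp fde : H,
        (∀ v, N⁻¹ * ∑ j ∈ J0 ∪ JA, (fp (Z j ω).1 - (Z j ω).2) * v (Z j ω).1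
          + lam1 * inner ℝ fp v = 0) ∧
        (∀ v, (J0.card : ℝ)⁻¹ * ∑ j ∈ J0, (fde (Z j ω).1 - ((Z j ω).2 - fp (Z j ω).1)) * v (Z j ω).1
          + lam2 * inner ℝ fde v = 0) ∧
        48 * M * β1 + √(16 * M) * (√(16 * M) * β2
          + min 1 (κ / √lam2) * (16 * M * (18 * β1 + β0) + 2 * β3) + √lam2 * h)
          < ‖incl hK hκ ρ (fp + fde - f0)‖}
      ≤ ENNReal.ofReal (9 * Real.exp (-L)) := by
  let _ : MeasurableSpace H := borel H
  have : BorelSpace H := ⟨rfl⟩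
  set S := incl hK hκ ρ with hS
  have hM0 : 0 < M := by linarith
  set n0 : ℝ := (J0.card : ℝ) with hn0
  have hn0pos : 0 < n0 := by rw [hn0]; exact_mod_cast hJ0.card_pos
  have hcard : N = n0 + JA.card := by
    rw [hN, Finset.card_union_of_disjoint hdisj]; push_cast; rfl
  have hN0 : 0 < N := by rw [hcard]; positivity
  set t : ℝ := N⁻¹ with ht
  have htpos : 0 < t := inv_pos.2 hN0
  -- the block that makes up at least half of the pool
  obtain ⟨K, hKJ, hKhalf, hKcase⟩ : ∃ K ⊆ J0 ∪ JA, N ≤ 2 * K.card ∧ (K = J0 ∨ K = JA) := by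
    rcases le_total N (2 * n0) with h2 | h2
    · exact ⟨J0, Finset.subset_union_left, h2, Or.inl rfl⟩
    · exact ⟨JA, Finset.subset_union_right, by linarith, Or.inr rfl⟩
  have hKpos : (0 : ℝ) < K.card := by linarith
  have hKne : K.Nonempty := Finset.card_pos.1 (by exact_mod_cast hKpos)
  have hKN : (K.card : ℝ) ≤ N := by
    rw [hN]; exact_mod_cast Finset.card_le_card hKJ
  have hlawX : ∀ j, P.map (fun ω => (Z j ω).1) = ρ := by
    intro j
    have : (fun ω => (Z j ω).1) = Prod.fst ∘ Z j := rfl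
    rw [this, ← Measure.map_map measurable_fst (hZ j), hlaw j]
    exact Measure.fst_compProd ρ (η j)
  have hZX : ∀ j, Measurable fun ω => (Z j ω).1 := fun j => measurable_fst.comp (hZ j)
  have hindepX : iIndepFun (fun j ω => (Z j ω).1) P :=
    hindep.comp (fun _ => Prod.fst) fun _ => measurable_fst
  -- the solution of the problem on the source samples
  have hbm : Measurable fun z : JA → X × ℝ =>
      t • ∑ i : JA, residual hK hκ ρ (f i) c (z i) - lam1 • c := by
    refine Measurable.sub_const ?_ _
    have hsum : Measurable fun z : JA → X × ℝ => ∑ i : JA, residual hK hκ ρ (f i) c (z i) :=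
      Finset.measurable_sum _ fun i _ =>
        (measurable_residual hK hκ ρ (f i) c).comp (measurable_pi_apply i)
    exact hsum.const_smul t
  obtain ⟨u', hu'm, hu'eq⟩ := exists_measurable_solution (α := JA → X × ℝ) (ι := JA)
    (p := fun i z => point H (z i).1)
    (fun i => (measurable_point hK).comp (measurable_fst.comp (measurable_pi_apply i)))
    hbm Finset.univ htpos.le hlam1
  -- the six exceptional events
  set A1 : Set Ω := {ω | ∃ v : H, (K.card : ℝ)⁻¹ * ∑ j ∈ K, v (Z j ω).1 ^ 2 + M * lam1 * ‖v‖ ^ 2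
    < 1 / 8 * regNorm S (M * lam1) v ^ 2} with hA1
  set A2 : Set Ω := {ω | ∃ v : H, (J0.card : ℝ)⁻¹ * ∑ j ∈ J0, v (Z j ω).1 ^ 2
    + M * lam2 * ‖v‖ ^ 2 < 1 / 8 * regNorm S (M * lam2) v ^ 2} with hA2
  set A3 : Set Ω := {ω | ∃ v : H, (B + γ + b) * (6 * κ * L / √lam1 + 5 * √(JA.card * D1 * L))
    * regNorm S lam1 v < |∑ j ∈ JA, (((Z j ω).2 - c (Z j ω).1) * v (Z j ω).1
      - inner ℝ (S (f j - c)) (S v))|} with hA3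
  set A4 : Set Ω := {ω | ∃ v : H, (B + γ + b) * (6 * κ * L / √lam1 + 5 * √(J0.card * D1 * L))
    * regNorm S lam1 v < |∑ j ∈ J0, (((Z j ω).2 - c (Z j ω).1) * v (Z j ω).1
      - inner ℝ (S (f j - c)) (S v))|} with hA4
  set A5 : Set Ω := {ω | ∃ v : H, (B + γ + b) * (6 * κ * L / √lam2 + 5 * √(J0.card * D2 * L))
    * regNorm S lam2 v < |∑ j ∈ J0, (((Z j ω).2 - f0 (Z j ω).1) * v (Z j ω).1
      - inner ℝ (S (f j - f0)) (S v))|} with hA5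
  set A6 : Set Ω := {ω | 2 * (J0.card * ‖S (u' fun i => Z i ω)‖ ^ 2)
    + κ ^ 2 * ‖u' fun i => Z i ω‖ ^ 2 * L < ∑ j ∈ J0, (u' fun i => Z i ω) (Z j ω).1 ^ 2} with hA6
  have hP1 : P A1 ≤ ENNReal.ofReal (Real.exp (-L)) := by
    refine (measure_exists_regNorm_lt_le hK hκ ρ hZX hindepX hKne (fun j _ => hlawX j)
      (by positivity) hp1 (by linarith)).trans (ENNReal.ofReal_le_ofReal ?_)
    exact (mul_le_mul_of_nonneg_right hKN (Real.exp_pos _).le).trans hNL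
  have hP2 : P A2 ≤ ENNReal.ofReal (Real.exp (-L)) :=
    (measure_exists_regNorm_lt_le hK hκ ρ hZX hindepX hJ0 (fun j _ => hlawX j)
      (by positivity) hp2 hp0).trans (ENNReal.ofReal_le_ofReal h0L)
  have hP3 : P A3 ≤ ENNReal.ofReal (2 * Real.exp (-L)) :=
    measure_exists_lt_abs_sum_residual_le hK hκ ρ hZ hindep JA (fun j _ => hlaw j) hreg hB hγ
      hnoise hκ0 hb0 (fun j _ => hb j) hlam1 hD1 hD10 hL
  have hP4 : P A4 ≤ ENNReal.ofReal (2 * Real.exp (-L)) :=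
    measure_exists_lt_abs_sum_residual_le hK hκ ρ hZ hindep J0 (fun j _ => hlaw j) hreg hB hγ
      hnoise hκ0 hb0 (fun j _ => hb j) hlam1 hD1 hD10 hL
  have hP5 : P A5 ≤ ENNReal.ofReal (2 * Real.exp (-L)) :=
    measure_exists_lt_abs_sum_residual_le hK hκ ρ hZ hindep J0 (fun j _ => hlaw j) hreg hB hγ
      hnoise hκ0 hb0 (fun j hj x => by rw [hf0 j hj, sub_self, ← inner_point]; simpa using hb0)
      hlam2 hD2 hD20 hL
  have hP6 : P A6 ≤ ENNReal.ofReal (Real.exp (-L)) :=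
    measure_sum_sq_gt_le_of_indep hK hκ ρ hκ0 hZ hindep hdisj.symm (fun j _ => hlawX j) L hu'm
  have hunion : P (A1 ∪ A2 ∪ A3 ∪ A4 ∪ A5 ∪ A6) ≤ ENNReal.ofReal (9 * Real.exp (-L)) := by
    have he := (Real.exp_pos (-L)).le
    calc _ ≤ P A1 + P A2 + P A3 + P A4 + P A5 + P A6 := by
          refine (measure_union_le _ _).trans (add_le_add_left ?_ _)
          refine (measure_union_le _ _).trans (add_le_add_left ?_ _)
          refine (measure_union_le _ _).trans (add_le_add_left ?_ _)
          refine (measure_union_le _ _).trans (add_le_add_left ?_ _)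
          exact measure_union_le _ _
      _ ≤ ENNReal.ofReal (Real.exp (-L)) + ENNReal.ofReal (Real.exp (-L))
          + ENNReal.ofReal (2 * Real.exp (-L)) + ENNReal.ofReal (2 * Real.exp (-L))
          + ENNReal.ofReal (2 * Real.exp (-L)) + ENNReal.ofReal (Real.exp (-L)) := by gcongr
      _ = _ := by
          rw [← ENNReal.ofReal_add he he, ← ENNReal.ofReal_add (by positivity) (by positivity),
            ← ENNReal.ofReal_add (by positivity) (by positivity),
            ← ENNReal.ofReal_add (by positivity) (by positivity),
            ← ENNReal.ofReal_add (by positivity) (by positivity)]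
          congr 1
          ring
  refine (measure_mono ?_).trans hunion
  intro ω hω
  by_contra hgood
  obtain ⟨fp, fde, hfp, hfde, hlt⟩ := hω
  refine absurd hlt (not_lt.2 ?_)
  simp only [Set.mem_union, not_or] at hgood
  obtain ⟨⟨⟨⟨⟨h1, h2⟩, h3⟩, h4⟩, h5⟩, h6⟩ := hgood
  simp only [hA1, hA2, hA3, hA4, hA5, hA6, Set.mem_ofPred_eq, not_exists, not_lt]
    at h1 h2 h3 h4 h5 h6
  set x : τ → X := fun j => (Z j ω).1 with hx
  set y : τ → ℝ := fun j => (Z j ω).2 with hy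
  have hhalf : ∀ k : ℝ, 0 < k → N ≤ 2 * k → k⁻¹ ≤ 2 * t := by
    intro k hk hNk
    rw [inv_le_iff_one_le_mul₀ hk, ht, mul_assoc, ← mul_inv_cancel₀ hN0.ne', mul_comm N,
      mul_left_comm]
    exact mul_le_mul_of_nonneg_left hNk (inv_nonneg.2 hN0.le)
  have hn0N : n0 ≤ N := by rw [hcard]; linarith only [Nat.cast_nonneg (α := ℝ) JA.card]
  have hnAN : (JA.card : ℝ) ≤ N := by rw [hcard]; linarith only [hn0pos]
  have hE : ∀ k : ℝ, k ≤ N → (B + γ + b) * (6 * κ * L / √lam1 + 5 * √(k * D1 * L)) ≤ N * β1 := by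
    intro k hk
    refine le_trans ?_ hβ1
    gcongr
  refine norm_le_of_forall_abs_le hK hκ ρ (x := x) (y := y) (w' := u' fun i => Z i ω) hκ0 hdisj hh
    hf0 hc hcf0 hlam1 hlam2 hM hL hn0 hn0pos hcard (by positivity) (by positivity)
    (hE n0 hn0N) (hE _ hnAN) hcβ hβ0 hβ2 hβ3
    (regNorm_le_energy hK hκ ρ hKJ htpos.le (hhalf _ hKpos hKhalf) hlam1 hM h1)
    (regNorm_le_energy hK hκ ρ subset_rfl (inv_nonneg.2 hn0pos.le)
      (by linarith only [inv_nonneg.2 hn0pos.le]) hlam2 hM h2) ?_ h3 h4 h5 (fun v => ?_) h6 hfp hfde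
  · rcases hKcase with rfl | rfl
    · exact Or.inl hKhalf
    · exact Or.inr
        (regNorm_le_energy hK hκ ρ subset_rfl htpos.le (hhalf _ hKpos hKhalf) hlam1 hM h1)
  · have e1 := hu'eq (fun i => Z i ω) v
    simp only [inner_point, inner_sub_left, real_inner_smul_left, sum_inner] at e1
    have e2 : ∀ i : JA, inner ℝ (residual hK hκ ρ (f i) c (Z i ω)) v
        = (y i - c (x i)) * v (x i) - inner ℝ (S (f i - c)) (S v) := fun i =>
      (real_inner_comm _ _).trans (inner_residual hK hκ ρ (f i) c v (Z i ω))
    simp only [e2] at e1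
    rw [Finset.sum_coe_sort JA fun j => (y j - c (x j)) * v (x j) - inner ℝ (S (f j - c)) (S v),
      Finset.sum_coe_sort JA fun j => (u' fun i => Z i ω) (x j) * v (x j)] at e1
    exact e1

end HighProbability

/-! ### Rates of convergence -/

section Rates

theorem log_twelve_div_ge {δ : ℝ} (hδ0 : 0 < δ) (hδ1 : δ < 1) : 2 ≤ Real.log (12 / δ) := by
  rw [Real.le_log_iff_exp_le (by positivity)]
  have h1 : Real.exp 2 = Real.exp 1 ^ 2 := by rw [← Real.exp_nat_mul]; norm_num
  have h2 := Real.exp_one_lt_three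
  have h3 := Real.exp_pos 1
  have h4 : (12 : ℝ) ≤ 12 / δ := by rw [le_div_iff₀ hδ0]; linarith
  rw [h1]
  nlinarith

theorem log_ge_half {n : ℝ} (hn : 2 ≤ n) : 1 / 2 ≤ Real.log n := by
  have h1 : Real.log 2 ≤ Real.log n := Real.log_le_log (by norm_num) hn
  linarith [Real.log_two_gt_d9]

/-- The choice of the exponent `p` in the lower isometry. -/
theorem exists_nat_mul_exp_le {n L : ℝ} (hn : 2 ≤ n) (hL : 2 ≤ L) :
    ∃ p : ℕ, 2 ≤ p ∧ n * Real.exp (-p) ≤ Real.exp (-L) ∧ (p : ℝ) ≤ L + Real.log n + 1 := by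
  have hlog := log_ge_half hn
  refine ⟨⌈L + Real.log n⌉₊, ?_, ?_, (Nat.ceil_lt_add_one (by linarith)).le⟩
  · have h1 : (2 : ℝ) ≤ (⌈L + Real.log n⌉₊ : ℝ) := le_trans (by linarith) (Nat.le_ceil _)
    exact_mod_cast h1
  · calc n * Real.exp (-(⌈L + Real.log n⌉₊ : ℝ)) ≤ n * Real.exp (-(L + Real.log n)) := by
          have := Nat.le_ceil (L + Real.log n)
          gcongr
      _ = Real.exp (-L) := by
          rw [neg_add, Real.exp_add, Real.exp_neg (Real.log n), Real.exp_log (by linarith)]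
          field_simp

/-- The condition on the confidence level bounds `log (12 / δ)`. -/
theorem log_le_of_mul_exp_le {C0 x y δ : ℝ} (hC0 : 12 ≤ C0) (hδ : 0 < δ)
    (h : C0 * Real.exp (-(min x y)) ≤ δ) : Real.log (12 / δ) ≤ x ∧ Real.log (12 / δ) ≤ y := by
  have h1 : Real.log (12 / δ) ≤ min x y := by
    rw [Real.log_le_iff_le_exp (by positivity), div_le_iff₀ hδ]
    calc (12 : ℝ) ≤ C0 := hC0
      _ = Real.exp (min x y) * (C0 * Real.exp (-(min x y))) := by
          rw [Real.exp_neg]; field_simp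
      _ ≤ Real.exp (min x y) * δ := mul_le_mul_of_nonneg_left h (Real.exp_pos _).le
  exact ⟨h1.trans (min_le_left _ _), h1.trans (min_le_right _ _)⟩

/-- The regularization parameter of the transferring step, compared with the rate
`N ^ (-r / (2 r + α))`. -/
theorem transfer_rates {r α cl cu N lam L : ℝ} (hr : r ∈ Set.Icc (1 / 2 : ℝ) 1) (hα : 0 < α)
    (hcl : 0 < cl) (hN : 2 ≤ N) (hL : 2 ≤ L)
    (hlam : lam ∈ Set.Icc (cl * N ^ (-(1 / (2 * r + α)))) (cu * N ^ (-(1 / (2 * r + α)))))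
    (hNL : L ≤ N ^ ((2 * r + α - 1) / (2 * (2 * r + α))) * Real.log N ^ (-(1 / 2) : ℝ)) :
    1 / N ≤ (N ^ (-(r / (2 * r + α)))) ^ 2 ∧
    lam ^ (-α) / N ≤ cl ^ (-α) * (N ^ (-(r / (2 * r + α)))) ^ 2 ∧
    lam ^ r ≤ cu ^ r * N ^ (-(r / (2 * r + α))) ∧
    cl * (N ^ (-(r / (2 * r + α)))) ^ 2 ≤ lam ∧
    cl * (L ^ 2 * Real.log N) ≤ N * lam := by
  obtain ⟨hr1, hr2⟩ := hr
  set θ := 2 * r + α with hθ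
  have hθ1 : 1 < θ := by linarith
  have hN0 : 0 < N := by linarith
  have hN1 : 1 ≤ N := by linarith
  have hlog := log_ge_half hN
  have hl0 : 0 < cl * N ^ (-(1 / θ)) := by positivity
  have hlam0 : 0 < lam := hl0.trans_le hlam.1
  have hsq : (N ^ (-(r / θ))) ^ 2 = N ^ (-(2 * r / θ)) := by
    rw [← Real.rpow_natCast, ← Real.rpow_mul hN0.le]
    congr 1
    push_cast
    ring
  refine ⟨?_, ?_, ?_, ?_, ?_⟩
  · rw [hsq, one_div, ← Real.rpow_neg_one]
    refine Real.rpow_le_rpow_of_exponent_le hN1 (neg_le_neg ?_)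
    rw [div_le_one (by linarith)]
    linarith
  · have h1 : lam ^ (-α) ≤ (cl * N ^ (-(1 / θ))) ^ (-α) :=
      Real.rpow_le_rpow_of_nonpos hl0 hlam.1 (by linarith)
    rw [Real.mul_rpow hcl.le (by positivity), ← Real.rpow_mul hN0.le] at h1
    calc lam ^ (-α) / N ≤ cl ^ (-α) * N ^ (-(1 / θ) * -α) / N := by gcongr
      _ = cl ^ (-α) * (N ^ (-(1 / θ) * -α) * N ^ (-1 : ℝ)) := by
          rw [Real.rpow_neg_one]; ring
      _ = _ := by
          rw [← Real.rpow_add hN0, hsq]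
          congr 2
          field_simp
          rw [hθ]; ring
  · calc lam ^ r ≤ (cu * N ^ (-(1 / θ))) ^ r :=
          Real.rpow_le_rpow hlam0.le hlam.2 (by linarith)
      _ = cu ^ r * N ^ (-(r / θ)) := by
          have hcu : 0 ≤ cu := by
            have h2 : 0 < cu * N ^ (-(1 / θ)) := hlam0.trans_le hlam.2
            exact (pos_of_mul_pos_left h2 (by positivity)).le
          rw [Real.mul_rpow hcu (by positivity), ← Real.rpow_mul hN0.le]
          congr 2
          ring
  · rw [hsq]
    refine le_trans (mul_le_mul_of_nonneg_left ?_ hcl.le) hlam.1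
    refine Real.rpow_le_rpow_of_exponent_le hN1 (neg_le_neg ?_)
    exact div_le_div_of_nonneg_right (by linarith) (by linarith)
  · have h1 : L ^ 2 ≤ (N ^ ((θ - 1) / (2 * θ)) * Real.log N ^ (-(1 / 2) : ℝ)) ^ 2 :=
      pow_le_pow_left₀ (by linarith) hNL 2
    have h2 : (N ^ ((θ - 1) / (2 * θ)) * Real.log N ^ (-(1 / 2) : ℝ)) ^ 2 * Real.log N
        = N ^ ((θ - 1) / θ) := by
      rw [mul_pow, ← Real.rpow_natCast, ← Real.rpow_natCast, ← Real.rpow_mul hN0.le,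
        ← Real.rpow_mul (by linarith)]
      have e1 : -(1 / 2) * ((2 : ℕ) : ℝ) = -1 := by push_cast; ring
      have e2 : (θ - 1) / (2 * θ) * ((2 : ℕ) : ℝ) = (θ - 1) / θ := by push_cast; field_simp
      rw [e1, e2, Real.rpow_neg_one, mul_assoc, inv_mul_cancel₀ (by linarith), mul_one]
    have h3 : N * N ^ (-(1 / θ)) = N ^ ((θ - 1) / θ) := by
      nth_rewrite 1 [← Real.rpow_one N]
      rw [← Real.rpow_add hN0]
      congr 1
      field_simp
      ring
    calc cl * (L ^ 2 * Real.log N) ≤ cl * N ^ ((θ - 1) / θ) := by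
          rw [← h2]
          have : 0 ≤ Real.log N := by linarith
          gcongr
      _ = N * (cl * N ^ (-(1 / θ))) := by rw [← h3]; ring
      _ ≤ N * lam := mul_le_mul_of_nonneg_left hlam.1 hN0.le

/-- The regularization parameter of the debiasing step, compared with the rate
`h ^ (α / (1 + α)) n ^ (-1 / (2 α + 2))`. -/
theorem debias_rates {α cl cu n h lam L : ℝ} (hα : α ∈ Set.Ioc (0 : ℝ) 1)
    (hcl : 0 < cl) (hn : 2 ≤ n) (hh : 0 < h)
    (hlam : lam ∈ Set.Icc (cl * (h ^ (-(2 / (1 + α))) * n ^ (-(1 / (1 + α)))))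
      (cu * (h ^ (-(2 / (1 + α))) * n ^ (-(1 / (1 + α))))))
    (hnL : L ≤ h ^ (-(2 / (1 + α))) * (n ^ (α / (2 + 2 * α)) * Real.log n ^ (-(1 / 2) : ℝ))) :
    lam * h ^ 2 ≤ cu * (h ^ (α / (1 + α)) * n ^ (-(1 / (2 * α + 2)))) ^ 2 ∧
    lam ^ (-α) / n ≤ cl ^ (-α) * (h ^ (α / (1 + α)) * n ^ (-(1 / (2 * α + 2)))) ^ 2 ∧
    cl * (L * n ^ (α / (2 + 2 * α)) * √(Real.log n)) ≤ n * lam := by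
  obtain ⟨hα0, hα1⟩ := hα
  have hn0 : 0 < n := by linarith
  have hlog := log_ge_half hn
  have hlog0 : 0 < Real.log n := by linarith
  have hα' : 1 + α ≠ 0 := by positivity
  set q := h ^ (-(2 / (1 + α))) * n ^ (-(1 / (1 + α))) with hq
  have hq0 : 0 < q := by positivity
  have hlam0 : 0 < lam := (mul_pos hcl hq0).trans_le hlam.1
  have hs2 : (h ^ (α / (1 + α)) * n ^ (-(1 / (2 * α + 2)))) ^ 2
      = h ^ (2 * α / (1 + α)) * n ^ (-(1 / (1 + α))) := by
    rw [mul_pow, ← Real.rpow_natCast, ← Real.rpow_natCast, ← Real.rpow_mul hh.le,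
      ← Real.rpow_mul hn0.le]
    congr 2
    · push_cast; ring
    · push_cast; field_simp; ring
  refine ⟨?_, ?_, ?_⟩
  · have h1 : q * h ^ 2 = h ^ (2 * α / (1 + α)) * n ^ (-(1 / (1 + α))) := by
      have : h ^ (-(2 / (1 + α))) * h ^ 2 = h ^ (2 * α / (1 + α)) := by
        rw [← Real.rpow_natCast h 2, ← Real.rpow_add hh]
        congr 1
        push_cast
        field_simp
        ring
      rw [hq, ← this]; ring
    calc lam * h ^ 2 ≤ cu * q * h ^ 2 := by gcongr; exact hlam.2
      _ = _ := by rw [hs2, ← h1]; ring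
  · have h1 : lam ^ (-α) ≤ (cl * q) ^ (-α) :=
      Real.rpow_le_rpow_of_nonpos (mul_pos hcl hq0) hlam.1 (by linarith)
    have h2 : q ^ (-α) / n = h ^ (2 * α / (1 + α)) * n ^ (-(1 / (1 + α))) := by
      rw [hq, Real.mul_rpow (by positivity) (by positivity), ← Real.rpow_mul hh.le,
        ← Real.rpow_mul hn0.le, mul_div_assoc]
      congr 1
      · congr 1; field_simp
      · rw [div_eq_mul_inv, ← Real.rpow_neg_one n, ← Real.rpow_add hn0]
        congr 1
        field_simp
        ring
    rw [Real.mul_rpow hcl.le hq0.le] at h1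
    calc lam ^ (-α) / n ≤ cl ^ (-α) * q ^ (-α) / n := by gcongr
      _ = cl ^ (-α) * (q ^ (-α) / n) := by ring
      _ = _ := by rw [h2, hs2]
  · set a := α / (2 + 2 * α) with ha
    have h1 : n * q = h ^ (-(2 / (1 + α))) * (n ^ a * Real.log n ^ (-(1 / 2) : ℝ))
        * n ^ a * √(Real.log n) := by
      have e1 : Real.log n ^ (-(1 / 2) : ℝ) * √(Real.log n) = 1 := by
        rw [Real.sqrt_eq_rpow, ← Real.rpow_add hlog0]
        norm_num
      have e2 : n ^ a * n ^ a = n * n ^ (-(1 / (1 + α))) := by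
        nth_rewrite 3 [← Real.rpow_one n]
        rw [← Real.rpow_add hn0, ← Real.rpow_add hn0]
        congr 1
        rw [ha]
        field_simp
        ring
      calc n * q = h ^ (-(2 / (1 + α))) * (n * n ^ (-(1 / (1 + α)))) := by rw [hq]; ring
        _ = h ^ (-(2 / (1 + α))) * (n ^ a * n ^ a)
            * (Real.log n ^ (-(1 / 2) : ℝ) * √(Real.log n)) := by rw [e1, e2, mul_one]
        _ = _ := by ring
    calc cl * (L * n ^ a * √(Real.log n)) ≤ cl * (n * q) := by
          rw [h1]
          gcongr
      _ = n * (cl * q) := by ring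
      _ ≤ n * lam := mul_le_mul_of_nonneg_left hlam.1 hn0.le

/-- The lower isometry of the transferring step applies with a regularization of order `lam`. -/
theorem transfer_isometry_condition {κ cl N lam L M : ℝ} {p : ℕ} (hcl : 0 < cl)
    (hN : 2 ≤ N) (hL : 2 ≤ L) (hlam : 0 < lam) (hM : 0 < M)
    (hNlam : cl * (L ^ 2 * Real.log N) ≤ N * lam) (hp : (p : ℝ) ≤ L + Real.log N + 1)
    (hMκ : 24 * κ ^ 2 / cl ≤ M) : 8 * (p * (κ ^ 2 / (M * lam))) ≤ N := by
  have hlog := log_ge_half hN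
  have h1 : (p : ℝ) ≤ 3 * (L ^ 2 * Real.log N) := by
    nlinarith [mul_nonneg (sub_nonneg.2 hL) (sub_nonneg.2 hlog),
      mul_nonneg (mul_nonneg (sub_nonneg.2 hL) (sub_nonneg.2 hL)) (sub_nonneg.2 hlog)]
  rw [div_le_iff₀ hcl] at hMκ
  have h2 : 8 * (p * (κ ^ 2 / (M * lam))) = 8 * p * κ ^ 2 / (M * lam) := by ring
  rw [h2, div_le_iff₀ (by positivity)]
  refine le_of_mul_le_mul_left ?_ hcl
  calc cl * (8 * p * κ ^ 2) ≤ cl * (8 * (3 * (L ^ 2 * Real.log N)) * κ ^ 2) := by gcongr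
    _ = 24 * κ ^ 2 * (cl * (L ^ 2 * Real.log N)) := by ring
    _ ≤ M * cl * (N * lam) := by
        have : 0 ≤ cl * (L ^ 2 * Real.log N) := by positivity
        gcongr
    _ = _ := by ring

/-- The lower isometry of the debiasing step applies with a regularization of order `lam`. -/
theorem debias_isometry_condition {κ cl a n lam L M : ℝ} {p : ℕ} (hcl : 0 < cl) (ha : 0 < a)
    (hn : 2 ≤ n) (hL : 2 ≤ L) (hlam : 0 < lam) (hM : 0 < M)
    (hnlam : cl * (L * n ^ a * √(Real.log n)) ≤ n * lam) (hp : (p : ℝ) ≤ L + Real.log n + 1)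
    (hMκ : 4 * κ ^ 2 * (4 + 1 / a) / cl ≤ M) : 4 * (p * (κ ^ 2 / (M * lam))) ≤ n := by
  have hlog := log_ge_half hn
  have hsq : 1 / 2 ≤ √(Real.log n) := by
    refine Real.le_sqrt_of_sq_le ?_
    linarith
  have hna : a * Real.log n + 1 ≤ n ^ a := by
    rw [Real.rpow_def_of_pos (by linarith), mul_comm (Real.log n)]
    exact Real.add_one_le_exp _
  have halog : 0 ≤ a * Real.log n := by positivity
  have hlogn : Real.log n = 1 / a * (a * Real.log n) := by field_simp
  set W := L * n ^ a * √(Real.log n) with hW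
  have hW1 : L * (a * Real.log n + 1) * (1 / 2) ≤ W := by
    rw [hW]; gcongr
  have hW2 : L / 2 ≤ W := by nlinarith
  have hW3 : a * Real.log n ≤ W := by nlinarith
  have h1 : (p : ℝ) ≤ (4 + 1 / a) * W := by
    have h3 : 1 / a * (a * Real.log n) ≤ 1 / a * W := mul_le_mul_of_nonneg_left hW3 (by positivity)
    rw [← hlogn] at h3
    linarith
  rw [div_le_iff₀ hcl] at hMκ
  have h2 : 4 * (p * (κ ^ 2 / (M * lam))) = 4 * p * κ ^ 2 / (M * lam) := by ring
  have hW0 : 0 ≤ W := by linarith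
  rw [h2, div_le_iff₀ (by positivity)]
  refine le_of_mul_le_mul_left ?_ hcl
  calc cl * (4 * p * κ ^ 2) ≤ cl * (4 * ((4 + 1 / a) * W) * κ ^ 2) := by gcongr
    _ = 4 * κ ^ 2 * (4 + 1 / a) * (cl * W) := by ring
    _ ≤ M * cl * (n * lam) := by gcongr
    _ = _ := by ring

end Rates

/-- The noise of the pooled sample, at the rate `e` of the transferring step. -/
theorem transfer_noise_le {κ D Q α cl N lam L e : ℝ} (hκ : 0 < κ) (hD : 0 ≤ D) (hQ : 0 ≤ Q)
    (hcl : 0 < cl) (hN : 2 ≤ N) (hL : 2 ≤ L) (hlam : 0 < lam) (he : 0 ≤ e) (hNe : 1 / N ≤ e ^ 2)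
    (hae : lam ^ (-α) / N ≤ cl ^ (-α) * e ^ 2) (hNlam : cl * (L ^ 2 * Real.log N) ≤ N * lam) :
    D * (6 * κ * L / √lam + 5 * √(N * (Q * lam ^ (-α)) * L))
      ≤ N * (D * (6 * κ * √(2 / cl) + 5 * √(Q * cl ^ (-α))) * (e * √L)) := by
  have hlog := log_ge_half hN
  have hN0 : 0 < N := by linarith
  have hNe' : N ≤ (N * e) ^ 2 := by
    rw [div_le_iff₀ hN0] at hNe
    nlinarith
  have hL1 : 1 ≤ √L := Real.one_le_sqrt.2 (by linarith)
  have h1 : L / √lam ≤ √(2 / cl) * (N * e) := by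
    rw [div_le_iff₀ (Real.sqrt_pos.2 hlam)]
    refine le_of_sq_le_sq ?_ (by positivity)
    rw [mul_pow, mul_pow, Real.sq_sqrt hlam.le, Real.sq_sqrt (by positivity)]
    have h2 : L ^ 2 ≤ 2 / cl * (N * lam) := by
      rw [div_mul_eq_mul_div, le_div_iff₀ hcl]
      nlinarith [mul_nonneg (mul_nonneg hcl.le (sq_nonneg L)) (sub_nonneg.2 hlog)]
    calc L ^ 2 ≤ 2 / cl * (N * lam) := h2
      _ ≤ 2 / cl * ((N * e) ^ 2 * lam) := by gcongr
      _ = _ := by ring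
  have h3 : √(N * (Q * lam ^ (-α)) * L) ≤ √(Q * cl ^ (-α)) * (N * e) * √L := by
    refine Real.sqrt_le_left (by positivity) |>.2 ?_
    rw [mul_pow, mul_pow, Real.sq_sqrt (by positivity), Real.sq_sqrt (by positivity)]
    rw [div_le_iff₀ hN0] at hae
    calc N * (Q * lam ^ (-α)) * L ≤ N * (Q * (cl ^ (-α) * e ^ 2 * N)) * L := by gcongr
      _ = _ := by ring
  calc _ = D * (6 * κ * (L / √lam) + 5 * √(N * (Q * lam ^ (-α)) * L)) := by ring
    _ ≤ D * (6 * κ * (√(2 / cl) * (N * e) * √L) + 5 * (√(Q * cl ^ (-α)) * (N * e) * √L)) := by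
        have := h1.trans (le_mul_of_one_le_right (by positivity) hL1)
        gcongr
    _ = _ := by ring

/-- The noise of the target sample, as it enters the transferring step. -/
theorem transfer_target_noise_le {κ D Q α cl N n lam L e : ℝ} (hκ : 0 < κ) (hD : 0 ≤ D)
    (hQ : 0 ≤ Q) (hcl : 0 < cl) (hN : 2 ≤ N) (hn : 0 < n) (hL : 2 ≤ L) (hlam : 0 < lam)
    (he : 0 ≤ e) (hae : lam ^ (-α) / N ≤ cl ^ (-α) * e ^ 2)
    (hNlam : cl * (L ^ 2 * Real.log N) ≤ N * lam) :
    √(N / n) * (D * (6 * κ * L / √lam + 5 * √(n * (Q * lam ^ (-α)) * L)))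
      ≤ N * (D * (6 * κ * √(2 / cl) + 5 * √(Q * cl ^ (-α))) * (e * √L)
        + 6 * κ * D / √cl * (L / √n)) := by
  have hlog := log_ge_half hN
  have hN0 : 0 < N := by linarith
  have h1 : cl ≤ N * lam := by
    have : 1 ≤ L ^ 2 * Real.log N := by nlinarith
    exact (le_mul_of_one_le_right hcl.le this).trans hNlam
  have h2 : √N / √lam ≤ N / √cl := by
    rw [div_le_div_iff₀ (Real.sqrt_pos.2 hlam) (Real.sqrt_pos.2 hcl)]
    refine le_of_sq_le_sq ?_ (by positivity)
    rw [mul_pow, mul_pow, Real.sq_sqrt hN0.le, Real.sq_sqrt hcl.le, Real.sq_sqrt hlam.le]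
    nlinarith
  have h3 : √(N / n) * √(n * (Q * lam ^ (-α)) * L) ≤ √(Q * cl ^ (-α)) * (N * e) * √L := by
    rw [← Real.sqrt_mul (by positivity)]
    refine Real.sqrt_le_left (by positivity) |>.2 ?_
    rw [mul_pow, mul_pow, Real.sq_sqrt (by positivity), Real.sq_sqrt (by positivity)]
    rw [div_le_iff₀ hN0] at hae
    calc N / n * (n * (Q * lam ^ (-α)) * L) = N * (Q * lam ^ (-α)) * L := by field_simp
      _ ≤ N * (Q * (cl ^ (-α) * e ^ 2 * N)) * L := by gcongr
      _ = _ := by ring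
  have h4 : 0 ≤ N * (D * (6 * κ * √(2 / cl)) * (e * √L)) := by positivity
  calc _ = D * (6 * κ * L * (√N / √lam / √n)
        + 5 * (√(N / n) * √(n * (Q * lam ^ (-α)) * L))) := by
        rw [Real.sqrt_div hN0.le]; ring
    _ ≤ D * (6 * κ * L * (N / √cl / √n) + 5 * (√(Q * cl ^ (-α)) * (N * e) * √L)) := by gcongr
    _ ≤ D * (6 * κ * L * (N / √cl / √n) + 5 * (√(Q * cl ^ (-α)) * (N * e) * √L))
        + N * (D * (6 * κ * √(2 / cl)) * (e * √L)) := le_add_of_nonneg_right h4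
    _ = _ := by ring

/-- The noise of the target sample, at the rate `s` of the debiasing step. -/
theorem debias_noise_le {κ D Q α cl n lam L s : ℝ} (hκ : 0 < κ) (hD : 0 ≤ D) (hQ : 0 ≤ Q)
    (hα : α ∈ Set.Ioc (0 : ℝ) 1) (hcl : 0 < cl) (hn : 1 ≤ n) (hL : 2 ≤ L) (hlam : 0 < lam)
    (hs : 0 ≤ s) (has : lam ^ (-α) / n ≤ cl ^ (-α) * s ^ 2) (hnlam : cl ≤ n * lam) :
    D * (6 * κ * L / √lam + 5 * √(n * (Q * lam ^ (-α)) * L))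
      ≤ n * (D * (6 * κ * √(cl ^ (-α) * cl ^ (α - 1)) + 5 * √(Q * cl ^ (-α))) * (s * L)) := by
  obtain ⟨hα0, hα1⟩ := hα
  have hn0 : 0 < n := by linarith
  rw [div_le_iff₀ hn0] at has
  have h0 : lam ^ (α - 1) ≤ cl ^ (α - 1) * n := by
    have h1 : cl / n ≤ lam := by rw [div_le_iff₀ hn0]; linarith
    calc lam ^ (α - 1) ≤ (cl / n) ^ (α - 1) :=
          Real.rpow_le_rpow_of_nonpos (by positivity) h1 (by linarith)
      _ = cl ^ (α - 1) * n ^ (1 - α) := by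
          rw [Real.div_rpow hcl.le hn0.le, div_eq_mul_inv, ← Real.rpow_neg hn0.le, neg_sub]
      _ ≤ cl ^ (α - 1) * n ^ (1 : ℝ) := by
          gcongr
          linarith
      _ = _ := by rw [Real.rpow_one]
  have h1 : 1 / √lam ≤ √(cl ^ (-α) * cl ^ (α - 1)) * (n * s) := by
    rw [show 1 / √lam = √(1 / lam) by rw [Real.sqrt_div zero_le_one, Real.sqrt_one]]
    refine Real.sqrt_le_left (by positivity) |>.2 ?_
    rw [mul_pow, Real.sq_sqrt (by positivity)]
    calc 1 / lam = lam ^ (-α) * lam ^ (α - 1) := by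
          rw [← Real.rpow_add hlam, show -α + (α - 1) = -1 by ring, Real.rpow_neg_one, one_div]
      _ ≤ cl ^ (-α) * s ^ 2 * n * (cl ^ (α - 1) * n) := by gcongr
      _ = _ := by ring
  have h3 : √(n * (Q * lam ^ (-α)) * L) ≤ √(Q * cl ^ (-α)) * (n * s) * L := by
    refine Real.sqrt_le_left (by positivity) |>.2 ?_
    rw [mul_pow, mul_pow, Real.sq_sqrt (by positivity)]
    calc n * (Q * lam ^ (-α)) * L ≤ n * (Q * (cl ^ (-α) * s ^ 2 * n)) * L ^ 2 := by
          gcongr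
          nlinarith
      _ = _ := by ring
  calc _ = D * (6 * κ * L * (1 / √lam) + 5 * √(n * (Q * lam ^ (-α)) * L)) := by ring
    _ ≤ D * (6 * κ * L * (√(cl ^ (-α) * cl ^ (α - 1)) * (n * s))
        + 5 * (√(Q * cl ^ (-α)) * (n * s) * L)) := by gcongr
    _ = _ := by ring

/-- Where the error of the transferring step enters the debiasing step, it does so with a factor
that turns the parametric rate `1 / √n` into the rate `s` of the debiasing step. -/
theorem min_div_sqrt_le {κ α cl n lam s : ℝ} (hκ : 0 < κ) (hα : α ∈ Set.Ioc (0 : ℝ) 1)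
    (hcl : 0 < cl) (hlam : 0 < lam) (hs : 0 ≤ s)
    (has : lam ^ (-α) / n ≤ cl ^ (-α) * s ^ 2) :
    min 1 (κ / √lam) / √n ≤ κ ^ α * √(cl ^ (-α)) * s := by
  obtain ⟨hα0, hα1⟩ := hα
  have hx : 0 < κ / √lam := by positivity
  -- `min 1 x ≤ x ^ α` because `0 ≤ α ≤ 1`
  have h1 : min 1 (κ / √lam) ≤ (κ / √lam) ^ α := by
    rcases le_total 1 (κ / √lam) with h | h
    · exact (min_le_left _ _).trans (Real.one_le_rpow h hα0.le)
    · refine (min_le_right _ _).trans ?_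
      calc κ / √lam = (κ / √lam) ^ (1 : ℝ) := (Real.rpow_one _).symm
        _ ≤ _ := Real.rpow_le_rpow_of_exponent_ge hx h hα1
  have h2 : (κ / √lam) ^ α = κ ^ α * √(lam ^ (-α)) := by
    rw [Real.div_rpow hκ.le (Real.sqrt_nonneg _), div_eq_mul_inv, Real.sqrt_eq_rpow,
      Real.sqrt_eq_rpow, ← Real.rpow_mul hlam.le, ← Real.rpow_mul hlam.le, ← Real.rpow_neg hlam.le]
    rw [show -(1 / 2 * α) = -α * (1 / 2) by ring]
  calc _ ≤ (κ / √lam) ^ α / √n := by gcongr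
    _ = κ ^ α * √(lam ^ (-α) / n) := by rw [h2, Real.sqrt_div (by positivity)]; ring
    _ ≤ κ ^ α * √(cl ^ (-α) * s ^ 2) := by gcongr
    _ = _ := by rw [Real.sqrt_mul (by positivity), Real.sqrt_sq hs]; ring

/-- The error bounds of the two steps add up to the two terms of the final bound. -/
theorem error_terms_le {M K1 K2 K3 K4 K5 K6 e s L μ rn q : ℝ} (hM : 0 ≤ M) (hK1 : 0 ≤ K1)
    (hK3 : 0 ≤ K3) (hK4 : 0 ≤ K4) (hK6 : 0 ≤ K6) (he : 0 ≤ e) (hs : 0 ≤ s) (hL : 2 ≤ L)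
    (hμ : μ ≤ 1) (hμn : μ / rn ≤ K5 * s) (hq : q ≤ K6 * s) :
    48 * M * (K1 * (e * √L)) + √(16 * M) * (√(16 * M) * (K2 * (s * L))
      + μ * (16 * M * (18 * (K1 * (e * √L)) + (K1 * (e * √L) + K4 * (L / rn)))
        + 2 * (K3 * (L / rn))) + q)
      ≤ (48 * M + 19 * (16 * M) * √(16 * M)) * K1 * e * L
        + (16 * M * K2 + √(16 * M) * (16 * M * K4 + 2 * K3) * K5 + √(16 * M) * K6) * s * L := by
  have hLL : √L ≤ L := Real.sqrt_le_left (by linarith) |>.2 (by nlinarith)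
  have h1 : √(16 * M) * √(16 * M) = 16 * M := Real.mul_self_sqrt (by positivity)
  have h2 : μ * (K1 * (e * √L)) ≤ K1 * (e * L) :=
    (mul_le_of_le_one_left (by positivity) hμ).trans (by gcongr)
  have h3 : K1 * (e * √L) ≤ K1 * (e * L) := by gcongr
  have h4 : q ≤ K6 * s * L := hq.trans (le_mul_of_one_le_right (by positivity) (by linarith))
  calc _ = 48 * M * (K1 * (e * √L)) + √(16 * M) * √(16 * M) * (K2 * (s * L))
        + √(16 * M) * (16 * M) * 19 * (μ * (K1 * (e * √L)))
        + √(16 * M) * ((16 * M * K4 + 2 * K3) * L) * (μ / rn) + √(16 * M) * q := by ring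
    _ ≤ 48 * M * (K1 * (e * L)) + 16 * M * (K2 * (s * L))
        + √(16 * M) * (16 * M) * 19 * (K1 * (e * L))
        + √(16 * M) * ((16 * M * K4 + 2 * K3) * L) * (K5 * s) + √(16 * M) * (K6 * s * L) := by
        rw [h1]
        gcongr
    _ = _ := by ring

/-! ### From the normal equations to the rate of the estimator -/

section Setting

variable {X : Type*} {H : Type*} [NormedAddCommGroup H] [InnerProductSpace ℝ H] [RKHS ℝ H X ℝ]

/-- The first-order condition for kernel ridge regression. -/
theorem normal_equation {τ : Type*} {J : Finset τ} {x : τ → X} {y : τ → ℝ} {t lam : ℝ} {f : H}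
    (hf : IsMinOn (fun f : H => t * ∑ j ∈ J, (f (x j) - y j) ^ 2 + lam * ‖f‖ ^ 2) Set.univ f)
    (v : H) : t * ∑ j ∈ J, (f (x j) - y j) * v (x j) + lam * inner ℝ f v = 0 := by
  set a := t * ∑ j ∈ J, (f (x j) - y j) * v (x j) + lam * inner ℝ f v with ha
  set b := t * ∑ j ∈ J, v (x j) ^ 2 + lam * ‖v‖ ^ 2 with hb
  have key : ∀ s : ℝ, 0 ≤ 2 * s * a + s ^ 2 * b := by
    intro s
    have h1 := isMinOn_iff.1 hf (f + s • v) (Set.mem_univ _)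
    have h2 : ∑ j ∈ J, ((f + s • v) (x j) - y j) ^ 2 = ∑ j ∈ J, (f (x j) - y j) ^ 2
        + 2 * s * ∑ j ∈ J, (f (x j) - y j) * v (x j) + s ^ 2 * ∑ j ∈ J, v (x j) ^ 2 := by
      rw [Finset.mul_sum, Finset.mul_sum, ← Finset.sum_add_distrib, ← Finset.sum_add_distrib]
      refine Finset.sum_congr rfl fun j _ => ?_
      rw [RKHS.coe_add, RKHS.coe_smul, Pi.add_apply, Pi.smul_apply, smul_eq_mul]
      ring
    have h3 : ‖f + s • v‖ ^ 2 = ‖f‖ ^ 2 + 2 * s * inner ℝ f v + s ^ 2 * ‖v‖ ^ 2 := by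
      rw [norm_add_sq_real, inner_smul_right, norm_smul, mul_pow, Real.norm_eq_abs, sq_abs]
      ring
    rw [h2, h3] at h1
    rw [ha, hb]
    linarith
  -- a quadratic in `s` that is nonnegative and vanishes at `0` has no linear term
  have h4 : 0 < |b| + 1 := by positivity
  have h5 := key (-a / (|b| + 1))
  have h6 : 2 * (-a / (|b| + 1)) * a + (-a / (|b| + 1)) ^ 2 * b
      = a ^ 2 / (|b| + 1) ^ 2 * (b - 2 * (|b| + 1)) := by
    field_simp
    ring
  rw [h6] at h5
  by_contra hne
  have h7 : 0 < a ^ 2 / (|b| + 1) ^ 2 := by positivity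
  nlinarith [le_abs_self b, abs_nonneg b]

variable {m : ℕ}

/-- The normal equations of the two steps, with the samples indexed by a single type. -/
theorem IsTKRR.normal_equations {n : Fin (m + 1) → ℕ} {A : Finset (Fin (m + 1))}
    {z : (k : Fin (m + 1)) → Fin (n k) → X × ℝ} {lam1 lam2 : ℝ} {fhat : H}
    (hfhat : IsTKRR n A z lam1 lam2 fhat) :
    ∃ fp fde : H,
      (∀ v : H, (poolSize n A : ℝ)⁻¹ *
        ∑ j ∈ (insert 0 A).sigma fun k => (Finset.univ : Finset (Fin (n k))),
          (fp (z j.1 j.2).1 - (z j.1 j.2).2) * v (z j.1 j.2).1 + lam1 * inner ℝ fp v = 0) ∧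
      (∀ v : H, (n 0 : ℝ)⁻¹ * ∑ j ∈ ({0} : Finset (Fin (m + 1))).sigma
          fun k => (Finset.univ : Finset (Fin (n k))),
        (fde (z j.1 j.2).1 - ((z j.1 j.2).2 - fp (z j.1 j.2).1)) * v (z j.1 j.2).1
          + lam2 * inner ℝ fde v = 0) ∧ fhat = fp + fde := by
  obtain ⟨fp, fde, hp, hd, rfl⟩ := hfhat
  refine ⟨fp, fde, fun v => ?_, fun v => ?_, rfl⟩
  · refine normal_equation (J := (insert 0 A).sigma fun k => (Finset.univ : Finset (Fin (n k))))
      (x := fun j => (z j.1 j.2).1) (y := fun j => (z j.1 j.2).2) ?_ v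
    convert hp using 2 with f
    rw [transferObjective, Finset.sum_sigma, one_div]
  · refine normal_equation
      (J := ({0} : Finset (Fin (m + 1))).sigma fun k => (Finset.univ : Finset (Fin (n k))))
      (x := fun j => (z j.1 j.2).1) (y := fun j => (z j.1 j.2).2 - fp (z j.1 j.2).1) ?_ v
    convert hd using 2 with f
    rw [debiasObjective, Finset.sum_sigma, Finset.sum_singleton, one_div]

end Setting

/-- An event about independent random variables has at most its probability under the product of
their laws; the event need not be measurable. -/
theorem measure_preimage_le_pi {Ω τ E : Type*} [MeasurableSpace Ω] {P : Measure Ω}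
    [IsProbabilityMeasure P] [Fintype τ] [MeasurableSpace E] {Z : τ → Ω → E} {μ : τ → Measure E}
    (hlaw : ∀ j, HasLaw (Z j) (μ j) P) (hindep : iIndepFun Z P) (s : Set (τ → E)) :
    P {ω | (fun j => Z j ω) ∈ s} ≤ Measure.pi μ s := by
  have h1 := (iIndepFun_iff_map_fun_eq_pi_map fun j => (hlaw j).aemeasurable).1 hindep
  have h2 : (fun j => P.map (Z j)) = μ := funext fun j => (hlaw j).map_eq
  rw [h2] at h1
  rw [← h1]
  exact Measure.le_map_apply (aemeasurable_pi_lambda _ fun j => (hlaw j).aemeasurable) s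

section Rate

variable {X : Type*} [MeasurableSpace X] {H : Type*} [NormedAddCommGroup H] [InnerProductSpace ℝ H]
  [CompleteSpace H] [RKHS ℝ H X ℝ]

/-- Regression functions are only determined up to null functions; the representative orthogonal to
the null functions obeys the source condition in the form of a bound on the functional `⟪f, ·⟫`. -/
theorem exists_orthogonal_representatives
    (hK : Measurable (Function.uncurry (ker H : X → X → ℝ))) {κ : ℝ}
    (hκ : ∀ x : X, Real.sqrt (ker H x x) ≤ κ) (ρ : Measure X) [IsProbabilityMeasure ρ]
    {σ : Type*} (f : σ → H) {r G : ℝ} (hr : r ∈ Set.Icc (1 / 2 : ℝ) 1)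
    (hsource : ∀ k, ∃ g : Lp ℝ 2 ρ, ‖g‖ ≤ G ∧
      (f k : X → ℝ) =ᵐ[ρ] (opPow (LK H hK hκ ρ) r g : Lp ℝ 2 ρ)) :
    ∃ f' : σ → H, (∀ k, incl hK hκ ρ (f' k) = incl hK hκ ρ (f k)) ∧
      (∀ k l, ‖f' k - f' l‖ ≤ ‖f k - f l‖) ∧
      ∀ k, ∀ lam : ℝ, 0 < lam → ∀ v,
        |inner ℝ (f' k) v| ≤ G * lam ^ (r - 1) * regNorm (incl hK hκ ρ) lam v := by
  set S := incl hK hκ ρ with hS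
  have hSf : ∀ k, S (S.kerᗮ.starProjection (f k)) = S (f k) := by
    intro k
    have h1 : f k - S.kerᗮ.starProjection (f k) ∈ S.kerᗮᗮ :=
      Submodule.sub_starProjection_mem_orthogonal _
    rw [Submodule.orthogonal_orthogonal] at h1
    have h2 : S (f k - S.kerᗮ.starProjection (f k)) = 0 := h1
    rw [map_sub, sub_eq_zero] at h2
    exact h2.symm
  refine ⟨fun k => S.kerᗮ.starProjection (f k), hSf, fun k l => ?_, fun k lam hlam v => ?_⟩
  · rw [← map_sub]
    exact Submodule.norm_starProjection_apply_le _ _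
  · obtain ⟨g, hg, hfg⟩ := hsource k
    have h1 : S (S.kerᗮ.starProjection (f k))
        = opPow (S ∘L ContinuousLinearMap.adjoint S) r g := by
      rw [hSf, hS, ← LK_eq]
      exact Lp.ext ((incl_ae hK hκ ρ (f k)).trans hfg)
    refine (abs_inner_le_of_source S hlam hr (Submodule.starProjection_apply_mem _ _) h1 v).trans ?_
    have := regNorm_nonneg S lam v
    gcongr

/-- The error bound of the two-step estimator, for regression functions in the range of a power of
the integral operator. -/
theorem exists_measure_rate_lt_le {κ B γ Q G α r cl cu : ℝ} (hκ0 : 0 < κ) (hB : 0 < B) (hγ : 0 < γ)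
    (hQ : 1 ≤ Q) (hG : 0 ≤ G) (hα : α ∈ Set.Ioc (0 : ℝ) 1) (hr : r ∈ Set.Icc (1 / 2 : ℝ) 1)
    (hcl : 0 < cl) (hcu : cl ≤ cu) :
    ∃ C1 C2 : ℝ, 0 < C1 ∧ 0 < C2 ∧
      ∀ (X : Type*) [MeasurableSpace X] (ρ : Measure X) [IsProbabilityMeasure ρ]
        (H : Type*) [NormedAddCommGroup H] [InnerProductSpace ℝ H] [CompleteSpace H]
        [TopologicalSpace.SeparableSpace H] [RKHS ℝ H X ℝ]
        (hK : Measurable (Function.uncurry (ker H : X → X → ℝ)))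
        (hκ : ∀ x : X, Real.sqrt (ker H x x) ≤ κ)
        (Ω : Type*) [MeasurableSpace Ω] (P : Measure Ω) [IsProbabilityMeasure P]
        (τ : Type*) [DecidableEq τ] (Z : τ → Ω → X × ℝ) (_ : ∀ j, Measurable (Z j))
        (_ : iIndepFun Z P) (η : τ → Kernel X ℝ) [∀ j, IsMarkovKernel (η j)] (f : τ → H)
        (_ : ∀ j, P.map (Z j) = ρ.compProd (η j)) (_ : ∀ j, IsRegression ρ (η j) (f j))
        (_ : ∀ j, SubExpNoise ρ (η j) (f j) B γ)
        (_ : ∀ lam : ℝ, 0 < lam →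
          effDim (LK H hK hκ ρ) lam ≤ ENNReal.ofReal (Q * lam ^ (-α)))
        (_ : ∀ j, ∀ lam : ℝ, 0 < lam → ∀ v,
          |inner ℝ (f j) v| ≤ G * lam ^ (r - 1) * regNorm (incl hK hκ ρ) lam v)
        (J0 JA : Finset τ) (_ : Disjoint J0 JA) (f0 : H) (h : ℝ) (_ : 0 < h)
        (_ : ∀ j ∈ J0, f j = f0) (_ : ∀ j ∈ JA, ‖f j - f0‖ ≤ h)
        (n N : ℝ) (_ : n = J0.card) (_ : N = (J0 ∪ JA).card) (_ : 2 ≤ n) (lam1 lam2 : ℝ)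
        (_ : lam1 ∈ Set.Icc (cl * N ^ (-(1 / (2 * r + α)))) (cu * N ^ (-(1 / (2 * r + α)))))
        (_ : lam2 ∈ Set.Icc (cl * (h ^ (-(2 / (1 + α))) * n ^ (-(1 / (1 + α)))))
          (cu * (h ^ (-(2 / (1 + α))) * n ^ (-(1 / (1 + α))))))
        (L : ℝ) (_ : 2 ≤ L)
        (_ : L ≤ N ^ ((2 * r + α - 1) / (2 * (2 * r + α))) * Real.log N ^ (-(1 / 2) : ℝ))
        (_ : L ≤ h ^ (-(2 / (1 + α)))
          * (n ^ (α / (2 + 2 * α)) * Real.log n ^ (-(1 / 2) : ℝ))),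
        P {ω | ∃ fp fde : H,
          (∀ v, N⁻¹ * ∑ j ∈ J0 ∪ JA, (fp (Z j ω).1 - (Z j ω).2) * v (Z j ω).1
            + lam1 * inner ℝ fp v = 0) ∧
          (∀ v, n⁻¹ * ∑ j ∈ J0, (fde (Z j ω).1 - ((Z j ω).2 - fp (Z j ω).1)) * v (Z j ω).1
            + lam2 * inner ℝ fde v = 0) ∧
          C1 * N ^ (-(r / (2 * r + α))) * L
            + C2 * (h ^ (α / (1 + α)) * n ^ (-(1 / (2 * α + 2)))) * L
            < ‖incl hK hκ ρ (fp + fde - f0)‖} ≤ ENNReal.ofReal (9 * Real.exp (-L)) := by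
  have hα0 : 0 < α := hα.1
  have hr0 : 0 < r := by linarith [hr.1]
  have hcu0 : 0 < cu := hcl.trans_le hcu
  set a : ℝ := α / (2 + 2 * α) with ha
  have ha0 : 0 < a := by positivity
  -- the bound `b` of `f j - c`, where `c` is the mean of the `f j`
  set b : ℝ := κ * (2 * (G * (κ ^ 2) ^ (r - 1) * (2 * κ))) with hb
  have hb0 : 0 ≤ b := by positivity
  set M : ℝ := 1 + 24 * κ ^ 2 / cl + 4 * κ ^ 2 * (4 + 1 / a) / cl with hM
  have hM1 : 1 + 24 * κ ^ 2 / cl ≤ M := le_add_of_nonneg_right (by positivity)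
  have hM2 : 24 * κ ^ 2 / cl ≤ M := by linarith
  have hM3 : 4 * κ ^ 2 * (4 + 1 / a) / cl ≤ M :=
    le_add_of_nonneg_left (by positivity)
  have hM4 : 1 ≤ M := le_trans (le_add_of_nonneg_right (by positivity)) hM1
  have hM0 : 0 < M := by linarith
  set D : ℝ := B + γ + b with hD
  have hD0 : 0 ≤ D := by positivity
  set K1 : ℝ := D * (6 * κ * √(2 / cl) + 5 * √(Q * cl ^ (-α))) + G * cu ^ r with hK1
  set K2 : ℝ := D * (6 * κ * √(cl ^ (-α) * cl ^ (α - 1)) + 5 * √(Q * cl ^ (-α))) with hK2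
  set K3 : ℝ := κ * √(16 * M) * (2 * K1) / √cl with hK3
  set K4 : ℝ := 6 * κ * D / √cl with hK4
  set K5 : ℝ := κ ^ α * √(cl ^ (-α)) with hK5
  set K6 : ℝ := √cu with hK6
  have hK10 : 0 ≤ K1 := by positivity
  have hK20 : 0 ≤ K2 := by positivity
  have hK30 : 0 ≤ K3 := by positivity
  have hK40 : 0 ≤ K4 := by positivity
  have hK50 : 0 ≤ K5 := by positivity
  have hK60 : 0 ≤ K6 := by positivity
  refine ⟨(48 * M + 19 * (16 * M) * √(16 * M)) * K1 + 1,
    16 * M * K2 + √(16 * M) * (16 * M * K4 + 2 * K3) * K5 + √(16 * M) * K6 + 1,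
    by positivity, by positivity, ?_⟩
  intro X _ ρ _ H _ _ _ _ _ hK hκ Ω _ P _ τ _ Z hZ hindep η _ f hlaw hreg hnoise heff hf J0 JA
    hdisj f0 h hh hf0 hfA n N hn hN hn2 lam1 lam2 hlam1 hlam2 L hL hNL hnL
  set S := incl hK hκ ρ with hS
  set e : ℝ := N ^ (-(r / (2 * r + α))) with he
  set s : ℝ := h ^ (α / (1 + α)) * n ^ (-(1 / (2 * α + 2))) with hs
  have hn0 : 0 < n := by linarith
  have hnN : n ≤ N := by
    rw [hn, hN]; exact_mod_cast Finset.card_le_card Finset.subset_union_left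
  have hN2 : 2 ≤ N := hn2.trans hnN
  have hN0 : 0 < N := by linarith
  have he0 : 0 < e := by positivity
  have hs0 : 0 < s := by positivity
  have hlam1' : 0 < lam1 := lt_of_lt_of_le (by positivity) hlam1.1
  have hlam2' : 0 < lam2 := lt_of_lt_of_le (by positivity) hlam2.1
  obtain ⟨hT1, hT2, hT3, hT4, hT5⟩ := transfer_rates hr hα0 hcl hN2 hL hlam1 hNL
  obtain ⟨hU1, hU2, hU3⟩ := debias_rates hα hcl hn2 hh hlam2 hnL
  rw [← he] at hT1 hT2 hT3 hT4
  rw [← hs] at hU1 hU2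
  rw [← ha] at hU3
  have hlogn := log_ge_half hn2
  have hL1 : 1 ≤ √L := Real.one_le_sqrt.2 (by linarith)
  have hU4 : cl ≤ n * lam2 := by
    refine le_trans (le_mul_of_one_le_right hcl.le ?_) hU3
    have h1 : 1 ≤ n ^ a := Real.one_le_rpow (by linarith) ha0.le
    have h2 : 1 / 2 ≤ √(Real.log n) := Real.le_sqrt_of_sq_le (by linarith)
    calc (1 : ℝ) = 2 * 1 * (1 / 2) := by norm_num
      _ ≤ _ := by gcongr
  obtain ⟨p1, hp1, hp1', hp1''⟩ := exists_nat_mul_exp_le hN2 hL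
  obtain ⟨p2, hp2, hp2', hp2''⟩ := exists_nat_mul_exp_le hn2 hL
  have hD1 : ∀ lam : ℝ, 0 < lam →
      ∫⁻ x, ENNReal.ofReal (resForm S lam (point H x) (point H x)) ∂ρ
        ≤ ENNReal.ofReal (Q * lam ^ (-α)) := fun lam hlam =>
    (lintegral_resForm_point_le hK hκ ρ hlam).trans (heff lam hlam)
  -- the mean of the regression functions of the pooled sample
  set c : H := N⁻¹ • ∑ j ∈ J0 ∪ JA, f j with hc
  have hNc : N • c = ∑ j ∈ J0 ∪ JA, f j := by
    rw [hc, smul_smul, mul_inv_cancel₀ hN0.ne', one_smul]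
  have hcsum : ∑ j ∈ J0 ∪ JA, (f j - c) = 0 := by
    rw [Finset.sum_sub_distrib, Finset.sum_const, ← Nat.cast_smul_eq_nsmul ℝ, ← hN, hNc, sub_self]
  have hcf0 : ‖c - f0‖ ≤ h := by
    have h1 : N • (c - f0) = ∑ j ∈ J0 ∪ JA, (f j - f0) := by
      rw [Finset.sum_sub_distrib, Finset.sum_const, ← Nat.cast_smul_eq_nsmul ℝ, ← hN, smul_sub, hNc]
    have h2 : ‖∑ j ∈ J0 ∪ JA, (f j - f0)‖ ≤ ∑ j ∈ J0 ∪ JA, h := by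
      refine norm_sum_le_of_le _ fun j hj => ?_
      rcases Finset.mem_union.1 hj with hj | hj
      · rw [hf0 j hj, sub_self, norm_zero]; exact hh.le
      · exact hfA j hj
    rw [← h1, norm_smul, Real.norm_eq_abs, abs_of_pos hN0, Finset.sum_const, nsmul_eq_mul,
      ← hN] at h2
    exact le_of_mul_le_mul_left h2 hN0
  have hcf : ∀ lam : ℝ, 0 < lam → ∀ v, |inner ℝ c v| ≤ G * lam ^ (r - 1) * regNorm S lam v := by
    intro lam hlam v
    rw [hc, real_inner_smul_left, sum_inner, abs_mul, abs_of_pos (inv_pos.2 hN0),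
      inv_mul_le_iff₀ hN0]
    refine (Finset.abs_sum_le_sum_abs _ _).trans
      ((Finset.sum_le_sum fun j _ => hf j lam hlam v).trans_eq ?_)
    rw [Finset.sum_const, nsmul_eq_mul, ← hN]
  have hnorm : ∀ v, ‖S v‖ ≤ κ * ‖v‖ := norm_incl_le hK hκ ρ hκ0.le
  have hfb : ∀ j x, |(f j - c) x| ≤ b := by
    intro j x
    refine (abs_apply_le hκ _ x).trans (mul_le_mul_of_nonneg_left ?_ hκ0.le)
    have h1 := norm_le_of_source S hκ0 hG hnorm (hf j)
    have h2 := norm_le_of_source S hκ0 hG hnorm hcf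
    linarith [norm_sub_le (f j) c]
  set β1 : ℝ := K1 * (e * √L) with hβ1
  have hβ1a : D * (6 * κ * L / √lam1 + 5 * √(N * (Q * lam1 ^ (-α)) * L)) ≤ N * β1 := by
    refine (transfer_noise_le hκ0 hD0 (by linarith) hcl hN2 hL hlam1' he0.le hT1 hT2 hT5).trans ?_
    rw [hβ1, hK1]
    gcongr
    exact le_add_of_nonneg_right (by positivity)
  have hβ1b : ∀ v, |inner ℝ c v| * lam1 ≤ β1 * regNorm S lam1 v := by
    intro v
    have h1 := regNorm_nonneg S lam1 v
    calc _ ≤ G * lam1 ^ (r - 1) * regNorm S lam1 v * lam1 :=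
          mul_le_mul_of_nonneg_right (hcf lam1 hlam1' v) hlam1'.le
      _ = G * lam1 ^ r * regNorm S lam1 v := by
          rw [Real.rpow_sub_one hlam1'.ne']; field_simp
      _ ≤ G * (cu ^ r * (e * √L)) * regNorm S lam1 v := by
          gcongr
          refine hT3.trans ?_
          gcongr
          exact le_mul_of_one_le_right he0.le hL1
      _ ≤ β1 * regNorm S lam1 v := by
          gcongr
          rw [hβ1, ← mul_assoc]
          gcongr
          exact le_add_of_nonneg_left (by positivity)
  have hβ0 : √(N / n) * (D * (6 * κ * L / √lam1 + 5 * √(n * (Q * lam1 ^ (-α)) * L)))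
      ≤ N * (β1 + K4 * (L / √n)) := by
    refine (transfer_target_noise_le hκ0 hD0 (by linarith) hcl hN2 hn0 hL hlam1' he0.le hT2
      hT5).trans ?_
    rw [hβ1, hK1, ← hK4]
    gcongr
    exact le_add_of_nonneg_right (by positivity)
  have hβ2 : D * (6 * κ * L / √lam2 + 5 * √(n * (Q * lam2 ^ (-α)) * L)) ≤ n * (K2 * (s * L)) :=
    debias_noise_le hκ0 hD0 (by linarith) hα hcl (by linarith) hL hlam2' hs0.le hU2 hU4
  have hβ3 : κ * (√(16 * M) * (2 * β1) / √lam1) * √(L / n) ≤ K3 * (L / √n) := by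
    have h1 : e / √lam1 ≤ 1 / √cl := by
      rw [div_le_div_iff₀ (Real.sqrt_pos.2 hlam1') (Real.sqrt_pos.2 hcl), one_mul]
      refine Real.le_sqrt_of_sq_le ?_
      rw [mul_pow, Real.sq_sqrt hcl.le]
      linarith
    have h2 : √(L / n) = √L / √n := Real.sqrt_div (by linarith) n
    have h3 : √L * √L = L := Real.mul_self_sqrt (by linarith)
    calc _ = κ * √(16 * M) * (2 * K1) * (e / √lam1) * (√L * √L / √n) := by
          rw [hβ1, h2]; ring
      _ ≤ κ * √(16 * M) * (2 * K1) * (1 / √cl) * (√L * √L / √n) := by gcongr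
      _ = _ := by rw [h3, hK3]; ring
  have hmain := measure_exists_lt_norm_le (β3 := K3 * (L / √n)) hK hκ ρ hZ hindep hlaw hreg hB hγ
    hnoise hκ0 hdisj
    (Finset.card_pos.1 (by rw [hn] at hn0; exact_mod_cast hn0)) hh.le hf0 hcsum hcf0 hb0 hfb
    hlam1' hlam2' hM4 (hD1 lam1 hlam1') (by positivity) (hD1 lam2 hlam2') (by positivity)
    (by linarith : 0 < L) hN hp1 hp2
    (transfer_isometry_condition hcl hN2 hL hlam1' hM0 hT5 hp1'' hM2)
    (by rw [← hn]
        exact debias_isometry_condition hcl ha0 hn2 hL hlam2' hM0 hU3 hp2'' hM3)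
    hp1' (by rw [← hn]; exact hp2') hβ1a hβ1b (by rw [← hn]; exact hβ0) (by rw [← hn]; exact hβ2)
    (by rw [← hn]; exact hβ3)
  rw [← hn] at hmain
  refine (measure_mono ?_).trans hmain
  rintro ω ⟨fp, fde, h1, h2, h3⟩
  refine ⟨fp, fde, h1, h2, lt_of_le_of_lt ?_ h3⟩
  have hq : √lam2 * h ≤ K6 * s := by
    refine le_of_sq_le_sq ?_ (by positivity)
    rw [mul_pow, mul_pow, Real.sq_sqrt hlam2'.le, Real.sq_sqrt hcu0.le]
    exact hU1
  refine (error_terms_le hM0.le hK10 hK30 hK40 hK60 he0.le hs0.le hL (min_le_left _ _)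
    (min_div_sqrt_le hκ0 hα hcl hlam2' hs0.le hU2) hq).trans ?_
  have hle : ∀ {x y : ℝ}, 0 ≤ y → x * y * L ≤ (x + 1) * y * L := by
    intro x y hy
    gcongr
    exact le_add_of_nonneg_right zero_le_one
  exact add_le_add (hle he0.le) (hle hs0.le)

end Rate

end TKRR

theorem theorem1
    -- the constants of the assumptions, and those implicit in the choice of `λ₁` and `λ₂`
    (κ B γ Q G α r cl cu : ℝ) (hκ0 : 0 < κ) (hB : 0 < B) (hγ : 0 < γ) (hQ : 1 ≤ Q) (hG : 0 ≤ G)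
    (hα : α ∈ Set.Ioc (0 : ℝ) 1) (hr : r ∈ Set.Icc (1 / 2 : ℝ) 1) (hcl : 0 < cl) (hcu : cl ≤ cu) :
    ∃ C0 C1 C2 : ℝ, 0 < C0 ∧ 0 < C1 ∧ 0 < C2 ∧
      ∀ (X : Type*) [MeasurableSpace X] (ρ : Measure X) [IsProbabilityMeasure ρ]
        -- the reproducing kernel Hilbert space
        (H : Type*) [NormedAddCommGroup H] [InnerProductSpace ℝ H] [CompleteSpace H]
        [TopologicalSpace.SeparableSpace H] [RKHS ℝ H X ℝ]
        (hK : Measurable (Function.uncurry (TKRR.ker H : X → X → ℝ)))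
        (hκ : ∀ x : X, Real.sqrt (TKRR.ker H x x) ≤ κ)
        -- the target model (index `0`) and the source models
        (m : ℕ) (η : Fin (m + 1) → Kernel X ℝ) [∀ k, IsMarkovKernel (η k)] (f : Fin (m + 1) → H)
        (_hreg : ∀ k, TKRR.IsRegression ρ (η k) (f k))
        (_hnoise : ∀ k, TKRR.SubExpNoise ρ (η k) (f k) B γ)
        (_heff : ∀ lam : ℝ, 0 < lam →
          TKRR.effDim (TKRR.LK H hK hκ ρ) lam ≤ ENNReal.ofReal (Q * lam ^ (-α)))
        (_hsource : ∀ k, ∃ g : Lp ℝ 2 ρ, ‖g‖ ≤ G ∧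
          (f k : X → ℝ) =ᵐ[ρ] (TKRR.opPow (TKRR.LK H hK hκ ρ) r g : Lp ℝ 2 ρ))
        -- the samples
        (n : Fin (m + 1) → ℕ) (_hn0 : 2 ≤ n 0)
        (Ω : Type*) [MeasurableSpace Ω] (P : Measure Ω) [IsProbabilityMeasure P]
        (Z : (k : Fin (m + 1)) → Fin (n k) → Ω → X × ℝ)
        (_hlaw : ∀ k i, HasLaw (Z k i) (ρ.compProd (η k)) P)
        (_hindep : iIndepFun (fun p : (Σ k, Fin (n k)) => Z p.1 p.2) P)
        -- the similarity level, the regularization parameters and the estimator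
        (h : ℝ) (_hh : 0 < h) (A : Finset (Fin (m + 1))) (_hA : A = TKRR.transferable f h)
        (N : ℕ) (_hN : N = TKRR.poolSize n A)
        (lam1 lam2 : ℝ)
        (_hlam1 : lam1 ∈ Set.Icc (cl * (N : ℝ) ^ (-(1 / (2 * r + α))))
          (cu * (N : ℝ) ^ (-(1 / (2 * r + α)))))
        (_hlam2 : lam2 ∈ Set.Icc (cl * (h ^ (-(2 / (1 + α))) * (n 0 : ℝ) ^ (-(1 / (1 + α)))))
          (cu * (h ^ (-(2 / (1 + α))) * (n 0 : ℝ) ^ (-(1 / (1 + α))))))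
        (fhat : Ω → H)
        (_hfhat : ∀ ω, TKRR.IsTKRR n A (fun k i => Z k i ω) lam1 lam2 (fhat ω))
        -- the confidence level
        (δ : ℝ) (_hδ : δ ∈ Set.Ioo (0 : ℝ) 1)
        (_hδC : C0 * Real.exp (-(min
            ((N : ℝ) ^ ((2 * r + α - 1) / (2 * (2 * r + α))) * Real.log N ^ (-(1 / 2) : ℝ))
            (h ^ (-(2 / (1 + α))) * ((n 0 : ℝ) ^ (α / (2 + 2 * α))
              * Real.log (n 0) ^ (-(1 / 2) : ℝ))))) ≤ δ),
        -- the error bound fails with (outer) probability at most `δ`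
        P {ω | ¬ (eLpNorm (fun x => fhat ω x - f 0 x) 2 ρ ≤ ENNReal.ofReal
            (C1 * (N : ℝ) ^ (-(r / (2 * r + α))) * Real.log (12 * ((A.card : ℝ) + 1) / δ)
              + C2 * h ^ (α / (1 + α)) * (n 0 : ℝ) ^ (-(1 / (2 * α + 2))) * Real.log (12 / δ)))}
          ≤ ENNReal.ofReal δ := by
  obtain ⟨C1, C2, hC1, hC2, hmain⟩ := TKRR.exists_measure_rate_lt_le hκ0 hB hγ hQ hG hα hr hcl hcu
  refine ⟨12, C1, C2, by norm_num, hC1, hC2, ?_⟩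
  intro X _ ρ _ H _ _ _ _ _ hK hκ m η _ f hreg hnoise heff hsource n hn0 Ω _ P _ Z hlaw hindep h hh
    A hA N hN lam1 lam2 hlam1 hlam2 fhat hfhat δ hδ hδC
  obtain ⟨hL1, hL2⟩ := TKRR.log_le_of_mul_exp_le le_rfl hδ.1 hδC
  have hL := TKRR.log_twelve_div_ge hδ.1 hδ.2
  obtain ⟨f', hSf, hff', hf'⟩ := TKRR.exists_orthogonal_representatives hK hκ ρ f hr hsource
  have hae : ∀ k, (f k : X → ℝ) =ᵐ[ρ] f' k := by
    intro k
    have h1 := TKRR.incl_ae hK hκ ρ (f' k)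
    rw [hSf k] at h1
    exact (TKRR.incl_ae hK hκ ρ (f k)).symm.trans h1
  have hreg' : ∀ k, TKRR.IsRegression ρ (η k) (f' k) := by
    intro k
    filter_upwards [hreg k, hae k] with x h1 h2
    rw [← h2, h1]
  have hnoise' : ∀ k, TKRR.SubExpNoise ρ (η k) (f' k) B γ := by
    intro k
    refine ⟨(hnoise k).1, ?_⟩
    filter_upwards [(hnoise k).2, hae k] with x h1 h2
    rw [← h2]
    exact h1
  have h0A : (0 : Fin (m + 1)) ∉ A := by simp [hA, TKRR.transferable]
  set J : Finset (Fin (m + 1)) → Finset (Σ k, Fin (n k)) := fun s =>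
    s.sigma fun k => Finset.univ with hJ
  have hunion : J {0} ∪ J A = J (insert 0 A) := by
    ext j
    simp [hJ]
  have hdisj : Disjoint (J {0}) (J A) := by
    rw [Finset.disjoint_left]
    intro j h1 h2
    simp only [hJ, Finset.mem_sigma, Finset.mem_singleton, Finset.mem_univ, and_true] at h1 h2
    exact h0A (h1 ▸ h2)
  have hcard0 : (n 0 : ℝ) = (J {0}).card := by simp [hJ]
  have hcardN : (N : ℝ) = (J {0} ∪ J A).card := by
    rw [hunion, hN]
    simp [hJ, TKRR.poolSize]
  -- the samples, on the product space that carries their joint law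
  set μ : (Σ k, Fin (n k)) → Measure (X × ℝ) := fun j => ρ.compProd (η j.1) with hμ
  have hZm : ∀ j, Measurable fun z : (Σ k, Fin (n k)) → X × ℝ => z j := measurable_pi_apply
  have hZi : iIndepFun (fun (j : Σ k, Fin (n k)) (z : (Σ k, Fin (n k)) → X × ℝ) => z j)
      (Measure.pi μ) :=
    iIndepFun_pi (X := fun _ z => z) fun _ => aemeasurable_id
  have hZlaw : ∀ j, (Measure.pi μ).map (fun z => z j) = ρ.compProd (η j.1) := fun j =>
    (measurePreserving_eval μ j).map_eq
  have hbad := hmain X ρ H hK hκ _ (Measure.pi μ) _ (fun j z => z j) hZm hZi (fun j => η j.1)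
    (fun j => f' j.1) hZlaw (fun j => hreg' j.1) (fun j => hnoise' j.1) heff (fun j => hf' j.1)
    (J {0}) (J A) hdisj (f' 0) h hh
    (by
      intro j hj
      simp only [hJ, Finset.mem_sigma, Finset.mem_singleton, Finset.mem_univ, and_true] at hj
      rw [hj])
    (by
      intro j hj
      simp only [hJ, Finset.mem_sigma, Finset.mem_univ, and_true] at hj
      rw [hA, TKRR.transferable, Finset.mem_filter] at hj
      rw [norm_sub_rev]
      exact (hff' 0 j.1).trans hj.2.2)
    (n 0) N hcard0 hcardN (by exact_mod_cast hn0) lam1 lam2 hlam1 hlam2 (Real.log (12 / δ)) hL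
    hL1 hL2
  have hδ' : 9 * Real.exp (-Real.log (12 / δ)) ≤ δ := by
    rw [Real.exp_neg, Real.exp_log (div_pos (by norm_num) hδ.1), inv_div]
    linarith [hδ.1]
  refine le_trans (measure_mono ?_) ((TKRR.measure_preimage_le_pi
    (fun j : (Σ k, Fin (n k)) => hlaw j.1 j.2) hindep
    _).trans (hbad.trans (ENNReal.ofReal_le_ofReal hδ')))
  intro ω hω
  obtain ⟨fp, fde, h1, h2, h3⟩ := (hfhat ω).normal_equations
  refine ⟨fp, fde, ?_, h2, ?_⟩
  · rw [hunion, hN]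
    exact h1
  have h4 : TKRR.incl hK hκ ρ (fhat ω - f 0) = TKRR.incl hK hκ ρ (fp + fde - f' 0) := by
    rw [h3, map_sub, map_sub, hSf]
  have h5 : (fun x => fhat ω x - f 0 x) = (fhat ω - f 0 : H) := by
    rw [RKHS.coe_sub]; rfl
  rw [Set.mem_ofPred_eq, h5, TKRR.eLpNorm_coe_eq hK hκ ρ, h4, not_le] at hω
  refine lt_of_le_of_lt ?_ ((ENNReal.ofReal_lt_ofReal_iff_of_nonneg ?_).1 hω)
  · have h6 : Real.log (12 / δ) ≤ Real.log (12 * ((A.card : ℝ) + 1) / δ) := by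
      have := hδ.1
      gcongr
      linarith [Nat.cast_nonneg (α := ℝ) A.card]
    rw [mul_assoc C2 (h ^ (α / (1 + α)))]
    gcongr
  · have h6 : 0 ≤ Real.log (12 * ((A.card : ℝ) + 1) / δ) := by
      refine Real.log_nonneg ?_
      rw [le_div_iff₀ hδ.1]
      nlinarith [Nat.cast_nonneg (α := ℝ) A.card, hδ.2]
    have h7 : 0 ≤ Real.log (12 / δ) := by linarith
    positivity
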